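/- Let $\sigma_x,\sigma_y,\sigma_z$ be the Pauli matrices, let $T>0$, and let $$H_d(t)=\sum_{i,j\in\{x,y,z\}}M_{ij}(t)\,\sigma_i\otimes\sigma_j,\qquad t\in[0,T],$$ be a time-varying nonlocal two-qubit Hamiltonian whose real coupling coefficients $M_{ij}$ are integrable on $[0,T]$. Let $H_1,\dots,H_m$ be Hermitian $4\times4$ matrices that generate the local unitary operations, i.e. the group generated by all $e^{-isH_j}$ ($s\in\mathbb R$, $1\le j\le m$) is $SU(2)\otimes SU(2)$. Consider $$\dot U(t)=-i\Big[H_d(t)+\sum_{j=1}^m v_j(t)H_j\Big]U(t),\qquad U(0)=I,$$ with integrable controls $v_j$ that are not a priori bounded, solutions being understood in the integrated (Carathéodory) sense. Let $\mathcal R(T)$, the set of unitaries that can be generated within time $T$ with $H_d(t)$ and arbitrarily fast local unitaries, be the closure of the set of all $U(\tau)$ with $0\le\tau\le T$ over all such controls. For $\beta\in\mathbb R^3$ put $H_\beta=\beta_1\sigma_x\otimes\sigma_x+\beta_2\sigma_y\otimes\sigma_y+\beta_3\sigma_z\otimes\sigma_z$ and $U_\beta=e^{-iH_\beta}$. The canonical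 parameters $\theta^H(t)\in\mathbb R^3$ of $H_d(t)$ are defined by $\theta_1^H\ge\theta_2^H\ge|\theta_3^H|$ and $H_d(t)=(A\otimes B)^\dagger H_{\theta^H(t)}(A\otimes B)$ for some single-qubit unitaries $A,B$. For $x\in\mathbb R^n$ let $x^\downarrow$ be its decreasing rearrangement, and write $x\prec y$ if $\sum_{j\le k}x^\downarrow_j\le\sum_{j\le k}y^\downarrow_j$ for all $k$, with equality for $k=n$. For $x\in\mathbb R^3$ let $x^s=(a_1,a_2,\operatorname{sgn}(x_1x_2x_3)\,a_3)$, where $a=(|x_1|,|x_2|,|x_3|)^\downarrow$, and write $x\prec_s y$ if $x^s_1\le y^s_1$ and $x^s_1+x^s_2\pm x^s_3\le y^s_1+y^s_2\pm y^s_3$ (for both signs). **Theorem.** The canonical parameters $\theta^H(t)$ exist and are integrable on $[0,T]$, and $$\mathcal R(T)=\Big\{K_1U_\beta K_2 \;:\; K_1,K_2\in SU(2)\otimes SU(2),\ \beta\in\mathbb R^3,\ \beta\prec_s\int_0^T\theta^H(t)\,dt\Big\}.$$ Moreover, let $$Q=\frac1{\sqrt2}\begin{pmatrix}1&0&0&i\\0&i&1&0\\0&i&-1&0\\1&0&0&-i\end{pmatrix}$$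 be the matrix of the magic basis, let $$\lambda=(\theta_1^H+\theta_2^H-\theta_3^H,\ \theta_1^H-\theta_2^H+\theta_3^H,\ -\theta_1^H+\theta_2^H+\theta_3^H,\ -\theta_1^H-\theta_2^H-\theta_3^H)$$ and $\gamma(T)=\int_0^T\lambda(t)\,dt$, and write $D_x$ for the diagonal matrix with diagonal $x$. Then for every $t$ there is $K\in SO(4)$ with $Q^{-1}H_d(t)Q=K^TD_{\lambda(t)}K$, so that $\lambda(t)$ is the vector of eigenvalues of $H_d(t)$, and in the magic basis $$Q^{-1}\mathcal R(T)\,Q=\big\{R\,e^{-iD_\beta}S \;:\; R,S\in SO(4),\ \beta\in\mathbb R^4,\ \beta\prec\gamma(T)\big\}.$$ -/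

import Mathlib

open MeasureTheory Set
open scoped Matrix Kronecker

namespace TwoQubit

/-! ### Majorization -/

/-- The decreasing rearrangement `x↓` of a real vector. -/
noncomputable def sortDesc {n : ℕ} (x : Fin n → ℝ) : Fin n → ℝ :=
  fun i => x (Tuple.sort x i.rev)

/-- `x ≺ y`: every partial sum of `x↓` is at most the corresponding one of `y↓`, and the
total sums agree. -/
def Majorized {n : ℕ} (x y : Fin n → ℝ) : Prop :=
  (∀ k : Fin n, ∑ i ∈ Finset.Iic k, sortDesc x i ≤ ∑ i ∈ Finset.Iic k, sortDesc y i) ∧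
    ∑ i, x i = ∑ i, y i

/-- The `s`-ordered version `x^s` of a vector `x ∈ ℝ³`: the decreasing rearrangement of
`(|x₁|, |x₂|, |x₃|)`, with the last entry multiplied by `sgn (x₁ x₂ x₃)`. -/
noncomputable def sOrder (x : Fin 3 → ℝ) : Fin 3 → ℝ :=
  ![sortDesc (fun i => |x i|) 0,
    sortDesc (fun i => |x i|) 1,
    Real.sign (x 0 * x 1 * x 2) * sortDesc (fun i => |x i|) 2]

/-- `x ≺_s y`. -/
def SMajorized (x y : Fin 3 → ℝ) : Prop :=
  sOrder x 0 ≤ sOrder y 0 ∧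
  sOrder x 0 + sOrder x 1 + sOrder x 2 ≤ sOrder y 0 + sOrder y 1 + sOrder y 2 ∧
  sOrder x 0 + sOrder x 1 - sOrder x 2 ≤ sOrder y 0 + sOrder y 1 - sOrder y 2

/-! ### Two-qubit operators, in the standard basis `|00⟩, |01⟩, |10⟩, |11⟩` -/

/-- The Pauli matrices `σ_x, σ_y, σ_z`. -/
noncomputable def pauli : Fin 3 → Matrix (Fin 2) (Fin 2) ℂ :=
  ![!![0, 1; 1, 0], !![0, -Complex.I; Complex.I, 0], !![1, 0; 0, -1]]

/-- `A ⊗ B` as a `4 × 4` matrix; the basis vector `|a b⟩` has index `2 a + b`. -/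
def tensor (A B : Matrix (Fin 2) (Fin 2) ℂ) : Matrix (Fin 4) (Fin 4) ℂ :=
  Matrix.reindex finProdFinEquiv finProdFinEquiv (A ⊗ₖ B)

/-- The local unitaries `SU(2) ⊗ SU(2)`. -/
def localUnitaries : Set (Matrix (Fin 4) (Fin 4) ℂ) :=
  {K | ∃ A ∈ Matrix.specialUnitaryGroup (Fin 2) ℂ, ∃ B ∈ Matrix.specialUnitaryGroup (Fin 2) ℂ,
    K = tensor A B}

/-- The nonlocal Hamiltonian `∑ M_{ij} σ_i ⊗ σ_j`. -/
noncomputable def nonlocalHamiltonian (M : Matrix (Fin 3) (Fin 3) ℝ) :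
    Matrix (Fin 4) (Fin 4) ℂ :=
  ∑ i, ∑ j, (M i j : ℂ) • tensor (pauli i) (pauli j)

/-- `H_β = β₁ σ_x ⊗ σ_x + β₂ σ_y ⊗ σ_y + β₃ σ_z ⊗ σ_z`. -/
noncomputable def canonicalHamiltonian (β : Fin 3 → ℝ) : Matrix (Fin 4) (Fin 4) ℂ :=
  ∑ i, (β i : ℂ) • tensor (pauli i) (pauli i)

/-- `U_β = exp (-i H_β)`. -/
noncomputable def canonicalUnitary (β : Fin 3 → ℝ) : Matrix (Fin 4) (Fin 4) ℂ :=
  NormedSpace.exp ((-Complex.I) • canonicalHamiltonian β)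

/-- `ϑ` is the vector of canonical parameters of `H`: it satisfies `ϑ₁ ≥ ϑ₂ ≥ |ϑ₃|`, and
`H = (A ⊗ B)† H_ϑ (A ⊗ B)` for some single-qubit unitaries `A`, `B`. -/
def IsCanonicalParameters (H : Matrix (Fin 4) (Fin 4) ℂ) (ϑ : Fin 3 → ℝ) : Prop :=
  (ϑ 1 ≤ ϑ 0 ∧ |ϑ 2| ≤ ϑ 1) ∧
    ∃ A ∈ Matrix.unitaryGroup (Fin 2) ℂ, ∃ B ∈ Matrix.unitaryGroup (Fin 2) ℂ,
      H = (tensor A B)ᴴ * canonicalHamiltonian ϑ * tensor A B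

/-- The canonical parameters `θ^H` of a nonlocal Hamiltonian `H` (the vector singled out by
`IsCanonicalParameters`). -/
noncomputable def canonicalParameters (H : Matrix (Fin 4) (Fin 4) ℂ) : Fin 3 → ℝ :=
  Classical.epsilon (IsCanonicalParameters H)

/-! ### The control system -/

/-- The control Hamiltonians `H_j` generate the local unitary operations: they are Hermitian, and
the group generated by the one-parameter groups `s ↦ exp (-i s H_j)` is `SU(2) ⊗ SU(2)`.
(The generating set is closed under inverses, so the submonoid it generates is a group.) -/
def GenerateLocalUnitaries {m : ℕ} (H : Fin m → Matrix (Fin 4) (Fin 4) ℂ) : Prop :=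
  (∀ j, (H j).IsHermitian) ∧
    (Submonoid.closure {V | ∃ (j : Fin m) (s : ℝ),
      V = NormedSpace.exp ((-Complex.I * (s : ℂ)) • H j)} :
        Set (Matrix (Fin 4) (Fin 4) ℂ)) = localUnitaries

/-- `U` solves `U' = -i [Hd(t) + ∑ v_j(t) H_j] U`, `U(0) = 1`, on `[0, τ]`, in the sense of
Carathéodory: `U` is continuous and satisfies the integrated equation (entry by entry). -/
def IsTrajectory {m : ℕ} (Hd : ℝ → Matrix (Fin 4) (Fin 4) ℂ)
    (H : Fin m → Matrix (Fin 4) (Fin 4) ℂ) (v : Fin m → ℝ → ℝ) (τ : ℝ)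
    (U : ℝ → Matrix (Fin 4) (Fin 4) ℂ) : Prop :=
  ContinuousOn U (Icc 0 τ) ∧
    ∀ t ∈ Icc 0 τ, ∀ k l, U t k l = (1 : Matrix (Fin 4) (Fin 4) ℂ) k l +
      ∫ s in (0 : ℝ)..t, (((-Complex.I) • (Hd s + ∑ j, (v j s : ℂ) • H j)) * U s) k l

/-- The unitaries at which a trajectory starting at the identity, with some integrable (not
a priori bounded) controls, arrives at time `τ`. -/
def reachableAt {m : ℕ} (Hd : ℝ → Matrix (Fin 4) (Fin 4) ℂ)
    (H : Fin m → Matrix (Fin 4) (Fin 4) ℂ) (τ : ℝ) : Set (Matrix (Fin 4) (Fin 4) ℂ) :=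
  {W | ∃ (v : Fin m → ℝ → ℝ) (U : ℝ → Matrix (Fin 4) (Fin 4) ℂ),
    (∀ j, IntervalIntegrable (v j) volume 0 τ) ∧ IsTrajectory Hd H v τ U ∧ U τ = W}

/-- The unitaries that can be generated within time `T` with arbitrarily fast local control: the
closure of the set of all unitaries reached at some time `τ ∈ [0, T]`. The closure accounts for
the limit of infinitely strong and infinitely short control pulses. -/
def reachableWithin {m : ℕ} (Hd : ℝ → Matrix (Fin 4) (Fin 4) ℂ)
    (H : Fin m → Matrix (Fin 4) (Fin 4) ℂ) (T : ℝ) : Set (Matrix (Fin 4) (Fin 4) ℂ) :=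
  closure (⋃ τ ∈ Icc 0 T, reachableAt Hd H τ)

/-! ### The magic basis -/

/-- The matrix `Q` whose columns are the vectors of the magic basis. -/
noncomputable def magicBasis : Matrix (Fin 4) (Fin 4) ℂ :=
  ((Real.sqrt 2 : ℝ) : ℂ)⁻¹ •
    !![1, 0, 0, Complex.I;
       0, Complex.I, 1, 0;
       0, Complex.I, -1, 0;
       1, 0, 0, -Complex.I]

/-- `Q⁻¹ X Q`: the matrix of the operator `X` in the magic basis. -/
noncomputable def inMagicBasis (X : Matrix (Fin 4) (Fin 4) ℂ) : Matrix (Fin 4) (Fin 4) ℂ :=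
  magicBasis⁻¹ * X * magicBasis

/-- The vector `φ ∈ ℝ⁴` of (decreasing) eigenvalues of `H_ϑ`. -/
def eigenvalueVector (ϑ : Fin 3 → ℝ) : Fin 4 → ℝ :=
  ![ϑ 0 + ϑ 1 - ϑ 2, ϑ 0 - ϑ 1 + ϑ 2, -ϑ 0 + ϑ 1 + ϑ 2, -ϑ 0 - ϑ 1 - ϑ 2]

/-- The complex diagonal matrix `D_x` with real diagonal `x`. -/
def diag (x : Fin 4 → ℝ) : Matrix (Fin 4) (Fin 4) ℂ :=
  Matrix.diagonal fun k => (x k : ℂ)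

/-- `SO(4)`, as a set of complex matrices. -/
def SO4 : Set (Matrix (Fin 4) (Fin 4) ℂ) :=
  {K | ∃ R ∈ Matrix.specialOrthogonalGroup (Fin 4) ℝ, K = R.map (fun x : ℝ => (x : ℂ))}

end TwoQubit

/-!
The magic basis turns the local unitaries `SU(2) ⊗ SU(2)` into `SO(4)`
(`inMagicBasis_image_localUnitaries`) and a nonlocal Hamiltonian into a real symmetric matrix of
trace `0`, whose ordered spectrum is the vector `λ` belonging to the canonical parameters
(`isSpec_spectrumVec`). Both descriptions of the reachable set are therefore consequences of
`inMagicBasis_image_reachableWithin`: in the magic basis, the reachable set is `kakSet (∫ λ)`, the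
set of all `R exp(-i D_b) P` with `R, P ∈ SO(4)` and `b` majorized by `∫ λ`. The order `≺_s` on
parameters is majorization of the eigenvalue vectors (`sMajorized_iff_isMaj`), since `x ↦ x^s`
permutes the eigenvalues. Majorization by a decreasing vector is used in the additive form `IsMaj`,
and, by Hardy–Littlewood–Pólya, as averaging by a doubly stochastic matrix.

For the inclusion `⊆` (`reachableAt_subset`), the moving compact set `kakSet (∫₀ᵗ λ)` is shown to be
tangent to the dynamics at each of its points (`exists_tangent_curve`). At `R exp(-i D_b) P`, the
velocity is split into infinitesimal rotations of `R` and `P` and a change of `b` by the diagonal of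
`Rᵀ S R`, where `S` is the Hamiltonian (`exists_linearized_decomposition`); by Schur, this diagonal
is a doubly stochastic average of `λ`. Solving for the rotations requires division by
`sin (b i - b j)`. Where this vanishes, the decomposition is not unique, and it is chosen such that
the corresponding entry of `Rᵀ S R` vanishes too (`exists_adapted_decomposition`). As the flow
consists of isometries, a differential inequality for the distance to the moving set gives the
inclusion for continuous data with an error control in `L¹` (`infDist_solution_le`), and an
approximation argument extends it to integrable couplings and controls.

For the inclusion `⊇` (`ofMagicBasis_mem_closure_propagators`), strong controls acting for a short
time produce any local unitary, up to the small `L¹` norm of the drift (`near_local`). Conjugating a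
constant Hamiltonian by local unitaries permutes its spectrum, and dividing the time between such
permutations realizes every doubly stochastic average, by Birkhoff (`near_phase_constant`).
Concatenation over short intervals treats continuous couplings, and integrable ones are again
approximated in `L¹`.
-/

namespace TwoQubit

/-! ### Majorization -/

/-- The inequalities describing the permutohedron of `a`, for `a` in decreasing order: a sum of `k`
coordinates of `b` is at most the sum of the first `k` coordinates of `a`, and the total sums agree.
In this form the condition is visibly additive in the pair `(b, a)`. -/
def IsMaj {n : ℕ} (b a : Fin n → ℝ) : Prop :=
  (∀ s : Finset (Fin n), ∑ i ∈ s, b i ≤ ∑ i with i.val < s.card, a i) ∧ ∑ i, b i = ∑ i, a i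

lemma IsMaj.add {n : ℕ} {b a b' a' : Fin n → ℝ} (h : IsMaj b a) (h' : IsMaj b' a') :
    IsMaj (b + b') (a + a') := by
  refine ⟨fun s => ?_, ?_⟩
  · simpa [Finset.sum_add_distrib] using add_le_add (h.1 s) (h'.1 s)
  · simpa [Finset.sum_add_distrib] using congrArg₂ (· + ·) h.2 h'.2

lemma card_filter_val_lt {n : ℕ} (s : Finset (Fin n)) :
    (Finset.univ.filter fun i : Fin n => i.val < s.card).card = s.card := by
  have hs : s.card ≤ n := by simpa using s.card_le_univ
  rw [Fin.card_filter_val_lt, min_eq_right hs]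

/-- A weighted sum of a decreasing vector, with weights in `[0, 1]` of integral total mass, is
largest when the weights sit on the first coordinates. -/
lemma sum_mul_le_sum_initial {n : ℕ} {a w : Fin n → ℝ} (ha : Antitone a) (h0 : ∀ i, 0 ≤ w i)
    (h1 : ∀ i, w i ≤ 1) (s : Finset (Fin n)) (hw : ∑ i, w i = s.card) :
    ∑ i, w i * a i ≤ ∑ i with i.val < s.card, a i := by
  classical
  rcases s.eq_empty_or_nonempty with rfl | hs
  · have hz : ∀ i, w i = 0 := by
      have := (Finset.sum_eq_zero_iff_of_nonneg fun i _ => h0 i).1 (by simpa using hw)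
      exact fun i => this i (Finset.mem_univ i)
    simp [hz]
  · have hpos : 0 < s.card := hs.card_pos
    have hle : s.card ≤ n := by simpa using s.card_le_univ
    -- compare every coordinate with the last one among the first `s.card`
    set c := a ⟨s.card - 1, by omega⟩ with hc
    have hcard : ∑ i : Fin n, (if i.val < s.card then (1 : ℝ) else 0) = s.card := by
      rw [← Finset.sum_filter, Finset.sum_const, card_filter_val_lt]; simp
    have key : ∑ i, w i * (a i - c) ≤
        ∑ i : Fin n, (if i.val < s.card then (1 : ℝ) else 0) * (a i - c) := by
      refine Finset.sum_le_sum fun i _ => ?_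
      split_ifs with hi
      · have : c ≤ a i := ha (by rw [Fin.le_def]; simp; omega)
        nlinarith [h1 i]
      · have : a i ≤ c := ha (by rw [Fin.le_def]; simp; omega)
        nlinarith [h0 i]
    simp only [mul_sub, Finset.sum_sub_distrib, ← Finset.sum_mul, hw, hcard] at key
    rw [Finset.sum_filter]
    calc _ ≤ ∑ i : Fin n, (if i.val < s.card then (1 : ℝ) else 0) * a i := by linarith
      _ = _ := Finset.sum_congr rfl fun i _ => by split_ifs <;> simp

lemma sum_le_sum_initial {n : ℕ} {a : Fin n → ℝ} (ha : Antitone a) (s : Finset (Fin n)) :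
    ∑ i ∈ s, a i ≤ ∑ i with i.val < s.card, a i := by
  classical
  have := sum_mul_le_sum_initial (w := fun i => if i ∈ s then 1 else 0) ha
    (fun i => by positivity) (fun i => by split_ifs <;> simp) s (by simp)
  simpa using this

/-- Doubly stochastic averaging produces majorized vectors. -/
lemma isMaj_mulVec {n : ℕ} {D : Matrix (Fin n) (Fin n) ℝ} (hD : D ∈ doublyStochastic ℝ (Fin n))
    {a : Fin n → ℝ} (ha : Antitone a) : IsMaj (D *ᵥ a) a := by
  classical
  refine ⟨fun s => ?_, ?_⟩
  · have : ∑ i ∈ s, (D *ᵥ a) i = ∑ j, (∑ i ∈ s, D i j) * a j := by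
      simp only [Matrix.mulVec, dotProduct, Finset.sum_mul]
      exact Finset.sum_comm
    rw [this]
    refine sum_mul_le_sum_initial ha
      (fun j => Finset.sum_nonneg fun i _ => nonneg_of_mem_doublyStochastic hD) (fun j => ?_) s ?_
    · rw [← sum_col_of_mem_doublyStochastic hD j]
      exact Finset.sum_le_sum_of_subset_of_nonneg (Finset.subset_univ s)
        fun i _ _ => nonneg_of_mem_doublyStochastic hD
    · rw [Finset.sum_comm]
      simp [sum_row_of_mem_doublyStochastic hD]
  · exact sum_mulVec_of_mem_doublyStochastic hD

lemma isClosed_isMaj {n : ℕ} (a : Fin n → ℝ) : IsClosed {b | IsMaj b a} := by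
  simp only [IsMaj, ofPred_and, ofPred_forall]
  refine (isClosed_iInter fun s => isClosed_le (by fun_prop) continuous_const).inter
    (isClosed_eq (by fun_prop) continuous_const)

lemma isCompact_doublyStochastic (n : ℕ) :
    IsCompact (doublyStochastic ℝ (Fin n) : Set (Matrix (Fin n) (Fin n) ℝ)) := by
  rw [doublyStochastic_eq_convexHull_permMatrix]
  exact (Set.finite_range fun σ : Equiv.Perm (Fin n) => σ.permMatrix ℝ).isCompact_convexHull ℝ

/-- Abel summation: pairing with an antitone `c` increases under majorization. -/
lemma IsMaj.sum_mul_le {n : ℕ} {b a : Fin n → ℝ} (h : IsMaj b a) (σ : Equiv.Perm (Fin n))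
    {c : Fin n → ℝ} (hc : Antitone c) : ∑ i, c i * b (σ i) ≤ ∑ i, c i * a i := by
  classical
  rcases n with _ | n
  · simp
  -- `c` is its last entry plus a nonnegative combination of indicators of initial segments
  have hrep : ∀ i : Fin (n + 1), c i = c (Fin.last n) +
      ∑ k : Fin n, (if i.val < k.val + 1 then c k.castSucc - c k.succ else 0) := by
    intro i
    induction i using Fin.reverseInduction with
    | last =>
      rw [Finset.sum_eq_zero]; · simp
      intro k _; rw [if_neg]; simp
    | cast j ih =>
      have : ∑ k : Fin n, (if j.castSucc.val < k.val + 1 then c k.castSucc - c k.succ else 0)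
          = ∑ k : Fin n, ((if j.succ.val < k.val + 1 then c k.castSucc - c k.succ else 0)
            + if k = j then c k.castSucc - c k.succ else 0) := by
        refine Finset.sum_congr rfl fun k _ => ?_
        rcases lt_trichotomy k j with hk | rfl | hk
        · rw [if_neg (by simp; omega), if_neg (by simp; omega), if_neg hk.ne]; simp
        · simp
        · rw [if_pos (by simp; omega), if_pos (by simp; omega), if_neg hk.ne']; simp
      rw [this, Finset.sum_add_distrib, ← add_assoc, ← ih]
      simp
  have hexp : ∀ f : Fin (n + 1) → ℝ, ∑ i, c i * f i = c (Fin.last n) * ∑ i, f i +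
      ∑ k : Fin n, (c k.castSucc - c k.succ) * ∑ i with i.val < k.val + 1, f i := by
    intro f
    calc ∑ i, c i * f i = ∑ i, (c (Fin.last n) * f i +
          ∑ k : Fin n, (c k.castSucc - c k.succ) * (if i.val < k.val + 1 then f i else 0)) := by
          refine Finset.sum_congr rfl fun i _ => ?_
          conv_lhs => rw [hrep i]
          rw [add_mul, Finset.sum_mul]
          congr 1
          exact Finset.sum_congr rfl fun k _ => by split_ifs <;> simp
      _ = _ := by
          rw [Finset.sum_add_distrib, ← Finset.mul_sum, Finset.sum_comm]
          congr 1
          refine Finset.sum_congr rfl fun k _ => ?_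
          rw [← Finset.mul_sum, Finset.sum_filter]
  rw [hexp a, hexp fun i => b (σ i), Equiv.sum_comp σ b, h.2]
  refine add_le_add le_rfl (Finset.sum_le_sum fun k _ => mul_le_mul_of_nonneg_left ?_ ?_)
  · have := h.1 ((Finset.univ.filter fun i : Fin (n + 1) => i.val < k.val + 1).map σ.toEmbedding)
    rw [Finset.sum_map, Finset.card_map, Fin.card_filter_val_lt, min_eq_right (by omega)] at this
    exact this
  · exact sub_nonneg.2 (hc (Fin.castSucc_lt_succ).le)

/-- **Hardy–Littlewood–Pólya**: a vector majorized by `a` is a doubly stochastic average of `a`.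
A separating hyperplane would contradict the rearrangement inequality. -/
lemma IsMaj.exists_doublyStochastic {n : ℕ} {b a : Fin n → ℝ} (h : IsMaj b a) :
    ∃ D ∈ doublyStochastic ℝ (Fin n), b = D *ᵥ a := by
  classical
  by_contra hcon
  set t : Set (Fin n → ℝ) := (fun D : Matrix (Fin n) (Fin n) ℝ => D *ᵥ a) ''
    (doublyStochastic ℝ (Fin n) : Set (Matrix (Fin n) (Fin n) ℝ)) with ht
  have hbt : b ∉ t := by
    rintro ⟨D, hD, hb⟩; exact hcon ⟨D, hD, hb.symm⟩
  have hconv : Convex ℝ t := by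
    have : t = (Matrix.mulVecBilin ℝ ℝ).flip a '' (doublyStochastic ℝ (Fin n) :
      Set (Matrix (Fin n) (Fin n) ℝ)) := rfl
    rw [this]
    exact convex_doublyStochastic.linear_image _
  have hclosed : IsClosed t :=
    ((isCompact_doublyStochastic n).image (by fun_prop)).isClosed
  obtain ⟨f, u, hfb, hft⟩ := geometric_hahn_banach_point_closed hconv hclosed hbt
  set c : Fin n → ℝ := fun i => - f (Pi.single i 1) with hc
  have hf : ∀ x : Fin n → ℝ, ∑ i, c i * x i = - f x := by
    intro x
    conv_rhs => rw [← Finset.univ_sum_single x]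
    rw [map_sum, ← Finset.sum_neg_distrib]
    refine Finset.sum_congr rfl fun i _ => ?_
    have : (Pi.single i (x i) : Fin n → ℝ) = x i • Pi.single i 1 := by
      ext j; by_cases hj : j = i
      · subst hj; simp
      · simp [hj]
    rw [this, map_smul]; simp [hc]; ring
  -- sort the separating functional decreasingly
  set σ : Equiv.Perm (Fin n) := Tuple.sort (fun i => - c i) with hσ
  have hanti : Antitone (c ∘ σ) := by
    have := Tuple.monotone_sort (fun i => - c i)
    intro i j hij
    have := this hij
    simp at this; exact this
  have h1 := h.sum_mul_le σ hanti
  have h2 : ∑ i, (c ∘ σ) i * b (σ i) = - f b := by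
    rw [← hf b]; exact Equiv.sum_comp σ fun i => c i * b i
  have h3 : ∑ i, (c ∘ σ) i * a i = - f ((Equiv.Perm.permMatrix ℝ σ.symm) *ᵥ a) := by
    rw [← hf, Matrix.permMatrix_mulVec, ← Equiv.sum_comp σ (fun i => c i * (a ∘ σ.symm) i)]
    simp
  have h4 := hft _ ⟨_, permMatrix_mem_doublyStochastic (σ := σ.symm), rfl⟩
  simp only at h4
  linarith

lemma antitone_sortDesc {n : ℕ} (x : Fin n → ℝ) : Antitone (sortDesc x) := fun _ _ hij =>
  Tuple.monotone_sort x (Fin.rev_le_rev.2 hij)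

/-- The permutation carrying `x` to its decreasing rearrangement. -/
noncomputable def sortDescPerm {n : ℕ} (x : Fin n → ℝ) : Equiv.Perm (Fin n) :=
  Fin.revPerm.trans (Tuple.sort x)

lemma sortDesc_eq {n : ℕ} (x : Fin n → ℝ) : sortDesc x = x ∘ sortDescPerm x := rfl

lemma sortDesc_of_antitone {n : ℕ} {x : Fin n → ℝ} (hx : Antitone x) : sortDesc x = x := by
  have h1 : Monotone (x ∘ Fin.revPerm) := fun i j hij => hx (Fin.rev_le_rev.2 hij)
  have h2 := Tuple.unique_monotone (f := x) (σ := Fin.revPerm) (τ := Tuple.sort x) h1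
    (Tuple.monotone_sort x)
  ext i
  have := congrFun h2 i.rev
  simp at this
  exact this.symm

lemma filter_val_lt_succ {n : ℕ} (k : Fin n) :
    (Finset.univ.filter fun i : Fin n => i.val < k.val + 1) = Finset.Iic k := by
  refine Finset.ext fun i => ?_
  simp only [Finset.mem_filter, Finset.mem_univ, true_and, Finset.mem_Iic, Fin.le_def]
  omega

/-- The condition `IsMaj b a` does not depend on the order of the coordinates of `b`. -/
lemma isMaj_comp_perm {n : ℕ} {b a : Fin n → ℝ} (σ : Equiv.Perm (Fin n)) :
    IsMaj (b ∘ σ) a ↔ IsMaj b a := by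
  have key : ∀ (b : Fin n → ℝ) (σ : Equiv.Perm (Fin n)), IsMaj b a → IsMaj (b ∘ σ) a := by
    intro b σ h
    refine ⟨fun s => ?_, (Equiv.sum_comp σ b).trans h.2⟩
    have := h.1 (s.map σ.toEmbedding)
    simpa using this
  refine ⟨fun h => ?_, key b σ⟩
  have := key _ σ.symm h
  simpa [Function.comp_assoc] using this

/-- For a decreasing `b`, only the sums over initial segments have to be compared. -/
lemma isMaj_iff_of_antitone {n : ℕ} {b a : Fin n → ℝ} (hb : Antitone b) :
    IsMaj b a ↔ (∀ k : Fin n, ∑ i ∈ Finset.Iic k, b i ≤ ∑ i ∈ Finset.Iic k, a i) ∧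
      ∑ i, b i = ∑ i, a i := by
  refine and_congr_left fun _ =>
    ⟨fun h k => ?_, fun h s => (sum_le_sum_initial hb s).trans ?_⟩
  · have := h (Finset.Iic k)
    rwa [Fin.card_Iic, filter_val_lt_succ] at this
  · rcases s.eq_empty_or_nonempty with rfl | hs
    · simp
    · have hpos : 0 < s.card := hs.card_pos
      have hle : s.card ≤ n := by simpa using s.card_le_univ
      have := h ⟨s.card - 1, by omega⟩
      rw [← filter_val_lt_succ] at this
      simpa [Nat.sub_add_cancel hpos] using this

lemma majorized_iff_isMaj {n : ℕ} {b a : Fin n → ℝ} (ha : Antitone a) :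
    Majorized b a ↔ IsMaj b a := by
  rw [← isMaj_comp_perm (sortDescPerm b), ← sortDesc_eq,
    isMaj_iff_of_antitone (antitone_sortDesc b), Majorized, sortDesc_of_antitone ha,
    sortDesc_eq, ← Equiv.sum_comp (sortDescPerm b) b]
  rfl

section
open scoped Matrix.Norms.L2Operator

/-! ### The group `SO(4)` -/

/-- Membership in `SO(4)` in terms of the complex matrix itself: it is real, orthogonal and of
determinant `1`. -/

lemma mem_SO4_iff {K : Matrix (Fin 4) (Fin 4) ℂ} :
    K ∈ SO4 ↔ K.map star = K ∧ Kᵀ * K = 1 ∧ K.det = 1 := by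
  constructor
  · rintro ⟨R, hR, rfl⟩
    rw [Matrix.mem_specialOrthogonalGroup_iff, Matrix.mem_orthogonalGroup_iff'] at hR
    refine ⟨by ext; simp, ?_, ?_⟩
    · have := congrArg (fun X : Matrix (Fin 4) (Fin 4) ℝ => X.map (algebraMap ℝ ℂ)) hR.1
      simp only [Matrix.map_mul, Matrix.transpose_map,
        Matrix.map_one _ (map_zero _) (map_one _)] at this
      exact this
    · have := (RingHom.map_det (algebraMap ℝ ℂ) R).symm
      rw [hR.2] at this
      simpa using this
  · rintro ⟨h1, h2, h3⟩
    have hK : K = (K.map Complex.re).map (fun x : ℝ => (x : ℂ)) := by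
      ext i j
      have := congrFun (congrFun h1 i) j
      exact (Complex.conj_eq_iff_re.1 this).symm
    refine ⟨K.map Complex.re, ?_, hK⟩
    rw [Matrix.mem_specialOrthogonalGroup_iff, Matrix.mem_orthogonalGroup_iff']
    have hinj : Function.Injective (fun X : Matrix (Fin 4) (Fin 4) ℝ => X.map (algebraMap ℝ ℂ)) :=
      Matrix.map_injective (algebraMap ℝ ℂ).injective
    refine ⟨hinj ?_, (algebraMap ℝ ℂ).injective ?_⟩
    · change (star (K.map Complex.re) * K.map Complex.re).map (algebraMap ℝ ℂ) =
        (1 : Matrix (Fin 4) (Fin 4) ℝ).map (algebraMap ℝ ℂ)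
      rw [Matrix.map_mul, Matrix.map_one _ (map_zero _) (map_one _)]
      have : (K.map Complex.re).map (algebraMap ℝ ℂ) = K := hK.symm
      rw [this, Matrix.star_eq_conjTranspose, Matrix.conjTranspose_eq_transpose_of_trivial,
        Matrix.transpose_map, this, h2]
    · rw [RingHom.map_det]
      have : (K.map Complex.re).map (algebraMap ℝ ℂ) = K := hK.symm
      rw [RingHom.mapMatrix_apply, this, h3, map_one]

lemma SO4_transpose_mul {K : Matrix (Fin 4) (Fin 4) ℂ} (hK : K ∈ SO4) : Kᵀ * K = 1 :=
  (mem_SO4_iff.1 hK).2.1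

lemma SO4_mul_transpose {K : Matrix (Fin 4) (Fin 4) ℂ} (hK : K ∈ SO4) : K * Kᵀ = 1 :=
  mul_eq_one_comm.1 (SO4_transpose_mul hK)

lemma SO4_conjTranspose {K : Matrix (Fin 4) (Fin 4) ℂ} (hK : K ∈ SO4) : Kᴴ = Kᵀ := by
  have := (mem_SO4_iff.1 hK).1
  conv_rhs => rw [← this]
  rfl

lemma one_mem_SO4 : (1 : Matrix (Fin 4) (Fin 4) ℂ) ∈ SO4 :=
  mem_SO4_iff.2 ⟨by simp, by simp, by simp⟩

lemma mul_mem_SO4 {K L : Matrix (Fin 4) (Fin 4) ℂ} (hK : K ∈ SO4) (hL : L ∈ SO4) :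
    K * L ∈ SO4 := by
  rw [mem_SO4_iff] at *
  refine ⟨?_, ?_, ?_⟩
  · have := Matrix.map_mul (L := K) (M := L) (f := starRingEnd ℂ)
    calc _ = K.map star * L.map star := this
      _ = _ := by rw [hK.1, hL.1]
  · rw [Matrix.transpose_mul, mul_assoc, ← mul_assoc Kᵀ, hK.2.1, one_mul, hL.2.1]
  · rw [Matrix.det_mul, hK.2.2, hL.2.2, one_mul]

lemma transpose_mem_SO4 {K : Matrix (Fin 4) (Fin 4) ℂ} (hK : K ∈ SO4) : Kᵀ ∈ SO4 := by
  have h := SO4_mul_transpose hK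
  rw [mem_SO4_iff] at *
  exact ⟨by rw [Matrix.transpose_map, hK.1], by simpa using h, by simpa using hK.2.2⟩

lemma SO4_mem_unitary {K : Matrix (Fin 4) (Fin 4) ℂ} (hK : K ∈ SO4) :
    K ∈ unitary (Matrix (Fin 4) (Fin 4) ℂ) := by
  rw [Unitary.mem_iff, Matrix.star_eq_conjTranspose, SO4_conjTranspose hK]
  exact ⟨SO4_transpose_mul hK, SO4_mul_transpose hK⟩

lemma norm_unitary_mul {K : Matrix (Fin 4) (Fin 4) ℂ}
    (hK : K ∈ unitary (Matrix (Fin 4) (Fin 4) ℂ)) (X : Matrix (Fin 4) (Fin 4) ℂ) :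
    ‖K * X‖ = ‖X‖ := CStarRing.norm_coe_unitary_mul ⟨K, hK⟩ X

lemma norm_mul_unitary {K : Matrix (Fin 4) (Fin 4) ℂ}
    (hK : K ∈ unitary (Matrix (Fin 4) (Fin 4) ℂ)) (X : Matrix (Fin 4) (Fin 4) ℂ) :
    ‖X * K‖ = ‖X‖ := CStarRing.norm_mul_coe_unitary X ⟨K, hK⟩

lemma norm_unitary {K : Matrix (Fin 4) (Fin 4) ℂ}
    (hK : K ∈ unitary (Matrix (Fin 4) (Fin 4) ℂ)) : ‖K‖ = 1 := by
  rw [← mul_one K, norm_unitary_mul hK, norm_one]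

lemma isCompact_SO4 : IsCompact SO4 := by
  refine Metric.isCompact_of_isClosed_isBounded ?_ ?_
  · have : SO4 = {K | K.map star = K ∧ Kᵀ * K = 1 ∧ K.det = 1} := by
      ext K; exact mem_SO4_iff
    rw [this]
    refine (isClosed_eq ?_ continuous_id).inter ((isClosed_eq ?_ continuous_const).inter
      (isClosed_eq ?_ continuous_const))
    · exact continuous_id.matrix_map continuous_star
    · exact (continuous_id.matrix_transpose).mul continuous_id
    · exact continuous_id.matrix_det
  · refine (Metric.isBounded_closedBall (x := (0 : Matrix (Fin 4) (Fin 4) ℂ)) (r := 1)).subset ?_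
    intro K hK
    simp [norm_unitary (SO4_mem_unitary hK)]

/-! ### Tensor products in the magic basis -/

lemma tensor_apply (A B : Matrix (Fin 2) (Fin 2) ℂ) : tensor A B =
    !![A 0 0 * B 0 0, A 0 0 * B 0 1, A 0 1 * B 0 0, A 0 1 * B 0 1;
       A 0 0 * B 1 0, A 0 0 * B 1 1, A 0 1 * B 1 0, A 0 1 * B 1 1;
       A 1 0 * B 0 0, A 1 0 * B 0 1, A 1 1 * B 0 0, A 1 1 * B 0 1;
       A 1 0 * B 1 0, A 1 0 * B 1 1, A 1 1 * B 1 0, A 1 1 * B 1 1] := by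
  ext i j; fin_cases i <;> fin_cases j <;> rfl

lemma tensor_mul (A B A' B' : Matrix (Fin 2) (Fin 2) ℂ) :
    tensor A B * tensor A' B' = tensor (A * A') (B * B') := by
  simp only [tensor, Matrix.mul_kronecker_mul, Matrix.reindex_apply, Matrix.submatrix_mul_equiv]

lemma tensor_one : tensor 1 1 = 1 := by
  simp [tensor]

lemma tensor_smul (a b : ℂ) (A B : Matrix (Fin 2) (Fin 2) ℂ) :
    tensor (a • A) (b • B) = (a * b) • tensor A B := by
  ext i j
  simp [tensor, mul_mul_mul_comm]

lemma tensor_conjTranspose (A B : Matrix (Fin 2) (Fin 2) ℂ) :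
    (tensor A B)ᴴ = tensor Aᴴ Bᴴ := by
  simp [tensor, Matrix.conjTranspose_kronecker]

lemma tensor_transpose (A B : Matrix (Fin 2) (Fin 2) ℂ) :
    (tensor A B)ᵀ = tensor Aᵀ Bᵀ := by
  simp [tensor, Matrix.kroneckerMap_transpose]

lemma tensor_mem_unitary {A B : Matrix (Fin 2) (Fin 2) ℂ}
    (hA : A ∈ Matrix.unitaryGroup (Fin 2) ℂ) (hB : B ∈ Matrix.unitaryGroup (Fin 2) ℂ) :
    tensor A B ∈ unitary (Matrix (Fin 4) (Fin 4) ℂ) := by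
  rw [Matrix.mem_unitaryGroup_iff] at hA hB
  have : tensor A B * (tensor A B)ᴴ = 1 := by
    rw [tensor_conjTranspose, tensor_mul, ← Matrix.star_eq_conjTranspose,
      ← Matrix.star_eq_conjTranspose, hA, hB, tensor_one]
  exact Unitary.mem_iff.2 ⟨mul_eq_one_comm.1 this, this⟩

lemma sqrt_two_inv_sq : (((Real.sqrt 2 : ℝ) : ℂ)⁻¹) * (((Real.sqrt 2 : ℝ) : ℂ)⁻¹) = 1 / 2 := by
  rw [← mul_inv, ← Complex.ofReal_mul, Real.mul_self_sqrt (by norm_num)]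
  norm_num

lemma magicBasis_conjTranspose : magicBasisᴴ = ((Real.sqrt 2 : ℝ) : ℂ)⁻¹ •
    !![1, 0, 0, 1; 0, -Complex.I, -Complex.I, 0; 0, 1, -1, 0; -Complex.I, 0, 0, Complex.I] := by
  ext i j; fin_cases i <;> fin_cases j <;> simp [magicBasis, Matrix.conjTranspose_apply]

lemma magicBasis_mul_conjTranspose : magicBasis * magicBasisᴴ = 1 := by
  rw [magicBasis_conjTranspose, magicBasis, Matrix.smul_mul, Matrix.mul_smul, smul_smul,
    sqrt_two_inv_sq]
  ext i j; fin_cases i <;> fin_cases j <;> simp <;> norm_num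

lemma magicBasis_mem_unitary : magicBasis ∈ unitary (Matrix (Fin 4) (Fin 4) ℂ) :=
  Unitary.mem_iff.2 ⟨mul_eq_one_comm.1 magicBasis_mul_conjTranspose, magicBasis_mul_conjTranspose⟩

lemma magicBasis_inv : magicBasis⁻¹ = magicBasisᴴ :=
  Matrix.inv_eq_right_inv magicBasis_mul_conjTranspose

lemma isUnit_magicBasis : IsUnit magicBasis :=
  ⟨⟨_, _, magicBasis_mul_conjTranspose, mul_eq_one_comm.1 magicBasis_mul_conjTranspose⟩, rfl⟩

lemma magicBasis_mul_inv : magicBasis * magicBasis⁻¹ = 1 := by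
  rw [magicBasis_inv, magicBasis_mul_conjTranspose]

lemma magicBasis_inv_mul : magicBasis⁻¹ * magicBasis = 1 :=
  mul_eq_one_comm.1 magicBasis_mul_inv

lemma magicBasis_inv_mem_unitary : magicBasis⁻¹ ∈ unitary (Matrix (Fin 4) (Fin 4) ℂ) := by
  rw [magicBasis_inv]; exact Unitary.star_mem magicBasis_mem_unitary

/-- The inverse of `inMagicBasis`: the operator whose matrix in the magic basis is `X`. -/
noncomputable def ofMagicBasis (X : Matrix (Fin 4) (Fin 4) ℂ) : Matrix (Fin 4) (Fin 4) ℂ :=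
  magicBasis * X * magicBasis⁻¹

@[simp] lemma ofMagicBasis_inMagicBasis (X : Matrix (Fin 4) (Fin 4) ℂ) :
    ofMagicBasis (inMagicBasis X) = X := by
  simp only [ofMagicBasis, inMagicBasis, ← mul_assoc, magicBasis_mul_inv, one_mul]
  rw [mul_assoc, magicBasis_mul_inv, mul_one]

@[simp] lemma inMagicBasis_ofMagicBasis (X : Matrix (Fin 4) (Fin 4) ℂ) :
    inMagicBasis (ofMagicBasis X) = X := by
  simp only [ofMagicBasis, inMagicBasis, ← mul_assoc, magicBasis_inv_mul, one_mul]
  rw [mul_assoc, magicBasis_inv_mul, mul_one]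

lemma inMagicBasis_mul (X Y : Matrix (Fin 4) (Fin 4) ℂ) :
    inMagicBasis (X * Y) = inMagicBasis X * inMagicBasis Y := by
  simp only [inMagicBasis]
  calc _ = magicBasis⁻¹ * X * (magicBasis * magicBasis⁻¹) * Y * magicBasis := by
        rw [magicBasis_mul_inv]; simp only [mul_assoc, mul_one]
    _ = _ := by simp only [mul_assoc]

lemma ofMagicBasis_mul (X Y : Matrix (Fin 4) (Fin 4) ℂ) :
    ofMagicBasis (X * Y) = ofMagicBasis X * ofMagicBasis Y := by
  conv_lhs => rw [← inMagicBasis_ofMagicBasis X, ← inMagicBasis_ofMagicBasis Y,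
    ← inMagicBasis_mul, ofMagicBasis_inMagicBasis]

@[simp] lemma inMagicBasis_one : inMagicBasis 1 = 1 := by
  simp [inMagicBasis, magicBasis_inv_mul]

lemma inMagicBasis_conjTranspose (X : Matrix (Fin 4) (Fin 4) ℂ) :
    inMagicBasis Xᴴ = (inMagicBasis X)ᴴ := by
  simp [inMagicBasis, magicBasis_inv, Matrix.conjTranspose_mul, mul_assoc]

lemma ofMagicBasis_conjTranspose (X : Matrix (Fin 4) (Fin 4) ℂ) :
    ofMagicBasis Xᴴ = (ofMagicBasis X)ᴴ := by
  simp [ofMagicBasis, magicBasis_inv, Matrix.conjTranspose_mul, mul_assoc]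

lemma inMagicBasis_add (X Y : Matrix (Fin 4) (Fin 4) ℂ) :
    inMagicBasis (X + Y) = inMagicBasis X + inMagicBasis Y := by
  simp [inMagicBasis, mul_add, add_mul]

lemma inMagicBasis_smul (c : ℂ) (X : Matrix (Fin 4) (Fin 4) ℂ) :
    inMagicBasis (c • X) = c • inMagicBasis X := by
  simp [inMagicBasis]

lemma ofMagicBasis_sub (X Y : Matrix (Fin 4) (Fin 4) ℂ) :
    ofMagicBasis (X - Y) = ofMagicBasis X - ofMagicBasis Y := by
  simp [ofMagicBasis, mul_sub, sub_mul]

lemma norm_inMagicBasis (X : Matrix (Fin 4) (Fin 4) ℂ) : ‖inMagicBasis X‖ = ‖X‖ := by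
  rw [inMagicBasis, norm_mul_unitary magicBasis_mem_unitary,
    norm_unitary_mul magicBasis_inv_mem_unitary]

lemma norm_ofMagicBasis (X : Matrix (Fin 4) (Fin 4) ℂ) : ‖ofMagicBasis X‖ = ‖X‖ := by
  rw [ofMagicBasis, norm_mul_unitary magicBasis_inv_mem_unitary,
    norm_unitary_mul magicBasis_mem_unitary]

lemma inMagicBasis_exp (X : Matrix (Fin 4) (Fin 4) ℂ) :
    inMagicBasis (NormedSpace.exp X) = NormedSpace.exp (inMagicBasis X) := by
  exact (Matrix.exp_conj' magicBasis X isUnit_magicBasis).symm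

lemma continuous_inMagicBasis : Continuous inMagicBasis := by
  unfold inMagicBasis; fun_prop

lemma continuous_ofMagicBasis : Continuous ofMagicBasis := by
  unfold ofMagicBasis; fun_prop

/-- The matrix of `ε ⊗ ε`, where `ε` is the symplectic form preserved by `SU(2)`; in the magic
basis it becomes the standard symmetric form. -/
lemma magicBasis_form : magicBasisᴴᵀ * magicBasisᴴ =
    tensor !![0, 1; -1, 0] !![0, 1; -1, 0] := by
  rw [magicBasis_conjTranspose, Matrix.transpose_smul, Matrix.smul_mul, Matrix.mul_smul, smul_smul,
    sqrt_two_inv_sq, tensor_apply]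
  ext i j; fin_cases i <;> fin_cases j <;> simp [Matrix.mul_apply, Fin.sum_univ_four] <;> norm_num

lemma localUnitaries_subset_unitary {K : Matrix (Fin 4) (Fin 4) ℂ} (hK : K ∈ localUnitaries) :
    K ∈ unitary (Matrix (Fin 4) (Fin 4) ℂ) := by
  obtain ⟨A, hA, B, hB, rfl⟩ := hK
  exact tensor_mem_unitary (Matrix.mem_specialUnitaryGroup_iff.1 hA).1
    (Matrix.mem_specialUnitaryGroup_iff.1 hB).1

lemma transpose_symplectic_mul (A : Matrix (Fin 2) (Fin 2) ℂ) :
    Aᵀ * !![0, 1; -1, 0] * A = A.det • !![0, 1; -1, 0] := by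
  rw [Matrix.det_fin_two]
  ext i j
  fin_cases i <;> fin_cases j <;>
    simp [Matrix.mul_apply, Fin.sum_univ_two] <;> ring

/-- In the magic basis, a local unitary is unitary, and also orthogonal because it preserves the
bilinear form `ε ⊗ ε`; hence it is real. -/
lemma inMagicBasis_mem_SO4 {K : Matrix (Fin 4) (Fin 4) ℂ} (hK : K ∈ localUnitaries) :
    inMagicBasis K ∈ SO4 := by
  obtain ⟨A, hA, B, hB, rfl⟩ := hK
  rw [Matrix.mem_specialUnitaryGroup_iff] at hA hB
  have hT : (inMagicBasis (tensor A B))ᵀ * inMagicBasis (tensor A B) = 1 := by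
    calc _ = magicBasisᵀ * ((tensor A B)ᵀ * (magicBasisᴴᵀ * magicBasisᴴ) * tensor A B) *
          magicBasis := by
          rw [inMagicBasis, magicBasis_inv]
          simp only [Matrix.transpose_mul, mul_assoc]
      _ = magicBasisᵀ * (magicBasisᴴᵀ * magicBasisᴴ) * magicBasis := by
          rw [magicBasis_form, tensor_transpose, tensor_mul, tensor_mul, transpose_symplectic_mul,
            transpose_symplectic_mul, hA.2, hB.2, one_smul]
      _ = (magicBasisᴴ * magicBasis)ᵀ * (magicBasisᴴ * magicBasis) := by
          simp only [Matrix.transpose_mul, mul_assoc]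
      _ = 1 := by rw [mul_eq_one_comm.1 magicBasis_mul_conjTranspose]; simp
  have hU : (inMagicBasis (tensor A B))ᴴ * inMagicBasis (tensor A B) = 1 := by
    rw [← inMagicBasis_conjTranspose, ← inMagicBasis_mul]
    have := (Unitary.mem_iff.1 (tensor_mem_unitary hA.1 hB.1)).1
    rw [Matrix.star_eq_conjTranspose] at this
    rw [this, inMagicBasis_one]
  have hdet : (inMagicBasis (tensor A B)).det = 1 := by
    rw [inMagicBasis, mul_assoc, Matrix.det_mul_comm, mul_assoc, magicBasis_mul_inv, mul_one,
      tensor, Matrix.det_reindex_self, Matrix.det_kronecker, hA.2, hB.2]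
    simp
  refine mem_SO4_iff.2 ⟨?_, hT, hdet⟩
  have : (inMagicBasis (tensor A B))ᴴ = (inMagicBasis (tensor A B))ᵀ := by
    calc _ = (inMagicBasis (tensor A B))ᴴ *
          (inMagicBasis (tensor A B) * (inMagicBasis (tensor A B))ᵀ) := by
          rw [mul_eq_one_comm.1 hT, mul_one]
      _ = _ := by rw [← mul_assoc, hU, one_mul]
  exact Matrix.transpose_injective this

/-! ### `SU(2) ⊗ SU(2)` is `SO(4)` in the magic basis -/

lemma localUnitaries_mul {K L : Matrix (Fin 4) (Fin 4) ℂ} (hK : K ∈ localUnitaries)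
    (hL : L ∈ localUnitaries) : K * L ∈ localUnitaries := by
  obtain ⟨A, hA, B, hB, rfl⟩ := hK
  obtain ⟨A', hA', B', hB', rfl⟩ := hL
  exact ⟨A * A', mul_mem hA hA', B * B', mul_mem hB hB', tensor_mul _ _ _ _⟩

/-- The reflection of `ℝ⁴` in the third coordinate. In the magic basis it is the swap of the two
qubits. -/
noncomputable def flip : Matrix (Fin 4) (Fin 4) ℂ := Matrix.diagonal ![1, 1, -1, 1]

lemma flip_mul_flip : flip * flip = 1 := by
  rw [flip, Matrix.diagonal_mul_diagonal, ← Matrix.diagonal_one]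
  congr 1
  ext i; fin_cases i <;> simp

lemma ofMagicBasis_flip : ofMagicBasis flip = !![1, 0, 0, 0; 0, 0, 1, 0; 0, 1, 0, 0; 0, 0, 0, 1] := by
  have : magicBasis * flip =
      !![1, 0, 0, 0; 0, 0, 1, 0; 0, 1, 0, 0; 0, 0, 0, 1] * magicBasis := by
    ext i j; fin_cases i <;> fin_cases j <;>
      simp [magicBasis, flip]
  rw [ofMagicBasis, this, mul_assoc, magicBasis_mul_inv, mul_one]

lemma flip_conj_tensor (A B : Matrix (Fin 2) (Fin 2) ℂ) :
    flip * inMagicBasis (tensor A B) * flip = inMagicBasis (tensor B A) := by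
  rw [← inMagicBasis_ofMagicBasis flip, ← inMagicBasis_mul, ← inMagicBasis_mul, ofMagicBasis_flip,
    tensor_apply A B, tensor_apply B A]
  congr 1
  ext i j; fin_cases i <;> fin_cases j <;> simp [Matrix.mul_apply, Fin.sum_univ_four, mul_comm]

/-- The quaternion with coordinate vector `v`. Up to the factor `√2`, the magic basis identifies
`v` with this `2 × 2` matrix, on which `A ⊗ B` acts as `X ↦ A X Bᵀ`. -/
noncomputable def quaternionMatrix (v : Fin 4 → ℝ) : Matrix (Fin 2) (Fin 2) ℂ :=
  !![v 0 + Complex.I * v 3, v 2 + Complex.I * v 1; -v 2 + Complex.I * v 1, v 0 - Complex.I * v 3]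

lemma det_quaternionMatrix (v : Fin 4 → ℝ) :
    (quaternionMatrix v).det = ((v 0 ^ 2 + v 1 ^ 2 + v 2 ^ 2 + v 3 ^ 2 : ℝ) : ℂ) := by
  rw [quaternionMatrix, Matrix.det_fin_two_of]
  push_cast
  linear_combination (-(v 3 : ℂ) ^ 2 - (v 1 : ℂ) ^ 2) * Complex.I_sq

lemma quaternionMatrix_mem {v : Fin 4 → ℝ} (hv : v 0 ^ 2 + v 1 ^ 2 + v 2 ^ 2 + v 3 ^ 2 = 1) :
    quaternionMatrix v ∈ Matrix.specialUnitaryGroup (Fin 2) ℂ := by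
  have hv' : (v 0 : ℂ) ^ 2 + (v 1 : ℂ) ^ 2 + (v 2 : ℂ) ^ 2 + (v 3 : ℂ) ^ 2 = 1 := by
    exact_mod_cast hv
  rw [Matrix.mem_specialUnitaryGroup_iff, det_quaternionMatrix, hv]
  refine ⟨?_, by simp⟩
  rw [Matrix.mem_unitaryGroup_iff]
  ext i j; fin_cases i <;> fin_cases j <;>
    simp [quaternionMatrix, Matrix.mul_apply, Fin.sum_univ_two, Matrix.star_apply]
  · linear_combination hv' - ((v 3 : ℂ) ^ 2 + (v 1 : ℂ) ^ 2) * Complex.I_sq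
  · ring
  · ring
  · linear_combination hv' - ((v 3 : ℂ) ^ 2 + (v 1 : ℂ) ^ 2) * Complex.I_sq

/-- A reflection `x ↦ x - 2 ⟨x, v⟩ v` is `x ↦ - v x̄ v` on quaternions; composing it with the
coordinate reflection removes the conjugation and leaves a local unitary. -/
lemma reflection_mul_flip {v : Fin 4 → ℝ} (hv : v 0 ^ 2 + v 1 ^ 2 + v 2 ^ 2 + v 3 ^ 2 = 1) :
    (1 - (2 : ℝ) • Matrix.vecMulVec v v).map (fun x : ℝ => (x : ℂ)) * flip ∈
      inMagicBasis '' localUnitaries := by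
  have hv' : (v 0 : ℂ) ^ 2 + (v 1 : ℂ) ^ 2 + (v 2 : ℂ) ^ 2 + (v 3 : ℂ) ^ 2 = 1 := by
    exact_mod_cast hv
  have hJ : ∀ c : ℂ, c ^ 2 = 1 → (star c = c) → c • !![(0 : ℂ), 1; -1, 0] ∈
      Matrix.specialUnitaryGroup (Fin 2) ℂ := by
    intro c hc hc'
    have hc2 : (starRingEnd ℂ) c = c := hc'
    rw [Matrix.mem_specialUnitaryGroup_iff, Matrix.mem_unitaryGroup_iff]
    constructor
    · ext i j; fin_cases i <;> fin_cases j <;>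
        simp [Matrix.mul_apply, Fin.sum_univ_two, Matrix.star_apply, hc2] <;>
        linear_combination hc
    · simp [Matrix.det_fin_two]; linear_combination hc
  have hVT : (quaternionMatrix v)ᵀ ∈ Matrix.specialUnitaryGroup (Fin 2) ℂ := by
    have : (quaternionMatrix v)ᵀ = quaternionMatrix ![v 0, v 1, - v 2, v 3] := by
      ext i j; fin_cases i <;> fin_cases j <;> simp [quaternionMatrix]
    rw [this]
    exact quaternionMatrix_mem (by simpa using hv)
  refine ⟨tensor (quaternionMatrix v * ((-1 : ℂ) • !![(0 : ℂ), 1; -1, 0]))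
    ((quaternionMatrix v)ᵀ * ((1 : ℂ) • !![(0 : ℂ), 1; -1, 0])),
    ⟨_, mul_mem (quaternionMatrix_mem hv) (hJ _ (by norm_num) (by simp)), _,
      mul_mem hVT (hJ _ (by norm_num) (by simp)), rfl⟩, ?_⟩
  suffices h : tensor (quaternionMatrix v * ((-1 : ℂ) • !![(0 : ℂ), 1; -1, 0]))
      ((quaternionMatrix v)ᵀ * ((1 : ℂ) • !![(0 : ℂ), 1; -1, 0])) * magicBasis = magicBasis *
      ((1 - (2 : ℝ) • Matrix.vecMulVec v v).map (fun x : ℝ => (x : ℂ)) * flip) by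
    rw [inMagicBasis, mul_assoc, h, ← mul_assoc, magicBasis_inv_mul, one_mul]
  rw [magicBasis, Matrix.mul_smul, Matrix.smul_mul]
  congr 1
  have hN : (1 - (2 : ℝ) • Matrix.vecMulVec v v).map (fun x : ℝ => (x : ℂ)) =
      Matrix.of fun i j => (if i = j then (v 0 : ℂ) ^ 2 + (v 1 : ℂ) ^ 2 + (v 2 : ℂ) ^ 2 +
        (v 3 : ℂ) ^ 2 else 0) - 2 * v i * v j := by
    ext i j
    rw [hv']
    simp [Matrix.one_apply, Matrix.vecMulVec_apply, mul_assoc]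
    split_ifs <;> simp
  rw [hN, tensor_apply]
  have hI : Complex.I ^ 3 = - Complex.I := by
    rw [pow_succ, Complex.I_sq]; ring
  ext i j; fin_cases i <;> fin_cases j <;>
    simp [quaternionMatrix, flip, Matrix.mul_apply, Fin.sum_univ_four, Matrix.diagonal] <;>
    ring_nf <;> simp only [Complex.I_sq, hI] <;> ring

/-- A product of reflections is a local unitary in the magic basis, possibly up to `flip`. Each
reflection is a local unitary times `flip`, and conjugation by `flip` preserves the local unitaries,
so the factors `flip` can be collected on the right, where they cancel in pairs. -/
lemma reflections_prod_local (l : List (EuclideanSpace ℝ (Fin 4))) :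
    ∃ R : Matrix (Fin 4) (Fin 4) ℝ, (∀ x, Matrix.toEuclideanCLM (n := Fin 4) (𝕜 := ℝ) R x =
      (l.map fun v => (ℝ ∙ v)ᗮ.reflection).prod x) ∧
      (R.map (fun x : ℝ => (x : ℂ)) ∈ inMagicBasis '' localUnitaries ∨
        R.map (fun x : ℝ => (x : ℂ)) * flip ∈ inMagicBasis '' localUnitaries) := by
  have hmul : ∀ X ∈ inMagicBasis '' localUnitaries, ∀ Y ∈ inMagicBasis '' localUnitaries,
      X * Y ∈ inMagicBasis '' localUnitaries := by
    rintro _ ⟨X, hX, rfl⟩ _ ⟨Y, hY, rfl⟩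
    exact ⟨X * Y, localUnitaries_mul hX hY, inMagicBasis_mul _ _⟩
  have hflip : ∀ X ∈ inMagicBasis '' localUnitaries, flip * X * flip ∈
      inMagicBasis '' localUnitaries := by
    rintro _ ⟨_, ⟨A, hA, B, hB, rfl⟩, rfl⟩
    exact ⟨tensor B A, ⟨B, hB, A, hA, rfl⟩, (flip_conj_tensor A B).symm⟩
  induction l with
  | nil =>
    refine ⟨1, fun x => by simp, Or.inl ⟨1, ⟨1, one_mem _, 1, one_mem _, tensor_one.symm⟩, ?_⟩⟩
    simp
  | cons v l ih =>
    obtain ⟨P, hP, hPG⟩ := ih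
    by_cases hv : v = 0
    · refine ⟨P, fun x => ?_, hPG⟩
      subst hv
      rw [hP]
      simp [Submodule.reflection_mem_subspace_eq_self]
    · set u : EuclideanSpace ℝ (Fin 4) := ‖v‖⁻¹ • v with hu
      have hnv : ‖v‖ ≠ 0 := norm_ne_zero_iff.2 hv
      have hun : ‖u‖ = 1 := by
        rw [hu, norm_smul, norm_inv, norm_norm, inv_mul_cancel₀ hnv]
      have hu1 : u 0 ^ 2 + u 1 ^ 2 + u 2 ^ 2 + u 3 ^ 2 = 1 := by
        have := EuclideanSpace.real_norm_sq_eq u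
        rw [hun, Fin.sum_univ_four] at this
        linarith
      have hN := reflection_mul_flip (v := fun i => u i) hu1
      set N := (1 - (2 : ℝ) • Matrix.vecMulVec (fun i => u i) (fun i => u i)) with hNdef
      have hNP : (N * P).map (fun x : ℝ => (x : ℂ)) =
          N.map (fun x : ℝ => (x : ℂ)) * P.map (fun x : ℝ => (x : ℂ)) :=
        Matrix.map_mul (f := algebraMap ℝ ℂ)
      refine ⟨N * P, fun x => ?_, ?_⟩
      · rw [map_mul, List.map_cons, List.prod_cons]
        change Matrix.toEuclideanCLM (n := Fin 4) (𝕜 := ℝ) N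
          (Matrix.toEuclideanCLM (n := Fin 4) (𝕜 := ℝ) P x) = _
        rw [hP, LinearIsometryEquiv.coe_mul, Function.comp_apply]
        set y := (l.map fun v => (ℝ ∙ v)ᗮ.reflection).prod x
        have hspan : (ℝ ∙ v) = ℝ ∙ u := by
          rw [hu, Submodule.span_singleton_smul_eq (IsUnit.mk0 _ (inv_ne_zero hnv))]
        simp only [hspan]
        rw [Submodule.reflection_orthogonal_apply, Submodule.reflection_singleton_apply, hun]
        ext i
        rw [Matrix.ofLp_toEuclideanCLM, hNdef, Matrix.sub_mulVec, Matrix.one_mulVec,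
          Matrix.smul_mulVec, Matrix.vecMulVec_mulVec]
        simp [PiLp.inner_apply, dotProduct, mul_comm]
      · rw [hNP]
        rcases hPG with h | h
        · right
          have := hmul _ hN _ (hflip _ h)
          convert this using 1
          calc _ = N.map (fun x : ℝ => (x : ℂ)) * (flip * flip) *
                P.map (fun x : ℝ => (x : ℂ)) * flip := by rw [flip_mul_flip, mul_one]
            _ = _ := by simp only [mul_assoc]
        · left
          have := hmul _ hN _ (hflip _ h)
          convert this using 1
          calc _ = N.map (fun x : ℝ => (x : ℂ)) * (flip * flip) *
                P.map (fun x : ℝ => (x : ℂ)) * (flip * flip) := by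
                rw [flip_mul_flip, mul_one, mul_one]
            _ = _ := by simp only [mul_assoc]

/-- By Cartan–Dieudonné every element of `SO(4)` is a product of reflections, and their number is
even. -/
lemma inMagicBasis_image_localUnitaries : inMagicBasis '' localUnitaries = SO4 := by
  refine Subset.antisymm ?_ ?_
  · rintro _ ⟨K, hK, rfl⟩
    exact inMagicBasis_mem_SO4 hK
  · rintro K hK
    have hK' := hK
    obtain ⟨R, hR, rfl⟩ := hK
    rw [Matrix.mem_specialOrthogonalGroup_iff] at hR
    have hRu : Matrix.toEuclideanCLM (n := Fin 4) (𝕜 := ℝ) R ∈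
        unitary (EuclideanSpace ℝ (Fin 4) →L[ℝ] EuclideanSpace ℝ (Fin 4)) := by
      have := Unitary.map_mem (Matrix.toEuclideanCLM (n := Fin 4) (𝕜 := ℝ)) hR.1
      exact this
    obtain ⟨l, -, hl⟩ := LinearIsometryEquiv.reflections_generate_dim
      (Unitary.linearIsometryEquiv ⟨_, hRu⟩)
    obtain ⟨P, hP, hPG⟩ := reflections_prod_local l
    have hPR : P = R := by
      apply (Matrix.toEuclideanCLM (n := Fin 4) (𝕜 := ℝ)).injective
      ext1 x
      refine (hP x).trans ?_
      rw [← hl]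
      rfl
    subst hPR
    rcases hPG with h | h
    · exact h
    · -- the product of an odd number of reflections has determinant `-1`
      exfalso
      obtain ⟨X, hX, hXe⟩ := h
      have h1 := (mem_SO4_iff.1 (inMagicBasis_mem_SO4 hX)).2.2
      rw [hXe, Matrix.det_mul, (mem_SO4_iff.1 hK').2.2, flip, Matrix.det_diagonal,
        Fin.prod_univ_four] at h1
      simp at h1
      norm_num at h1

lemma ofMagicBasis_mem_local {K : Matrix (Fin 4) (Fin 4) ℂ} (hK : K ∈ SO4) :
    ofMagicBasis K ∈ localUnitaries := by
  rw [← inMagicBasis_image_localUnitaries] at hK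
  obtain ⟨X, hX, rfl⟩ := hK
  simpa using hX

/-! ### Spectra of real symmetric matrices -/

lemma norm_entry_le (A : Matrix (Fin 4) (Fin 4) ℂ) (i j : Fin 4) : ‖A i j‖ ≤ ‖A‖ := by
  have h := Matrix.l2_opNorm_mulVec A (EuclideanSpace.single j (1 : ℂ))
  have h2 := PiLp.norm_apply_le (WithLp.toLp 2 (A *ᵥ (EuclideanSpace.single j (1 : ℂ)))) i
  simp at h h2
  exact h2.trans h

lemma diag_add (x y : Fin 4 → ℝ) : diag (x + y) = diag x + diag y := by
  simp [diag, Matrix.diagonal_add]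

lemma diag_smul (c : ℝ) (x : Fin 4 → ℝ) : diag (c • x) = (c : ℂ) • diag x := by
  simp only [diag, ← Matrix.diagonal_smul]
  congr 1
  ext; simp

/-- A permutation matrix, with the sign of one row adjusted so that it lies in `SO(4)`. -/
lemma exists_SO4_permuting (σ : Equiv.Perm (Fin 4)) :
    ∃ K ∈ SO4, ∀ x : Fin 4 → ℝ, K * diag x * Kᵀ = diag (x ∘ σ) := by
  set e : ℂ := ((Equiv.Perm.sign σ : ℤ) : ℂ) with he
  have hee : e * e = 1 := by
    rw [he, ← Int.cast_mul, Int.units_coe_mul_self, Int.cast_one]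
  set s : Fin 4 → ℂ := ![e, 1, 1, 1] with hs
  have hss : ∀ i, s i * s i = 1 := by
    intro i; fin_cases i <;> simp [hs, hee]
  set P : Matrix (Fin 4) (Fin 4) ℂ := σ.permMatrix ℂ with hP
  have hPentry : ∀ i j, P i j = if σ i = j then 1 else 0 := by
    intro i j
    simp [hP, Equiv.Perm.permMatrix, PEquiv.toMatrix_apply, eq_comm]
  have hconj : ∀ x : Fin 4 → ℝ, (Matrix.diagonal s * P) * diag x * (Matrix.diagonal s * P)ᵀ =
      diag (x ∘ σ) := by
    intro x
    ext i j
    have h1 : ((Matrix.diagonal s * P) * diag x * (Matrix.diagonal s * P)ᵀ) i j =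
        ∑ k, (s i * P i k * (x k : ℂ)) * (s j * P j k) := by
      simp [Matrix.mul_apply, diag, Matrix.diagonal_apply]
      exact Finset.sum_congr rfl fun k _ => by ring
    rw [h1]
    simp only [hPentry]
    rw [Finset.sum_eq_single (σ i)]
    · by_cases hij : i = j
      · subst hij
        simp [diag]
        linear_combination (x (σ i) : ℂ) * hss i
      · have : σ j ≠ σ i := fun h => hij (σ.injective h).symm
        simp [diag, this, hij]
    · intro k _ hk
      simp [hk.symm]
    · simp
  have hreal : (starRingEnd ℂ) e = e := by rw [he]; simp
  refine ⟨Matrix.diagonal s * P, mem_SO4_iff.2 ⟨?_, ?_, ?_⟩, hconj⟩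
  · ext i j
    simp only [Matrix.map_apply, Matrix.diagonal_mul, hPentry]
    have hsr : star (s i) = s i := by fin_cases i <;> simp [hs, hreal]
    rw [star_mul', hsr]
    split_ifs <;> simp
  · rw [mul_eq_one_comm]
    have := hconj (fun _ => 1)
    have h1 : diag (fun _ => 1) = 1 := by simp [diag]
    have h2 : diag ((fun _ => (1 : ℝ)) ∘ σ) = 1 := by simp [diag]
    rwa [h1, h2, mul_one] at this
  · rw [Matrix.det_mul, Matrix.det_diagonal, hP, Matrix.det_permutation, Fin.prod_univ_four]
    simpa [hs] using hee

/-- `lam` is the decreasingly ordered spectrum of the real symmetric matrix `S`, which is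
diagonalized by an element of `SO(4)`. -/
def IsSpec (S : Matrix (Fin 4) (Fin 4) ℂ) (lam : Fin 4 → ℝ) : Prop :=
  Antitone lam ∧ ∃ K ∈ SO4, S = Kᵀ * diag lam * K

/-- The spectral theorem, with a diagonalizing matrix of determinant `1`. -/
lemma exists_isSpec {S : Matrix (Fin 4) (Fin 4) ℂ} (hr : S.map star = S) (hs : Sᵀ = S) :
    ∃ lam, IsSpec S lam := by
  set A : Matrix (Fin 4) (Fin 4) ℝ := S.map Complex.re with hA
  have hAS : A.map (algebraMap ℝ ℂ) = S := by
    ext i j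
    exact Complex.conj_eq_iff_re.1 (congrFun (congrFun hr i) j)
  have hAh : A.IsHermitian := by
    rw [Matrix.IsHermitian, Matrix.conjTranspose_eq_transpose_of_trivial, hA,
      ← Matrix.transpose_map, hs]
  set V : Matrix (Fin 4) (Fin 4) ℝ := (hAh.eigenvectorUnitary : Matrix (Fin 4) (Fin 4) ℝ) with hV
  have hVu : Vᵀ * V = 1 := by
    have := (Unitary.mem_iff.1 hAh.eigenvectorUnitary.2).1
    rwa [Matrix.star_eq_conjTranspose, Matrix.conjTranspose_eq_transpose_of_trivial] at this
  have hspec : A = V * Matrix.diagonal hAh.eigenvalues * Vᵀ := by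
    have := hAh.spectral_theorem
    rw [Unitary.conjStarAlgAut_apply, Matrix.star_eq_conjTranspose,
      Matrix.conjTranspose_eq_transpose_of_trivial] at this
    exact this
  -- adjust the determinant of the eigenvector matrix
  have hdet : V.det * V.det = 1 := by
    have := congrArg Matrix.det hVu
    rwa [Matrix.det_mul, Matrix.det_transpose, Matrix.det_one] at this
  set s : Fin 4 → ℝ := ![V.det, 1, 1, 1] with hsdef
  have hss : ∀ i, s i * s i = 1 := by
    intro i; fin_cases i <;> simp [hsdef, hdet]
  have hss' : Matrix.diagonal s * Matrix.diagonal s = 1 := by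
    rw [Matrix.diagonal_mul_diagonal, ← Matrix.diagonal_one]
    congr 1; ext i; exact hss i
  set W := V * Matrix.diagonal s with hW
  have hWspec : A = W * Matrix.diagonal hAh.eigenvalues * Wᵀ := by
    conv_lhs => rw [hspec]
    have hc : Matrix.diagonal s * Matrix.diagonal hAh.eigenvalues * Matrix.diagonal s =
        Matrix.diagonal hAh.eigenvalues := by
      rw [Matrix.diagonal_mul_diagonal, Matrix.diagonal_mul_diagonal]
      congr 1; ext i; rw [mul_right_comm, hss, one_mul]
    calc _ = V * (Matrix.diagonal s * Matrix.diagonal hAh.eigenvalues * Matrix.diagonal s) *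
          Vᵀ := by rw [hc]
      _ = _ := by simp only [hW, Matrix.transpose_mul, Matrix.diagonal_transpose, mul_assoc]
  have hWSO : Wᵀ ∈ Matrix.specialOrthogonalGroup (Fin 4) ℝ := by
    rw [Matrix.mem_specialOrthogonalGroup_iff, Matrix.mem_orthogonalGroup_iff]
    refine ⟨?_, ?_⟩
    · change Wᵀ * Wᵀᵀ = 1
      rw [Matrix.transpose_transpose, hW, Matrix.transpose_mul, Matrix.diagonal_transpose, mul_assoc,
        ← mul_assoc Vᵀ, hVu, one_mul, hss']
    · rw [Matrix.det_transpose, hW, Matrix.det_mul, Matrix.det_diagonal, Fin.prod_univ_four]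
      simpa [hsdef] using hdet
  set L : Matrix (Fin 4) (Fin 4) ℂ := Wᵀ.map (fun x : ℝ => (x : ℂ)) with hL
  have hLSO : L ∈ SO4 := ⟨_, hWSO, rfl⟩
  have hS : S = Lᵀ * diag hAh.eigenvalues * L := by
    rw [← hAS]
    conv_lhs => rw [hWspec]
    rw [Matrix.map_mul, Matrix.map_mul]
    congr 2
    ext i j
    simp [diag, Matrix.diagonal_apply]
    split_ifs <;> simp
  obtain ⟨K, hK, hKd⟩ := exists_SO4_permuting (sortDescPerm hAh.eigenvalues)
  refine ⟨sortDesc hAh.eigenvalues, antitone_sortDesc _, K * L, mul_mem_SO4 hK hLSO, ?_⟩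
  rw [sortDesc_eq, ← hKd, Matrix.transpose_mul]
  calc S = Lᵀ * (Kᵀ * K) * diag hAh.eigenvalues * (Kᵀ * K) * L := by
        rw [SO4_transpose_mul hK, mul_one, mul_one, hS]
    _ = _ := by simp only [mul_assoc]

/-- **Schur**: in every orthonormal basis, the diagonal of a symmetric matrix is a doubly stochastic
average of the spectrum. -/
lemma IsSpec.exists_doublyStochastic {S : Matrix (Fin 4) (Fin 4) ℂ} {lam : Fin 4 → ℝ}
    (h : IsSpec S lam) {R : Matrix (Fin 4) (Fin 4) ℂ} (hR : R ∈ SO4) :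
    ∃ D ∈ doublyStochastic ℝ (Fin 4), ∀ i, (R * S * Rᵀ) i i = (((D *ᵥ lam) i : ℝ) : ℂ) := by
  obtain ⟨-, K, hK, rfl⟩ := h
  have hO := mul_mem_SO4 hR (transpose_mem_SO4 hK)
  set O := R * Kᵀ with hOdef
  have hOO : R * (Kᵀ * diag lam * K) * Rᵀ = O * diag lam * Oᵀ := by
    simp only [hOdef, Matrix.transpose_mul, Matrix.transpose_transpose, mul_assoc]
  have hre : ∀ i j, O i j = ((O i j).re : ℂ) := fun i j =>
    (Complex.conj_eq_iff_re.1 (congrFun (congrFun (mem_SO4_iff.1 hO).1 i) j)).symm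
  refine ⟨Matrix.of fun i j => (O i j).re ^ 2, ?_, fun i => ?_⟩
  · rw [mem_doublyStochastic_iff_sum]
    refine ⟨fun i j => sq_nonneg _, fun i => ?_, fun j => ?_⟩
    · have := congrFun (congrFun (SO4_mul_transpose hO) i) i
      rw [Matrix.mul_apply] at this
      have h2 : ((∑ j, (O i j).re ^ 2 : ℝ) : ℂ) = 1 := by
        rw [Matrix.one_apply_eq] at this
        rw [← this]
        push_cast
        refine Finset.sum_congr rfl fun j _ => ?_
        rw [Matrix.transpose_apply, ← hre i j, sq]
      exact_mod_cast h2
    · have := congrFun (congrFun (SO4_transpose_mul hO) j) j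
      rw [Matrix.mul_apply] at this
      have h2 : ((∑ i, (O i j).re ^ 2 : ℝ) : ℂ) = 1 := by
        rw [Matrix.one_apply_eq] at this
        rw [← this]
        push_cast
        refine Finset.sum_congr rfl fun i _ => ?_
        rw [Matrix.transpose_apply, ← hre i j, sq]
      exact_mod_cast h2
  · rw [hOO, Matrix.mul_apply]
    simp only [Matrix.mulVec, dotProduct, Matrix.of_apply]
    push_cast
    refine Finset.sum_congr rfl fun j _ => ?_
    rw [Matrix.transpose_apply, diag, Matrix.mul_diagonal, ← hre i j]
    ring

lemma IsSpec.apply_eq {S : Matrix (Fin 4) (Fin 4) ℂ} {lam : Fin 4 → ℝ} {K}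
    (hK : K ∈ SO4) (hS : S = Kᵀ * diag lam * K) : K * S * Kᵀ = diag lam := by
  rw [hS]
  calc _ = (K * Kᵀ) * diag lam * (K * Kᵀ) := by simp only [mul_assoc]
    _ = _ := by rw [SO4_mul_transpose hK, one_mul, mul_one]

lemma IsSpec.sum_eq_trace {S : Matrix (Fin 4) (Fin 4) ℂ} {lam : Fin 4 → ℝ} (h : IsSpec S lam) :
    ((∑ i, lam i : ℝ) : ℂ) = S.trace := by
  obtain ⟨-, K, hK, rfl⟩ := h
  rw [mul_assoc, Matrix.trace_mul_comm, mul_assoc, SO4_mul_transpose hK, mul_one, diag,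
    Matrix.trace_diagonal]
  push_cast; rfl

/-- One half of the Lipschitz estimate for the ordered spectrum: the sum of the largest eigenvalues
is a maximum of partial traces. -/
lemma IsSpec.partial_sum_le {S S' : Matrix (Fin 4) (Fin 4) ℂ} {lam lam' : Fin 4 → ℝ}
    (h : IsSpec S lam) (h' : IsSpec S' lam') (s : Finset (Fin 4)) :
    ∑ i ∈ s, lam i ≤ ∑ i with i.val < s.card, lam' i + s.card * ‖S - S'‖ := by
  obtain ⟨-, K, hK, hS⟩ := h
  obtain ⟨D, hD, hDe⟩ := h'.exists_doublyStochastic hK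
  have hd := IsSpec.apply_eq hK hS
  have hle : ∀ i, lam i ≤ (D *ᵥ lam') i + ‖S - S'‖ := by
    intro i
    have h1 : (K * (S - S') * Kᵀ) i i = ((lam i - (D *ᵥ lam') i : ℝ) : ℂ) := by
      rw [mul_sub, sub_mul, hd, Matrix.sub_apply, hDe]
      simp [diag]
    have h2 := norm_entry_le (K * (S - S') * Kᵀ) i i
    rw [norm_mul_unitary (SO4_mem_unitary (transpose_mem_SO4 hK)),
      norm_unitary_mul (SO4_mem_unitary hK), h1, Complex.norm_real] at h2
    linarith [le_abs_self (lam i - (D *ᵥ lam') i), Real.norm_eq_abs (lam i - (D *ᵥ lam') i)]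
  calc ∑ i ∈ s, lam i ≤ ∑ i ∈ s, ((D *ᵥ lam') i + ‖S - S'‖) := Finset.sum_le_sum fun i _ => hle i
    _ = ∑ i ∈ s, (D *ᵥ lam') i + s.card * ‖S - S'‖ := by
        rw [Finset.sum_add_distrib, Finset.sum_const, nsmul_eq_mul]
    _ ≤ _ := add_le_add ((isMaj_mulVec hD h'.1).1 s) le_rfl

/-- The ordered eigenvalues are Lipschitz functions of the matrix. The constant is not sharp: a
single eigenvalue is written as the difference of two partial sums. -/
lemma IsSpec.abs_sub_le {S S' : Matrix (Fin 4) (Fin 4) ℂ} {lam lam' : Fin 4 → ℝ}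
    (h : IsSpec S lam) (h' : IsSpec S' lam') (k : Fin 4) : |lam k - lam' k| ≤ 8 * ‖S - S'‖ := by
  have key : ∀ k : Fin 4, ∀ {S S' : Matrix (Fin 4) (Fin 4) ℂ} {lam lam' : Fin 4 → ℝ},
      IsSpec S lam → IsSpec S' lam' →
      ∑ i ∈ Finset.Iic k, lam i - ∑ i ∈ Finset.Iic k, lam' i ≤ 4 * ‖S - S'‖ := by
    intro k S S' lam lam' h h'
    have := h.partial_sum_le h' (Finset.Iic k)
    rw [Fin.card_Iic, filter_val_lt_succ] at this
    have hk : ((k.val + 1 : ℕ) : ℝ) ≤ 4 := by exact_mod_cast k.isLt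
    nlinarith [norm_nonneg (S - S')]
  have hI0 : Finset.Iic (0 : Fin 4) = {0} := by decide
  have hI1 : Finset.Iic (1 : Fin 4) = {0, 1} := by decide
  have hI2 : Finset.Iic (2 : Fin 4) = {0, 1, 2} := by decide
  have hI3 : Finset.Iic (3 : Fin 4) = {0, 1, 2, 3} := by decide
  have hn := norm_sub_rev S S'
  have a0 := key 0 h h'; have b0 := key 0 h' h
  have a1 := key 1 h h'; have b1 := key 1 h' h
  have a2 := key 2 h h'; have b2 := key 2 h' h
  have a3 := key 3 h h'; have b3 := key 3 h' h
  simp [hI0, hI1, hI2, hI3] at a0 b0 a1 b1 a2 b2 a3 b3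
  have := norm_nonneg (S - S')
  rw [abs_le]
  fin_cases k <;> simp <;> constructor <;> linarith

lemma IsSpec.unique {S : Matrix (Fin 4) (Fin 4) ℂ} {lam lam' : Fin 4 → ℝ}
    (h : IsSpec S lam) (h' : IsSpec S lam') : lam = lam' := by
  ext k
  have := h.abs_sub_le h' k
  simp at this
  linarith

/-! ### Canonical parameters -/

/-- Operators that are symmetric with respect to the bilinear form `ε ⊗ ε` are symmetric matrices
in the magic basis. -/
lemma inMagicBasis_transpose_of_form {X : Matrix (Fin 4) (Fin 4) ℂ}
    (hX : Xᵀ * tensor !![0, 1; -1, 0] !![0, 1; -1, 0] =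
      tensor !![0, 1; -1, 0] !![0, 1; -1, 0] * X) :
    (inMagicBasis X)ᵀ = inMagicBasis X := by
  have hQ : magicBasisᴴ * magicBasis = 1 := mul_eq_one_comm.1 magicBasis_mul_conjTranspose
  have hQ' : magicBasisᵀ * magicBasisᴴᵀ = 1 := by
    rw [← Matrix.transpose_mul, hQ, Matrix.transpose_one]
  calc (inMagicBasis X)ᵀ = magicBasisᵀ * (Xᵀ * magicBasisᴴᵀ) := by
        rw [inMagicBasis, magicBasis_inv]; simp only [Matrix.transpose_mul]
    _ = magicBasisᵀ * (Xᵀ * (magicBasisᴴᵀ * magicBasisᴴ)) * magicBasis := by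
        simp only [mul_assoc, hQ, mul_one]
    _ = (magicBasisᵀ * magicBasisᴴᵀ) * magicBasisᴴ * X * magicBasis := by
        rw [magicBasis_form, hX, ← magicBasis_form]; simp only [mul_assoc]
    _ = inMagicBasis X := by rw [hQ', one_mul, inMagicBasis, magicBasis_inv]

lemma pauli_conjTranspose (i : Fin 3) : (pauli i)ᴴ = pauli i := by
  fin_cases i <;> ext a b <;> fin_cases a <;> fin_cases b <;>
    simp [pauli, Matrix.conjTranspose_apply]

lemma pauli_transpose_mul (i : Fin 3) :
    (pauli i)ᵀ * !![0, 1; -1, 0] = (-1 : ℂ) • (!![0, 1; -1, 0] * pauli i) := by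
  fin_cases i <;> ext a b <;> fin_cases a <;> fin_cases b <;>
    simp [pauli, Matrix.mul_apply, Fin.sum_univ_two]

lemma nonlocalHamiltonian_conjTranspose (M : Matrix (Fin 3) (Fin 3) ℝ) :
    (nonlocalHamiltonian M)ᴴ = nonlocalHamiltonian M := by
  simp [nonlocalHamiltonian, Matrix.conjTranspose_sum, tensor_conjTranspose, pauli_conjTranspose]

lemma inMagicBasis_nonlocal_transpose (M : Matrix (Fin 3) (Fin 3) ℝ) :
    (inMagicBasis (nonlocalHamiltonian M))ᵀ = inMagicBasis (nonlocalHamiltonian M) := by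
  refine inMagicBasis_transpose_of_form ?_
  simp only [nonlocalHamiltonian, Matrix.transpose_sum, Finset.sum_mul, Finset.mul_sum,
    Matrix.transpose_smul, Matrix.smul_mul, Matrix.mul_smul, tensor_transpose, tensor_mul,
    pauli_transpose_mul, tensor_smul]
  simp

lemma inMagicBasis_nonlocal_real (M : Matrix (Fin 3) (Fin 3) ℝ) :
    (inMagicBasis (nonlocalHamiltonian M)).map star = inMagicBasis (nonlocalHamiltonian M) := by
  have h := inMagicBasis_conjTranspose (nonlocalHamiltonian M)
  rw [nonlocalHamiltonian_conjTranspose] at h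
  have h2 := congrArg Matrix.transpose h
  rw [inMagicBasis_nonlocal_transpose] at h2
  exact h2.symm

lemma trace_inMagicBasis_nonlocal (M : Matrix (Fin 3) (Fin 3) ℝ) :
    (inMagicBasis (nonlocalHamiltonian M)).trace = 0 := by
  rw [inMagicBasis, Matrix.trace_mul_comm, ← mul_assoc, magicBasis_mul_inv, one_mul,
    nonlocalHamiltonian, Matrix.trace_sum]
  refine Finset.sum_eq_zero fun i _ => ?_
  rw [Matrix.trace_sum]
  refine Finset.sum_eq_zero fun j _ => ?_
  rw [Matrix.trace_smul, tensor_apply]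
  fin_cases i <;> fin_cases j <;> simp [pauli, Matrix.trace, Fin.sum_univ_four]

/-- The magic basis diagonalizes all the `H_ϑ`. The eigenvalues appear there in an order different
from that of `eigenvalueVector`, which `L` corrects. -/
lemma exists_SO4_canonical : ∃ L ∈ SO4, ∀ ϑ : Fin 3 → ℝ,
    inMagicBasis (canonicalHamiltonian ϑ) = L * diag (eigenvalueVector ϑ) * Lᵀ := by
  obtain ⟨L, hL, h⟩ := exists_SO4_permuting (Equiv.swap 0 1 * Equiv.swap 2 3)
  refine ⟨L, hL, fun ϑ => ?_⟩
  have hx : ∀ x : Fin 4 → ℝ, x ∘ (Equiv.swap 0 1 * Equiv.swap 2 3 : Equiv.Perm (Fin 4)) =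
      ![x 1, x 0, x 3, x 2] := by
    intro x; ext i
    fin_cases i <;> rfl
  rw [h, hx]
  have key : canonicalHamiltonian ϑ * magicBasis = magicBasis *
      diag ![eigenvalueVector ϑ 1, eigenvalueVector ϑ 0, eigenvalueVector ϑ 3,
        eigenvalueVector ϑ 2] := by
    rw [canonicalHamiltonian, Fin.sum_univ_three, magicBasis, Matrix.mul_smul, Matrix.smul_mul]
    congr 1
    rw [tensor_apply, tensor_apply, tensor_apply]
    ext i j; fin_cases i <;> fin_cases j <;>
      simp [pauli, diag, eigenvalueVector, Matrix.mul_apply, Fin.sum_univ_four,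
        Matrix.diagonal_apply] <;> ring
  rw [inMagicBasis, mul_assoc, key, ← mul_assoc, magicBasis_inv_mul, one_mul]

lemma antitone_eigenvalueVector {ϑ : Fin 3 → ℝ} (h : ϑ 1 ≤ ϑ 0 ∧ |ϑ 2| ≤ ϑ 1) :
    Antitone (eigenvalueVector ϑ) := by
  obtain ⟨h1, h2⟩ := h
  rw [abs_le] at h2
  rw [Fin.antitone_iff_succ_le]
  intro i
  fin_cases i <;> simp [eigenvalueVector] <;> linarith

/-- Diagonalize the Hamiltonian in the magic basis by an element of `SO(4)`, which is a local
unitary; as the trace vanishes, the ordered eigenvalues are `eigenvalueVector ϑ` for some `ϑ`. -/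
lemma exists_isCanonicalParameters (M : Matrix (Fin 3) (Fin 3) ℝ) :
    ∃ ϑ, IsCanonicalParameters (nonlocalHamiltonian M) ϑ := by
  obtain ⟨lam, hlam⟩ := exists_isSpec (inMagicBasis_nonlocal_real M)
    (inMagicBasis_nonlocal_transpose M)
  have hsum := hlam.sum_eq_trace
  rw [trace_inMagicBasis_nonlocal, Complex.ofReal_eq_zero, Fin.sum_univ_four] at hsum
  obtain ⟨hanti, K, hK, hS⟩ := hlam
  obtain ⟨L, hL, hLc⟩ := exists_SO4_canonical
  set ϑ : Fin 3 → ℝ := ![(lam 0 + lam 1) / 2, (lam 0 + lam 2) / 2, (lam 1 + lam 2) / 2] with hϑ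
  have hev : eigenvalueVector ϑ = lam := by
    ext i; fin_cases i <;> simp [eigenvalueVector, hϑ] <;> linarith
  have h01 : lam 1 ≤ lam 0 := hanti (by decide)
  have h12 : lam 2 ≤ lam 1 := hanti (by decide)
  have h23 : lam 3 ≤ lam 2 := hanti (by decide)
  obtain ⟨A, hA, B, hB, hAB⟩ := ofMagicBasis_mem_local (mul_mem_SO4 hL hK)
  refine ⟨ϑ, ⟨?_, ?_⟩, A, (Matrix.mem_specialUnitaryGroup_iff.1 hA).1, B,
    (Matrix.mem_specialUnitaryGroup_iff.1 hB).1, ?_⟩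
  · simp [hϑ]; linarith
  · simp only [hϑ, Matrix.cons_val]; rw [abs_le]; constructor <;> linarith
  · rw [← hAB, ← ofMagicBasis_inMagicBasis (canonicalHamiltonian ϑ), hLc, hev,
      ← ofMagicBasis_conjTranspose, ← ofMagicBasis_mul, ← ofMagicBasis_mul,
      SO4_conjTranspose (mul_mem_SO4 hL hK)]
    conv_lhs => rw [← ofMagicBasis_inMagicBasis (nonlocalHamiltonian M), hS]
    congr 1
    rw [Matrix.transpose_mul]
    calc _ = Kᵀ * (Lᵀ * L) * diag lam * (Lᵀ * L) * K := by
          rw [SO4_transpose_mul hL, mul_one, mul_one]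
      _ = _ := by simp only [mul_assoc]

/-- A unitary `2 × 2` matrix is a phase times an element of `SU(2)`. -/
lemma exists_phase {A : Matrix (Fin 2) (Fin 2) ℂ} (hA : A ∈ Matrix.unitaryGroup (Fin 2) ℂ) :
    ∃ (c : ℂ) (A' : Matrix (Fin 2) (Fin 2) ℂ), A' ∈ Matrix.specialUnitaryGroup (Fin 2) ℂ ∧
      star c * c = 1 ∧ A = c • A' := by
  have hdet : ‖A.det‖ = 1 := by
    have h := Matrix.det_of_mem_unitary hA
    have := (Unitary.mem_iff.1 h).1
    have h2 := congrArg norm this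
    rw [norm_mul, norm_star, norm_one] at h2
    nlinarith [norm_nonneg A.det]
  obtain ⟨c, hc⟩ := IsAlgClosed.exists_pow_nat_eq A.det (n := 2) (by norm_num)
  have hcn : ‖c‖ = 1 := by
    have := congrArg norm hc
    rw [norm_pow, hdet] at this
    nlinarith [norm_nonneg c]
  have hcc : star c * c = 1 := by
    have := Complex.conj_mul' c
    rw [hcn] at this
    simpa using this
  have hc0 : c ≠ 0 := by
    rintro rfl; simp at hcn
  refine ⟨c, star c • A, ?_, hcc, ?_⟩
  · rw [Matrix.mem_specialUnitaryGroup_iff, Matrix.mem_unitaryGroup_iff]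
    constructor
    · rw [Matrix.mem_unitaryGroup_iff] at hA
      rw [star_smul, Matrix.smul_mul, Matrix.mul_smul, hA, smul_smul, star_star, hcc, one_smul]
    · rw [Matrix.det_smul, ← hc]
      simp only [Fintype.card_fin]
      rw [← mul_pow, hcc, one_pow]
  · rw [smul_smul, mul_comm, hcc, one_smul]

/-- Canonical parameters are determined by the ordered spectrum. The unitaries `A`, `B` in their
definition may be replaced by elements of `SU(2)`, since the phases cancel in the conjugation. -/
lemma IsCanonicalParameters.isSpec {H : Matrix (Fin 4) (Fin 4) ℂ} {ϑ : Fin 3 → ℝ}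
    (h : IsCanonicalParameters H ϑ) : IsSpec (inMagicBasis H) (eigenvalueVector ϑ) := by
  obtain ⟨hϑ, A, hA, B, hB, rfl⟩ := h
  refine ⟨antitone_eigenvalueVector hϑ, ?_⟩
  obtain ⟨c, A', hA', hc, rfl⟩ := exists_phase hA
  obtain ⟨d, B', hB', hd, rfl⟩ := exists_phase hB
  obtain ⟨L, hL, hLc⟩ := exists_SO4_canonical
  have hK := inMagicBasis_mem_SO4 ⟨A', hA', B', hB', rfl⟩
  refine ⟨Lᵀ * inMagicBasis (tensor A' B'), mul_mem_SO4 (transpose_mem_SO4 hL) hK, ?_⟩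
  have hcd : star (c * d) * (c * d) = 1 := by
    rw [star_mul]; linear_combination hc * star d * d + hd
  rw [tensor_smul, Matrix.conjTranspose_smul, Matrix.smul_mul, Matrix.smul_mul, Matrix.mul_smul,
    smul_smul, hcd, one_smul, inMagicBasis_mul, inMagicBasis_mul, hLc, inMagicBasis_conjTranspose,
    SO4_conjTranspose hK, Matrix.transpose_mul, Matrix.transpose_transpose]
  simp only [mul_assoc]

lemma canonicalParameters_spec (M : Matrix (Fin 3) (Fin 3) ℝ) :
    IsCanonicalParameters (nonlocalHamiltonian M) (canonicalParameters (nonlocalHamiltonian M)) :=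
  Classical.epsilon_spec (exists_isCanonicalParameters M)

/-- The ordered spectrum of the Hamiltonian with coupling matrix `M`. -/
noncomputable def spectrumVec (M : Matrix (Fin 3) (Fin 3) ℝ) : Fin 4 → ℝ :=
  eigenvalueVector (canonicalParameters (nonlocalHamiltonian M))

lemma isSpec_spectrumVec (M : Matrix (Fin 3) (Fin 3) ℝ) :
    IsSpec (inMagicBasis (nonlocalHamiltonian M)) (spectrumVec M) :=
  (canonicalParameters_spec M).isSpec

lemma antitone_spectrumVec (M : Matrix (Fin 3) (Fin 3) ℝ) : Antitone (spectrumVec M) :=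
  (isSpec_spectrumVec M).1

lemma nonlocalHamiltonian_sub (M M' : Matrix (Fin 3) (Fin 3) ℝ) :
    nonlocalHamiltonian (M - M') = nonlocalHamiltonian M - nonlocalHamiltonian M' := by
  simp [nonlocalHamiltonian, sub_smul, Finset.sum_sub_distrib]

lemma abs_spectrumVec_sub_le (M M' : Matrix (Fin 3) (Fin 3) ℝ) (k : Fin 4) :
    |spectrumVec M k - spectrumVec M' k| ≤
      8 * ‖nonlocalHamiltonian M - nonlocalHamiltonian M'‖ := by
  have := (isSpec_spectrumVec M).abs_sub_le (isSpec_spectrumVec M') k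
  have h : inMagicBasis (nonlocalHamiltonian M) - inMagicBasis (nonlocalHamiltonian M') =
      inMagicBasis (nonlocalHamiltonian M - nonlocalHamiltonian M') := by
    simp [inMagicBasis, mul_sub, sub_mul]
  rwa [h, norm_inMagicBasis] at this

lemma continuous_nonlocalHamiltonian : Continuous nonlocalHamiltonian := by
  unfold nonlocalHamiltonian
  fun_prop

lemma continuous_spectrumVec : Continuous spectrumVec := by
  refine continuous_pi fun k => ?_
  rw [continuous_iff_continuousAt]
  intro M
  rw [ContinuousAt, tendsto_iff_norm_sub_tendsto_zero]
  have h0 : Filter.Tendsto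
      (fun M' => 8 * ‖nonlocalHamiltonian M' - nonlocalHamiltonian M‖) (nhds M) (nhds 0) := by
    have : Continuous fun M' => 8 * ‖nonlocalHamiltonian M' - nonlocalHamiltonian M‖ :=
      continuous_const.mul (continuous_nonlocalHamiltonian.sub continuous_const).norm
    simpa using this.tendsto M
  exact squeeze_zero (fun _ => norm_nonneg _) (fun M' => abs_spectrumVec_sub_le M' M k) h0

lemma sum_eigenvalueVector (ϑ : Fin 3 → ℝ) : ∑ i, eigenvalueVector ϑ i = 0 := by
  rw [Fin.sum_univ_four]
  simp [eigenvalueVector]; ring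

lemma spectrumVec_zero : spectrumVec 0 = 0 := by
  refine (isSpec_spectrumVec 0).unique ⟨antitone_const, 1, one_mem_SO4, ?_⟩
  simp [nonlocalHamiltonian, inMagicBasis, diag]

lemma intervalIntegrable_nonlocalHamiltonian {M : ℝ → Matrix (Fin 3) (Fin 3) ℝ} {a b : ℝ}
    (hM : ∀ i j, IntervalIntegrable (fun t => M t i j) volume a b) :
    IntervalIntegrable (fun t => nonlocalHamiltonian (M t)) volume a b := by
  have h : ∀ i j, IntervalIntegrable
      (fun t => (M t i j : ℂ) • tensor (pauli i) (pauli j)) volume a b := by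
    intro i j
    have h2 : IntervalIntegrable (fun t => (M t i j : ℂ)) volume a b :=
      ⟨(hM i j).1.ofReal, (hM i j).2.ofReal⟩
    exact ⟨h2.1.smul_const _, h2.2.smul_const _⟩
  exact ⟨integrable_finsetSum _ fun i _ => integrable_finsetSum _ fun j _ => (h i j).1,
    integrable_finsetSum _ fun i _ => integrable_finsetSum _ fun j _ => (h i j).2⟩

/-- The ordered eigenvalues depend continuously on the coupling matrix, which gives measurability,
and are bounded by a multiple of the norm of the Hamiltonian. -/
lemma intervalIntegrable_spectrumVec {M : ℝ → Matrix (Fin 3) (Fin 3) ℝ} {a b : ℝ}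
    (hM : ∀ i j, IntervalIntegrable (fun t => M t i j) volume a b) (k : Fin 4) :
    IntervalIntegrable (fun t => spectrumVec (M t) k) volume a b := by
  have hmeas : AEStronglyMeasurable M (volume.restrict (uIoc a b)) := by
    have : AEStronglyMeasurable (fun t => ∑ i, ∑ j, M t i j • Matrix.single i j (1 : ℝ))
        (volume.restrict (uIoc a b)) := by
      refine Finset.aestronglyMeasurable_fun_sum _ fun i _ =>
        Finset.aestronglyMeasurable_fun_sum _ fun j _ => ?_
      exact (intervalIntegrable_iff.1 (hM i j)).aestronglyMeasurable.smul_const _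
    refine this.congr (Filter.Eventually.of_forall fun t => ?_)
    conv_rhs => rw [Matrix.matrix_eq_sum_single (M t)]
    simp [Matrix.smul_single]
  have hn := (intervalIntegrable_nonlocalHamiltonian hM).norm.const_mul 8
  rw [intervalIntegrable_iff] at hn ⊢
  refine hn.mono' (((continuous_apply k).comp continuous_spectrumVec).comp_aestronglyMeasurable
    hmeas) (Filter.Eventually.of_forall fun t => ?_)
  -- the bound is the Lipschitz estimate, compared with the zero Hamiltonian
  have := abs_spectrumVec_sub_le (M t) 0 k
  simpa [spectrumVec_zero, nonlocalHamiltonian] using this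

lemma canonicalParameters_eq (M : Matrix (Fin 3) (Fin 3) ℝ) :
    canonicalParameters (nonlocalHamiltonian M) =
      ![(spectrumVec M 0 + spectrumVec M 1) / 2, (spectrumVec M 0 + spectrumVec M 2) / 2,
        (spectrumVec M 1 + spectrumVec M 2) / 2] := by
  ext i
  fin_cases i <;> simp [spectrumVec, eigenvalueVector] <;> ring

lemma intervalIntegrable_canonicalParameters {M : ℝ → Matrix (Fin 3) (Fin 3) ℝ} {a b : ℝ}
    (hM : ∀ i j, IntervalIntegrable (fun t => M t i j) volume a b) (i : Fin 3) :
    IntervalIntegrable (fun t => canonicalParameters (nonlocalHamiltonian (M t)) i)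
      volume a b := by
  have h := intervalIntegrable_spectrumVec hM
  have key : ∀ j k : Fin 4, IntervalIntegrable
      (fun t => (spectrumVec (M t) j + spectrumVec (M t) k) / 2) volume a b :=
    fun j k => ((h j).add (h k)).div_const 2
  simp only [canonicalParameters_eq]
  fin_cases i
  · exact key 0 1
  · exact key 0 2
  · exact key 1 2

/-! ### Carathéodory solutions of linear equations -/

/-- `U` solves `U' = G U`, `U(a) = 1`, on `[a, b]` in integrated form. -/
def IsSolution (G : ℝ → Matrix (Fin 4) (Fin 4) ℂ) (a b : ℝ) (U : ℝ → Matrix (Fin 4) (Fin 4) ℂ) :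
    Prop :=
  ContinuousOn U (Icc a b) ∧ ∀ t ∈ Icc a b, U t = 1 + ∫ s in a..t, G s * U s

lemma exists_continuous_integral_sub_le {E : Type*} [NormedAddCommGroup E] [NormedSpace ℝ E]
    {f : ℝ → E} {a b : ℝ} (hab : a ≤ b) (hf : IntervalIntegrable f volume a b) {ε : ℝ}
    (hε : 0 < ε) : ∃ g : ℝ → E, Continuous g ∧ ∫ t in a..b, ‖f t - g t‖ ≤ ε := by
  have h : Integrable f (volume.restrict (Ioc a b)) :=
    (intervalIntegrable_iff_integrableOn_Ioc_of_le hab).1 hf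
  obtain ⟨g, -, hg, hgc, -⟩ := h.exists_hasCompactSupport_integral_sub_le hε
  exact ⟨g, hgc, by rwa [intervalIntegral.integral_of_le hab]⟩

/-- Skew-Hermitian integrable functions are `L¹`-limits of continuous skew-Hermitian ones. -/
lemma exists_continuous_skew {G : ℝ → Matrix (Fin 4) (Fin 4) ℂ} {a b : ℝ} (hab : a ≤ b)
    (hG : IntervalIntegrable G volume a b) (hskew : ∀ t, star (G t) = - G t) {ε : ℝ}
    (hε : 0 < ε) : ∃ g : ℝ → Matrix (Fin 4) (Fin 4) ℂ, Continuous g ∧ (∀ t, star (g t) = - g t) ∧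
      ∫ t in a..b, ‖G t - g t‖ ≤ ε := by
  obtain ⟨g, hgc, hg⟩ := exists_continuous_integral_sub_le hab hG hε
  have hgc' : Continuous fun t => (1 / 2 : ℝ) • (g t - star (g t)) := by
    fun_prop
  refine ⟨fun t => (1 / 2 : ℝ) • (g t - star (g t)), hgc', fun t => ?_, le_trans ?_ hg⟩
  · rw [star_smul, star_sub, star_star, ← smul_neg, neg_sub]; simp
  · refine intervalIntegral.integral_mono_on hab (hG.sub (hgc'.intervalIntegrable _ _)).norm
      (hG.sub (hgc.intervalIntegrable _ _)).norm fun t _ => ?_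
    have h1 : G t - (1 / 2 : ℝ) • (g t - star (g t)) =
        (1 / 2 : ℝ) • ((G t - g t) - star (G t - g t)) := by
      rw [star_sub, hskew]; module
    rw [h1, norm_smul, Real.norm_of_nonneg (by norm_num)]
    have h2 := norm_sub_le (G t - g t) (star (G t - g t))
    rw [norm_star] at h2
    linarith

lemma exp_smul_mem_unitary {A : Matrix (Fin 4) (Fin 4) ℂ} (hA : star A = -A) (c : ℝ) :
    NormedSpace.exp (c • A) ∈ unitary (Matrix (Fin 4) (Fin 4) ℂ) := by
  let _ : NormedAlgebra ℚ (Matrix (Fin 4) (Fin 4) ℂ) := NormedAlgebra.restrictScalars ℚ ℝ _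
  apply NormedSpace.exp_mem_unitary_of_mem_skewAdjoint
  rw [skewAdjoint.mem_iff, star_smul, hA]
  simp

lemma hasDerivAt_exp_sub_smul (A : Matrix (Fin 4) (Fin 4) ℂ) (c t : ℝ) :
    HasDerivAt (fun s : ℝ => NormedSpace.exp ((s - c) • A))
      (A * NormedSpace.exp ((t - c) • A)) t := by
  have h := hasDerivAt_exp_smul_const' (𝕂 := ℝ) A (t - c)
  have h' : HasDerivAt (fun s : ℝ => s - c) 1 t := (hasDerivAt_id t).sub_const c
  have := h.scomp t h'
  simpa [Function.comp_def] using this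

/-- **Viability estimate.** If a moving compact set is tangent to the flow of a continuous
skew-Hermitian generator `Gc` at each of its points, then a solution of `U' = G U` starting in the
set stays as close to it as `G` is to `Gc` in `L¹`. The flow of `Gc` consists of isometries, so the
distance to the set grows at most at the rate `‖(G - Gc) U‖`. -/
lemma infDist_solution_le {a b B : ℝ} (hab : a ≤ b) {U G Gc : ℝ → Matrix (Fin 4) (Fin 4) ℂ}
    {C : ℝ → Set (Matrix (Fin 4) (Fin 4) ℂ)} (hU : IsSolution G a b U)
    (hG : IntervalIntegrable G volume a b) (hB : ∀ t ∈ Icc a b, ‖U t‖ ≤ B)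
    (hGc : Continuous Gc) (hskew : ∀ t, star (Gc t) = - Gc t)
    (hcomp : ∀ t ∈ Icc a b, IsCompact (C t)) (hne : ∀ t ∈ Icc a b, (C t).Nonempty)
    (hcont : ContinuousOn (fun t => Metric.infDist (U t) (C t)) (Icc a b))
    (htan : ∀ t ∈ Ico a b, ∀ y ∈ C t, ∃ z : ℝ → Matrix (Fin 4) (Fin 4) ℂ,
      (∀ s ∈ Icc t b, z s ∈ C s) ∧ z t = y ∧ HasDerivWithinAt z (Gc t * y) (Ici t) t)
    (h1 : (1 : Matrix (Fin 4) (Fin 4) ℂ) ∈ C a) :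
    Metric.infDist (U b) (C b) ≤ B * ∫ s in a..b, ‖G s - Gc s‖ := by
  obtain ⟨hUc, hUeq⟩ := hU
  -- a continuous extension of `U` to the whole line
  obtain ⟨V, hV, hVU⟩ : ∃ V : ℝ → Matrix (Fin 4) (Fin 4) ℂ, Continuous V ∧
      ∀ t ∈ Icc a b, U t = V t :=
    ⟨IccExtend hab ((Icc a b).domRestrict U), (hUc.domRestrict).Icc_extend',
      fun t ht => by rw [IccExtend_of_mem _ _ ht]; rfl⟩
  have hUa : U a = 1 := by simpa using hUeq a (left_mem_Icc.2 hab)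
  have hsub : ∀ x ∈ Icc a b, ∀ y ∈ Icc a b, uIcc x y ⊆ uIcc a b := by
    intro x hx y hy
    rw [uIcc_of_le hab]
    exact uIcc_subset_Icc hx hy
  have hdiff : IntervalIntegrable (fun s => ‖G s - Gc s‖) volume a b :=
    (hG.sub (hGc.intervalIntegrable _ _)).norm
  have hGV : IntervalIntegrable (fun s => G s * V s) volume a b :=
    hG.mul_continuousOn hV.continuousOn
  have hGcV : Continuous fun s => Gc s * V s := hGc.mul hV
  have hincr : ∀ x ∈ Icc a b, ∀ s ∈ Icc x b, U s = U x + ∫ r in x..s, G r * V r := by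
    intro x hx s hs
    have hs' : s ∈ Icc a b := ⟨hx.1.trans hs.1, hs.2⟩
    have hV' : ∀ t ∈ Icc a b, ∫ r in a..t, G r * U r = ∫ r in a..t, G r * V r := by
      intro t ht
      refine intervalIntegral.integral_congr fun r hr => ?_
      rw [uIcc_of_le ht.1] at hr
      rw [hVU r ⟨hr.1, hr.2.trans ht.2⟩]
    rw [hUeq s hs', hUeq x hx, hV' s hs', hV' x hx, add_assoc,
      intervalIntegral.integral_add_adjacent_intervals]
    · exact hGV.mono_set (hsub _ (left_mem_Icc.2 hab) _ hx)
    · exact hGV.mono_set (hsub _ hx _ hs')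
  set I : ℝ → ℝ := fun t => ∫ s in a..t, ‖G s - Gc s‖ with hI
  have hIcont : ContinuousOn I (Icc a b) := by
    have := intervalIntegral.continuousOn_primitive_interval' hdiff (left_mem_uIcc)
    rwa [uIcc_of_le hab] at this
  set f : ℝ → ℝ := fun t => Metric.infDist (U t) (C t) - B * I t with hf
  have hfcont : ContinuousOn f (Icc a b) := hcont.sub (continuousOn_const.mul hIcont)
  have hfa : f a ≤ 0 := by
    simp [hf, hI, hUa, Metric.infDist_zero_of_mem h1]
  have key := image_le_of_liminf_slope_right_le_deriv_boundary hfcont (B := fun _ => 0)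
    (B' := fun _ => 0) hfa continuousOn_const (fun x _ => hasDerivWithinAt_const _ _ _) ?_
    (right_mem_Icc.2 hab)
  · simp only [hf] at key
    linarith
  intro x hx r hr
  have hx' : x ∈ Icc a b := ⟨hx.1, hx.2.le⟩
  obtain ⟨y, hy, hyd⟩ := (hcomp x hx').exists_infDist_eq_dist (hne x hx') (U x)
  obtain ⟨z, hzC, hzx, hzd⟩ := htan x hx y hy
  -- the first-order remainder
  set w : ℝ → Matrix (Fin 4) (Fin 4) ℂ := fun s => U x + (∫ q in x..s, Gc q * V q) - z s -
    NormedSpace.exp ((s - x) • Gc x) * (U x - y) with hw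
  have hwx : w x = 0 := by simp [hw, hzx]
  have hwd : HasDerivWithinAt w 0 (Ici x) x := by
    have d1 : HasDerivAt (fun s => ∫ q in x..s, Gc q * V q) (Gc x * V x) x :=
      intervalIntegral.integral_hasDerivAt_right (hGcV.intervalIntegrable _ _)
        (hGcV.stronglyMeasurableAtFilter _ _) hGcV.continuousAt
    have d2 : HasDerivAt (fun s : ℝ => NormedSpace.exp ((s - x) • Gc x)) (Gc x) x := by
      simpa using hasDerivAt_exp_sub_smul (Gc x) x x
    have := ((d1.hasDerivWithinAt (s := Ici x)).const_add (U x)).sub hzd |>.sub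
      ((d2.hasDerivWithinAt (s := Ici x)).mul_const (U x - y))
    refine this.congr_deriv ?_
    rw [hVU x hx', mul_sub]; abel
  have hev : ∀ᶠ s in nhdsWithin x (Ioi x), ‖w s‖ ≤ r / 2 * (s - x) := by
    have h := (hasDerivWithinAt_iff_isLittleO.1 hwd).def (half_pos hr)
    filter_upwards [nhdsWithin_mono x Ioi_subset_Ici_self h, self_mem_nhdsWithin] with s hs hsx
    have hsx' : x < s := hsx
    simpa [hwx, abs_of_pos (sub_pos.2 hsx')] using hs
  have hIoc : Ioc x b ∈ nhdsWithin x (Ioi x) := Ioc_mem_nhdsGT hx.2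
  refine Filter.Eventually.frequently ?_
  filter_upwards [hev, hIoc] with s hs hsb
  have hs1 : s ∈ Icc x b := ⟨hsb.1.le, hsb.2⟩
  have hs2 : s ∈ Icc a b := ⟨hx.1.trans hs1.1, hs1.2⟩
  have hdec : U s - z s = w s + NormedSpace.exp ((s - x) • Gc x) * (U x - y) +
      ∫ q in x..s, (G q - Gc q) * V q := by
    have hsplit : ∫ q in x..s, (G q - Gc q) * V q =
        (∫ q in x..s, G q * V q) - ∫ q in x..s, Gc q * V q := by
      rw [← intervalIntegral.integral_sub (hGV.mono_set (hsub _ hx' _ hs2))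
        (hGcV.intervalIntegrable _ _)]
      simp only [sub_mul]
    rw [hincr x hx' s hs1, hsplit]
    simp only [hw]; abel
  have hint : ‖∫ q in x..s, (G q - Gc q) * V q‖ ≤ B * (I s - I x) := by
    have hIs : I s - I x = ∫ q in x..s, ‖G q - Gc q‖ := by
      simp only [hI]
      rw [sub_eq_iff_eq_add', intervalIntegral.integral_add_adjacent_intervals]
      · exact hdiff.mono_set (hsub _ (left_mem_Icc.2 hab) _ hx')
      · exact hdiff.mono_set (hsub _ hx' _ hs2)
    rw [hIs, ← intervalIntegral.integral_const_mul]
    refine intervalIntegral.norm_integral_le_of_norm_le hs1.1 (Filter.Eventually.of_forall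
      fun q hq => ?_) ((hdiff.mono_set (hsub _ hx' _ hs2)).const_mul B)
    have hq' : q ∈ Icc a b := ⟨hx.1.trans hq.1.le, hq.2.trans hsb.2⟩
    refine (norm_mul_le _ _).trans ?_
    rw [mul_comm]
    exact mul_le_mul_of_nonneg_right (by rw [← hVU q hq']; exact hB q hq') (norm_nonneg _)
  have hdist : Metric.infDist (U s) (C s) ≤
      r / 2 * (s - x) + Metric.infDist (U x) (C x) + B * (I s - I x) := by
    refine (Metric.infDist_le_dist_of_mem (hzC s hs1)).trans ?_
    rw [dist_eq_norm, hdec, hyd, dist_eq_norm]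
    refine (norm_add₃_le).trans (add_le_add (add_le_add hs ?_) hint)
    rw [norm_unitary_mul (exp_smul_mem_unitary (hskew x) _)]
  rw [slope_def_field, div_lt_iff₀ (sub_pos.2 hsb.1)]
  simp only [hf]
  nlinarith [sub_pos.2 hsb.1]

lemma isCompact_unitary : IsCompact (unitary (Matrix (Fin 4) (Fin 4) ℂ) :
    Set (Matrix (Fin 4) (Fin 4) ℂ)) := by
  refine Metric.isCompact_of_isClosed_isBounded isClosed_unitary ?_
  refine (Metric.isBounded_closedBall (x := (0 : Matrix (Fin 4) (Fin 4) ℂ)) (r := 1)).subset ?_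
  intro K hK
  simp [norm_unitary hK]

lemma IsSolution.apply_left {G U : ℝ → Matrix (Fin 4) (Fin 4) ℂ} {a b : ℝ} (hab : a ≤ b)
    (h : IsSolution G a b U) : U a = 1 := by
  simpa using h.2 a (left_mem_Icc.2 hab)

lemma IsSolution.mono {G U : ℝ → Matrix (Fin 4) (Fin 4) ℂ} {a b c : ℝ}
    (h : IsSolution G a b U) (hc : c ≤ b) : IsSolution G a c U :=
  ⟨h.1.mono (Icc_subset_Icc_right hc), fun t ht => h.2 t ⟨ht.1, ht.2.trans hc⟩⟩

lemma IsSolution.mem_unitary {G U : ℝ → Matrix (Fin 4) (Fin 4) ℂ} {a b : ℝ} (hab : a ≤ b)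
    (h : IsSolution G a b U) (hG : IntervalIntegrable G volume a b)
    (hskew : ∀ t, star (G t) = - G t) : U b ∈ unitary (Matrix (Fin 4) (Fin 4) ℂ) := by
  obtain ⟨B, hB⟩ := (isCompact_Icc.image_of_continuousOn h.1).isBounded.exists_norm_le
  have hB' : ∀ t ∈ Icc a b, ‖U t‖ ≤ B := fun t ht => hB _ (mem_image_of_mem _ ht)
  have hB0 : 0 ≤ B := (norm_nonneg _).trans (hB' a (left_mem_Icc.2 hab))
  have hne : (unitary (Matrix (Fin 4) (Fin 4) ℂ) : Set (Matrix (Fin 4) (Fin 4) ℂ)).Nonempty :=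
    ⟨1, one_mem _⟩
  have key : ∀ ε : ℝ, 0 < ε → Metric.infDist (U b)
      (unitary (Matrix (Fin 4) (Fin 4) ℂ) : Set (Matrix (Fin 4) (Fin 4) ℂ)) ≤ 0 + ε := by
    intro ε hε
    obtain ⟨g, hgc, hgs, hg⟩ := exists_continuous_skew hab hG hskew
      (ε := ε / (B + 1)) (by positivity)
    have := infDist_solution_le hab (C := fun _ => (unitary (Matrix (Fin 4) (Fin 4) ℂ) :
        Set (Matrix (Fin 4) (Fin 4) ℂ))) h hG hB' hgc hgs
      (fun _ _ => isCompact_unitary) (fun _ _ => hne)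
      ((Metric.continuous_infDist_pt _).comp_continuousOn h.1) ?_ (one_mem _)
    · refine this.trans ?_
      calc B * ∫ s in a..b, ‖G s - g s‖ ≤ B * (ε / (B + 1)) :=
            mul_le_mul_of_nonneg_left hg hB0
        _ ≤ 0 + ε := by
            rw [zero_add, ← mul_div_assoc, div_le_iff₀ (by positivity)]
            nlinarith
    · intro t _ y hy
      refine ⟨fun s => NormedSpace.exp ((s - t) • g t) * y, fun s _ =>
        mul_mem (exp_smul_mem_unitary (hgs t) _) hy, by simp, ?_⟩
      have := ((hasDerivAt_exp_sub_smul (g t) t t).mul_const y).hasDerivWithinAt (s := Ici t)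
      simpa using this
  have h0 := le_of_forall_pos_le_add key
  have := (isClosed_unitary (R := Matrix (Fin 4) (Fin 4) ℂ)).mem_iff_infDist_zero hne (x := U b)
  exact this.2 (le_antisymm h0 Metric.infDist_nonneg)

/-- Stability: a solution is as close to the flow of a constant generator as the generators are
in `L¹`. -/
lemma IsSolution.norm_sub_exp_le {G U : ℝ → Matrix (Fin 4) (Fin 4) ℂ} {a b : ℝ} (hab : a ≤ b)
    (h : IsSolution G a b U) (hG : IntervalIntegrable G volume a b)
    (hskew : ∀ t, star (G t) = - G t) {A : Matrix (Fin 4) (Fin 4) ℂ} (hA : star A = -A) :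
    ‖U b - NormedSpace.exp ((b - a) • A)‖ ≤ ∫ s in a..b, ‖G s - A‖ := by
  have hB : ∀ t ∈ Icc a b, ‖U t‖ ≤ 1 := by
    intro t ht
    refine (norm_unitary ((h.mono ht.2).mem_unitary ht.1 (hG.mono_set ?_) hskew)).le
    rw [uIcc_of_le hab, uIcc_of_le ht.1]
    exact Icc_subset_Icc_right ht.2
  have hcont : Continuous fun t : ℝ => NormedSpace.exp ((t - a) • A) :=
    continuous_iff_continuousAt.2 fun t => (hasDerivAt_exp_sub_smul A a t).continuousAt
  have := infDist_solution_le hab (C := fun t => {NormedSpace.exp ((t - a) • A)}) h hG hB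
    (continuous_const (y := A)) (fun _ => hA) (fun _ _ => isCompact_singleton)
    (fun _ _ => singleton_nonempty _) ?_ ?_ (by simp)
  · simpa [dist_eq_norm] using this
  · simp only [Metric.infDist_singleton]
    exact continuous_dist.comp_continuousOn (h.1.prodMk hcont.continuousOn)
  · rintro t - y rfl
    exact ⟨fun s => NormedSpace.exp ((s - a) • A), fun s _ => rfl, rfl,
      (hasDerivAt_exp_sub_smul A a t).hasDerivWithinAt⟩

/-! ### The sets `SO(4) exp(-i D_β) SO(4)`, `β` majorized by `a` -/

/-- The diagonal unitary `exp (-i D_b)`. -/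
noncomputable def phase (b : Fin 4 → ℝ) : Matrix (Fin 4) (Fin 4) ℂ :=
  NormedSpace.exp ((-Complex.I) • diag b)

lemma phase_eq (b : Fin 4 → ℝ) :
    phase b = Matrix.diagonal fun k => Complex.exp (-Complex.I * b k) := by
  rw [phase, diag, ← Matrix.diagonal_smul, Matrix.exp_diagonal]
  congr 1
  ext k
  rw [Pi.coe_exp, Complex.exp_eq_exp_ℂ]
  simp

lemma phase_add (b c : Fin 4 → ℝ) : phase (b + c) = phase b * phase c := by
  rw [phase_eq, phase_eq, phase_eq, Matrix.diagonal_mul_diagonal]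
  congr 1
  ext k
  rw [← Complex.exp_add]
  congr 1
  simp; ring

@[simp] lemma phase_zero : phase 0 = 1 := by
  simp [phase_eq]

lemma phase_mem_unitary (b : Fin 4 → ℝ) :
    phase b ∈ unitary (Matrix (Fin 4) (Fin 4) ℂ) := by
  have := exp_smul_mem_unitary (A := (-Complex.I) • diag b) ?_ 1
  · simpa [phase] using this
  · rw [star_smul, Matrix.star_eq_conjTranspose, diag, Matrix.diagonal_conjTranspose]
    have : star (fun k => (b k : ℂ)) = fun k => (b k : ℂ) := by ext k; simp
    rw [this]
    simp

lemma norm_phase_sub_le (b c : Fin 4 → ℝ) : ‖phase b - phase c‖ ≤ ‖b - c‖ := by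
  rw [phase_eq, phase_eq, Matrix.diagonal_sub, Matrix.l2_opNorm_diagonal,
    pi_norm_le_iff_of_nonneg (norm_nonneg _)]
  intro k
  have h : Complex.exp (-Complex.I * b k) - Complex.exp (-Complex.I * c k) =
      Complex.exp (((-(c k) : ℝ) : ℂ) * Complex.I) *
        (Complex.exp (Complex.I * ((c k - b k : ℝ) : ℂ)) - 1) := by
    rw [mul_sub, ← Complex.exp_add, mul_one]
    congr 2 <;> push_cast <;> ring
  rw [h, norm_mul, Complex.norm_exp_ofReal_mul_I, one_mul]
  refine Real.norm_exp_I_mul_ofReal_sub_one_le.trans ?_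
  rw [← norm_neg, neg_sub]
  exact norm_le_pi_norm (b - c) k

lemma continuous_phase : Continuous phase := by
  refine continuous_iff_continuousAt.2 fun c => ?_
  rw [ContinuousAt, tendsto_iff_norm_sub_tendsto_zero]
  refine squeeze_zero (fun _ => norm_nonneg _) (fun b => norm_phase_sub_le b c) ?_
  have : Continuous fun b : Fin 4 → ℝ => ‖b - c‖ := by fun_prop
  simpa using this.tendsto c

/-- The set of matrices `R exp(-i D_b) P` with `R, P ∈ SO(4)` and `b` majorized by `a`. -/
def kakSet (a : Fin 4 → ℝ) : Set (Matrix (Fin 4) (Fin 4) ℂ) :=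
  {X | ∃ R ∈ SO4, ∃ P ∈ SO4, ∃ b, IsMaj b a ∧ X = R * phase b * P}

lemma isCompact_isMaj (a : Fin 4 → ℝ) : IsCompact {b | IsMaj b a} := by
  refine IsCompact.of_isClosed_subset ((isCompact_doublyStochastic 4).image
    (f := fun D => D *ᵥ a) (by fun_prop)) (isClosed_isMaj a) fun b hb => ?_
  obtain ⟨D, hD, h⟩ := IsMaj.exists_doublyStochastic hb
  exact ⟨D, hD, h.symm⟩

lemma isCompact_kakSet (a : Fin 4 → ℝ) : IsCompact (kakSet a) := by
  have h := ((isCompact_SO4.prod isCompact_SO4).prod (isCompact_isMaj a)).image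
    (f := fun x : (Matrix (Fin 4) (Fin 4) ℂ × Matrix (Fin 4) (Fin 4) ℂ) × (Fin 4 → ℝ) =>
      x.1.1 * phase x.2 * x.1.2)
    (((continuous_fst.comp continuous_fst).mul (continuous_phase.comp continuous_snd)).mul
      (continuous_snd.comp continuous_fst))
  convert h using 1
  ext X
  constructor
  · rintro ⟨R, hR, P, hP, b, hb, rfl⟩
    exact ⟨((R, P), b), ⟨⟨hR, hP⟩, hb⟩, rfl⟩
  · rintro ⟨⟨⟨R, P⟩, b⟩, ⟨⟨hR, hP⟩, hb⟩, rfl⟩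
    exact ⟨R, hR, P, hP, b, hb, rfl⟩

lemma kakSet_nonempty (a : Fin 4 → ℝ) (ha : Antitone a) : (kakSet a).Nonempty :=
  ⟨_, 1, one_mem_SO4, 1, one_mem_SO4, a, by simpa using isMaj_mulVec (one_mem _) ha, rfl⟩

lemma norm_mulVec_le {D : Matrix (Fin 4) (Fin 4) ℝ} (hD : D ∈ doublyStochastic ℝ (Fin 4))
    (x : Fin 4 → ℝ) : ‖D *ᵥ x‖ ≤ ‖x‖ := by
  rw [pi_norm_le_iff_of_nonneg (norm_nonneg _)]
  intro i
  calc ‖(D *ᵥ x) i‖ = ‖∑ j, D i j * x j‖ := rfl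
    _ ≤ ∑ j, ‖D i j * x j‖ := norm_sum_le _ _
    _ ≤ ∑ j, D i j * ‖x‖ := Finset.sum_le_sum fun j _ => by
        rw [norm_mul, Real.norm_of_nonneg (nonneg_of_mem_doublyStochastic hD)]
        exact mul_le_mul_of_nonneg_left (norm_le_pi_norm x j) (nonneg_of_mem_doublyStochastic hD)
    _ = ‖x‖ := by rw [← Finset.sum_mul, sum_row_of_mem_doublyStochastic hD, one_mul]

/-- The sets `kakSet a` vary continuously with `a` in the Hausdorff sense. -/
lemma infDist_kakSet_le {a a' : Fin 4 → ℝ} (ha : Antitone a) (ha' : Antitone a')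
    (X : Matrix (Fin 4) (Fin 4) ℂ) :
    Metric.infDist X (kakSet a') ≤ Metric.infDist X (kakSet a) + ‖a - a'‖ := by
  obtain ⟨y, ⟨R, hR, P, hP, b, hb, rfl⟩, hy⟩ :=
    (isCompact_kakSet a).exists_infDist_eq_dist (kakSet_nonempty a ha) X
  obtain ⟨D, hD, rfl⟩ := hb.exists_doublyStochastic
  have hz : R * phase (D *ᵥ a') * P ∈ kakSet a' :=
    ⟨R, hR, P, hP, _, isMaj_mulVec hD ha', rfl⟩
  have hyz : dist (R * phase (D *ᵥ a) * P) (R * phase (D *ᵥ a') * P) ≤ ‖a - a'‖ := by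
    rw [dist_eq_norm, ← sub_mul, ← mul_sub, norm_mul_unitary (SO4_mem_unitary hP),
      norm_unitary_mul (SO4_mem_unitary hR)]
    refine (norm_phase_sub_le _ _).trans ?_
    rw [← Matrix.mulVec_sub]
    exact norm_mulVec_le hD _
  calc _ ≤ dist X (R * phase (D *ᵥ a') * P) := Metric.infDist_le_dist_of_mem hz
    _ ≤ dist X (R * phase (D *ᵥ a) * P) + _ := dist_triangle _ _ _
    _ ≤ _ := by rw [hy]; exact add_le_add le_rfl hyz

lemma continuousOn_infDist_kakSet {U : ℝ → Matrix (Fin 4) (Fin 4) ℂ} {α : ℝ → Fin 4 → ℝ}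
    {s : Set ℝ} (hU : ContinuousOn U s) (hα : ContinuousOn α s) (hanti : ∀ t ∈ s, Antitone (α t)) :
    ContinuousOn (fun t => Metric.infDist (U t) (kakSet (α t))) s := by
  intro t ht
  rw [ContinuousWithinAt, tendsto_iff_dist_tendsto_zero]
  have h0 : Filter.Tendsto (fun r => dist (U r) (U t) + ‖α r - α t‖) (nhdsWithin t s) (nhds 0) := by
    have h1 := tendsto_iff_dist_tendsto_zero.1 (hU t ht)
    have h2 := tendsto_iff_norm_sub_tendsto_zero.1 (hα t ht)
    simpa using h1.add h2
  refine squeeze_zero' (Filter.Eventually.of_forall fun _ => dist_nonneg) ?_ h0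
  filter_upwards [self_mem_nhdsWithin] with r hr
  have a1 := infDist_kakSet_le (hanti r hr) (hanti t ht) (U t)
  have a2 := infDist_kakSet_le (hanti t ht) (hanti r hr) (U r)
  have a3 := Metric.infDist_le_infDist_add_dist (s := kakSet (α r)) (x := U t) (y := U r)
  have a4 := Metric.infDist_le_infDist_add_dist (s := kakSet (α t)) (x := U r) (y := U t)
  rw [norm_sub_rev] at a2
  rw [dist_comm] at a3
  rw [Real.dist_eq, abs_le]
  constructor <;> linarith

/-! ### Tangent curves -/

lemma map_star_eq (X : Matrix (Fin 4) (Fin 4) ℂ) : X.map star = Xᴴᵀ := rfl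

/-- A real antisymmetric matrix exponentiates into `SO(4)`. -/
lemma exp_mem_SO4 {X : Matrix (Fin 4) (Fin 4) ℂ} (hr : X.map star = X) (hX : Xᵀ = -X) :
    NormedSpace.exp X ∈ SO4 := by
  have horth : ∀ Y : Matrix (Fin 4) (Fin 4) ℂ, Yᵀ = -Y →
      (NormedSpace.exp Y)ᵀ * NormedSpace.exp Y = 1 := by
    intro Y hY
    rw [← Matrix.exp_transpose, hY, Matrix.exp_neg]
    exact Matrix.nonsing_inv_mul _ ((Matrix.isUnit_iff_isUnit_det _).1 (Matrix.isUnit_exp Y))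
  refine mem_SO4_iff.2 ⟨?_, horth X hX, ?_⟩
  · rw [map_star_eq, ← Matrix.exp_conjTranspose, ← Matrix.exp_transpose, ← map_star_eq, hr]
  · -- an exponential is a square, so its determinant is the square of `±1`
    set Y := (1 / 2 : ℂ) • X with hY
    have hX2 : X = (2 : ℕ) • Y := by
      rw [hY, ← Nat.cast_smul_eq_nsmul ℂ, smul_smul]; norm_num
    have hYt : Yᵀ = -Y := by rw [hY, Matrix.transpose_smul, hX, smul_neg]
    have := congrArg Matrix.det (horth Y hYt)
    rw [Matrix.det_mul, Matrix.det_transpose, Matrix.det_one] at this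
    rw [hX2, Matrix.exp_nsmul, Matrix.det_pow, sq, this]

lemma real_smul_map_star {X : Matrix (Fin 4) (Fin 4) ℂ} (hr : X.map star = X) (c : ℝ) :
    (c • X).map star = c • X := by
  ext i j
  have := congrFun (congrFun hr i) j
  simp only [Matrix.map_apply, Matrix.smul_apply] at this ⊢
  rw [star_smul, this]; simp

lemma exp_smul_mem_SO4 {X : Matrix (Fin 4) (Fin 4) ℂ} (hr : X.map star = X) (hX : Xᵀ = -X)
    (c : ℝ) : NormedSpace.exp (c • X) ∈ SO4 :=
  exp_mem_SO4 (real_smul_map_star hr c) (by rw [Matrix.transpose_smul, hX, smul_neg])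

/-- The generator of the rotations in the coordinate plane `(i, j)`. -/
def planeRotation (i j : Fin 4) : Matrix (Fin 4) (Fin 4) ℂ :=
  Matrix.single i j 1 - Matrix.single j i 1

lemma planeRotation_real (i j : Fin 4) : (planeRotation i j).map star = planeRotation i j := by
  ext k l
  simp only [planeRotation, Matrix.map_apply, Matrix.sub_apply, Matrix.single_apply, star_sub]
  split_ifs <;> simp

lemma planeRotation_transpose (i j : Fin 4) : (planeRotation i j)ᵀ = -planeRotation i j := by
  simp [planeRotation, Matrix.transpose_single]

/-- If `sin (b i - b j) = 0` then `exp (-i D_b)` normalizes the rotations in the plane `(i, j)`. -/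
lemma planeRotation_mul_phase {b : Fin 4 → ℝ} {i j : Fin 4} (h : Real.sin (b i - b j) = 0) :
    planeRotation i j * phase b = phase b * ((Real.cos (b i - b j)) • planeRotation i j) := by
  have hsq : Real.cos (b i - b j) * Real.cos (b i - b j) = 1 := by
    have := Real.sin_sq_add_cos_sq (b i - b j)
    rw [h] at this; nlinarith
  have he : Complex.exp (-Complex.I * b i) =
      Complex.exp (-Complex.I * b j) * ((Real.cos (b i - b j) : ℝ) : ℂ) := by
    have : (-Complex.I * b i : ℂ) = -Complex.I * b j + ((-(b i - b j) : ℝ) : ℂ) * Complex.I := by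
      push_cast; ring
    rw [this, Complex.exp_add, Complex.exp_mul_I, ← Complex.ofReal_cos, ← Complex.ofReal_sin,
      Real.sin_neg, Real.cos_neg, h]
    simp
  have he' : Complex.exp (-Complex.I * b j) =
      Complex.exp (-Complex.I * b i) * ((Real.cos (b i - b j) : ℝ) : ℂ) := by
    rw [he, mul_assoc, ← Complex.ofReal_mul, hsq]; simp
  have hright : ∀ (d : Fin 4 → ℂ) (k l : Fin 4),
      Matrix.single k l 1 * Matrix.diagonal d = d l • Matrix.single k l 1 := by
    intro d k l
    ext p q
    rw [Matrix.mul_diagonal, Matrix.smul_apply, Matrix.single_apply]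
    split_ifs with h
    · simp [h.2]
    · simp
  have hleft : ∀ (d : Fin 4 → ℂ) (k l : Fin 4),
      Matrix.diagonal d * Matrix.single k l 1 = d k • Matrix.single k l 1 := by
    intro d k l
    ext p q
    rw [Matrix.diagonal_mul, Matrix.smul_apply, Matrix.single_apply]
    split_ifs with h
    · simp [h.1]
    · simp
  have hc : ∀ X : Matrix (Fin 4) (Fin 4) ℂ, Real.cos (b i - b j) • X =
      ((Real.cos (b i - b j) : ℝ) : ℂ) • X := fun X => (Complex.coe_smul _ X).symm
  rw [phase_eq, planeRotation, sub_mul, hright, hright, Matrix.mul_smul, mul_sub, hleft, hleft,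
    hc, smul_sub, smul_smul, smul_smul, mul_comm _ (Complex.exp (-Complex.I * b i)),
    mul_comm _ (Complex.exp (-Complex.I * b j)), ← he, ← he']

/-- If the weighted trace `∑ k (Aᵂ)ₖₖ`, with distinct weights, is maximal at `W = 1` among the
rotations in the plane `(i, j)`, then the `(i, j)` entry of the symmetric matrix `A` vanishes. -/
lemma entry_eq_zero_of_max {A : Matrix (Fin 4) (Fin 4) ℂ} (hAt : ∀ k l, A k l = A l k)
    (hAr : ∀ k l, A k l = ((A k l).re : ℂ)) {i j : Fin 4} (hij : i ≠ j)
    (hle : ∀ φ : ℝ, ∑ k, (k.val : ℝ) * (((NormedSpace.exp (φ • planeRotation i j))ᵀ * A *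
      NormedSpace.exp (φ • planeRotation i j)) k k).re ≤ ∑ k, (k.val : ℝ) * (A k k).re) :
    A i j = 0 := by
  set L := planeRotation i j with hL
  set W : ℝ → Matrix (Fin 4) (Fin 4) ℂ := fun φ => NormedSpace.exp (φ • L) with hW
  have hW0 : W 0 = 1 := by simp [hW]
  have hWd : HasDerivAt W L 0 := by
    have := hasDerivAt_exp_smul_const (𝕂 := ℝ) L (0 : ℝ)
    simpa using this
  have hWtd : HasDerivAt (fun φ => (W φ)ᵀ) (-L) 0 := by
    have := hasDerivAt_exp_smul_const (𝕂 := ℝ) (-L) (0 : ℝ)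
    rw [zero_smul, NormedSpace.exp_zero, one_mul] at this
    refine this.congr_of_eventuallyEq (Filter.Eventually.of_forall fun φ => ?_)
    simp only [hW]
    rw [← Matrix.exp_transpose, Matrix.transpose_smul, planeRotation_transpose]
  have hQd : HasDerivAt (fun φ => (W φ)ᵀ * A * W φ) (A * L - L * A) 0 := by
    have := (hWtd.mul_const A).mul hWd
    simp only [hW0, Matrix.transpose_one, one_mul, mul_one] at this
    refine this.congr_deriv ?_
    rw [neg_mul]; abel
  have hentry : ∀ k, HasDerivAt (fun φ => (((W φ)ᵀ * A * W φ) k k).re)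
      ((A * L - L * A) k k).re 0 := by
    intro k
    let E : Matrix (Fin 4) (Fin 4) ℂ →L[ℝ] ℝ := LinearMap.toContinuousLinearMap
      (Complex.reLm ∘ₗ (Matrix.entryLinearMap ℝ ℂ k k))
    exact E.hasFDerivAt.comp_hasDerivAt (0 : ℝ) hQd
  have hFd : HasDerivAt (fun φ => ∑ k : Fin 4, (k.val : ℝ) * (((W φ)ᵀ * A * W φ) k k).re)
      (∑ k : Fin 4, (k.val : ℝ) * ((A * L - L * A) k k).re) 0 :=
    HasDerivAt.fun_sum fun k _ => (hentry k).const_mul _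
  have hzero : ∑ k : Fin 4, (k.val : ℝ) * ((A * L - L * A) k k).re = 0 := by
    refine IsLocalMax.hasDerivAt_eq_zero (Filter.Eventually.of_forall fun φ => ?_) hFd
    simpa [hW0] using hle φ
  have hdiag : ∀ k, (A * L - L * A) k k =
      (if k = j then 2 * A i j else 0) - (if k = i then 2 * A i j else 0) := by
    intro k
    have h1 : (A * L) k k = (if j = k then A k i else 0) - (if i = k then A k j else 0) := by
      rw [hL, planeRotation, mul_sub, Matrix.sub_apply, Matrix.mul_apply, Matrix.mul_apply]
      simp [Matrix.single_apply, ite_and]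
    have h2 : (L * A) k k = (if i = k then A j k else 0) - (if j = k then A i k else 0) := by
      rw [hL, planeRotation, sub_mul, Matrix.sub_apply, Matrix.mul_apply, Matrix.mul_apply]
      simp [Matrix.single_apply, ite_and]
    rw [Matrix.sub_apply, h1, h2]
    by_cases hkj : k = j
    · subst hkj
      simp only [hij, hij.symm, ↓reduceIte, hAt k i]
      ring
    · by_cases hki : k = i
      · subst hki
        simp only [hij, hij.symm, ↓reduceIte, hAt j k]
        ring
      · rw [if_neg (Ne.symm hkj), if_neg (Ne.symm hki), if_neg (Ne.symm hki),
          if_neg (Ne.symm hkj), if_neg hkj, if_neg hki]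
        ring
  have hval : ∑ k : Fin 4, (k.val : ℝ) * ((A * L - L * A) k k).re =
      2 * ((j.val : ℝ) - i.val) * (A i j).re := by
    simp only [hdiag, Complex.sub_re, mul_sub, Finset.sum_sub_distrib, apply_ite Complex.re,
      Complex.zero_re, mul_ite, mul_zero, Finset.sum_ite_eq', Finset.mem_univ, if_true]
    simp; ring
  rw [hval] at hzero
  have hcij : (j.val : ℝ) - i.val ≠ 0 := by
    rw [sub_ne_zero]
    exact fun h => hij (Fin.ext (Nat.cast_injective h).symm)
  have : (A i j).re = 0 := by
    rcases mul_eq_zero.1 hzero with h | h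
    · exact absurd h (mul_ne_zero two_ne_zero hcij)
    · exact h
  rw [hAr, this, Complex.ofReal_zero]

lemma conj_symm_real {S R : Matrix (Fin 4) (Fin 4) ℂ} (hr : S.map star = S) (hs : Sᵀ = S)
    (hR : R ∈ SO4) : (Rᵀ * S * R)ᵀ = Rᵀ * S * R ∧ (Rᵀ * S * R).map star = Rᵀ * S * R := by
  have hSh : Sᴴ = S := by
    have := congrArg Matrix.transpose hr
    rw [hs] at this
    exact this
  have h1 : (Rᵀ * S * R)ᵀ = Rᵀ * S * R := by
    simp only [Matrix.transpose_mul, Matrix.transpose_transpose, hs, mul_assoc]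
  have h2 : (Rᵀ * S * R)ᴴ = Rᵀ * S * R := by
    rw [← SO4_conjTranspose hR]
    simp only [Matrix.conjTranspose_mul, Matrix.conjTranspose_conjTranspose, hSh, mul_assoc]
  exact ⟨h1, by rw [map_star_eq, h2, h1]⟩

/-- In a decomposition `R exp(-i D_b) P`, the factors can be chosen so that `Rᵀ S R` is diagonal on
the blocks on which `exp (-2 i D_b)` is scalar: choose the one that maximizes a weighted trace. -/
lemma exists_adapted_decomposition {S : Matrix (Fin 4) (Fin 4) ℂ} (hr : S.map star = S)
    (hs : Sᵀ = S) {b : Fin 4 → ℝ} {R₀ P₀ : Matrix (Fin 4) (Fin 4) ℂ} (hR₀ : R₀ ∈ SO4)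
    (hP₀ : P₀ ∈ SO4) : ∃ R ∈ SO4, ∃ P ∈ SO4, R * phase b * P = R₀ * phase b * P₀ ∧
      ∀ i j, i ≠ j → Real.sin (b i - b j) = 0 → (Rᵀ * S * R) i j = 0 := by
  set K : Set (Matrix (Fin 4) (Fin 4) ℂ × Matrix (Fin 4) (Fin 4) ℂ) :=
    (SO4 ×ˢ SO4) ∩ {x | x.1 * phase b * x.2 = R₀ * phase b * P₀} with hK
  have hKc : IsCompact K := (isCompact_SO4.prod isCompact_SO4).inter_right
    (isClosed_eq (by fun_prop) continuous_const)
  let F : Matrix (Fin 4) (Fin 4) ℂ → ℝ := fun R => ∑ k, (k.val : ℝ) * ((Rᵀ * S * R) k k).re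
  have hFc : Continuous F := by
    refine continuous_finsetSum _ fun k _ => continuous_const.mul
      (Complex.continuous_re.comp ?_)
    exact Continuous.matrix_elem (by fun_prop) k k
  obtain ⟨⟨R, P⟩, ⟨⟨hR, hP⟩, hRP⟩, hmax⟩ := hKc.exists_isMaxOn ⟨(R₀, P₀), ⟨hR₀, hP₀⟩, rfl⟩
    (hFc.comp continuous_fst).continuousOn
  refine ⟨R, hR, P, hP, hRP, fun i j hij hsin => ?_⟩
  obtain ⟨hAt, hAr⟩ := conj_symm_real hr hs hR
  refine entry_eq_zero_of_max (A := Rᵀ * S * R) (fun k l => congrFun (congrFun hAt l) k)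
    (fun k l => (Complex.conj_eq_iff_re.1 (congrFun (congrFun hAr k) l)).symm) hij fun φ => ?_
  set L := planeRotation i j with hL
  have hWSO : ∀ φ : ℝ, NormedSpace.exp (φ • L) ∈ SO4 := fun φ =>
    exp_smul_mem_SO4 (planeRotation_real i j) (planeRotation_transpose i j) φ
  set e := Real.cos (b i - b j) with he
  have hmove : NormedSpace.exp (φ • L) * phase b = phase b * NormedSpace.exp ((φ * e) • L) := by
    have hu : IsUnit (phase b) := (Unitary.toUnits ⟨phase b, phase_mem_unitary b⟩).isUnit
    have hdet := (Matrix.isUnit_iff_isUnit_det _).1 hu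
    have h1 : (phase b)⁻¹ * (φ • L) * phase b = (φ * e) • L := by
      rw [mul_assoc, Matrix.smul_mul, planeRotation_mul_phase hsin, Matrix.mul_smul,
        Matrix.mul_smul, Matrix.mul_smul, ← mul_assoc, Matrix.nonsing_inv_mul _ hdet, one_mul,
        smul_smul]
    have h2 := Matrix.exp_conj' (phase b) (φ • L) hu
    rw [h1] at h2
    rw [h2, ← mul_assoc, ← mul_assoc, Matrix.mul_nonsing_inv _ hdet, one_mul]
  have hmem : (R * NormedSpace.exp (φ • L), (NormedSpace.exp ((φ * e) • L))ᵀ * P) ∈ K := by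
    refine ⟨⟨mul_mem_SO4 hR (hWSO φ), mul_mem_SO4 (transpose_mem_SO4 (hWSO _)) hP⟩, ?_⟩
    change R * NormedSpace.exp (φ • L) * phase b * ((NormedSpace.exp ((φ * e) • L))ᵀ * P) = _
    rw [mul_assoc R, hmove]
    calc _ = R * phase b * (NormedSpace.exp ((φ * e) • L) *
          (NormedSpace.exp ((φ * e) • L))ᵀ) * P := by simp only [mul_assoc]
      _ = _ := by rw [SO4_mul_transpose (hWSO _), mul_one]; exact hRP
  have hle := isMaxOn_iff.1 hmax _ hmem
  simp only [Function.comp_apply, F, Matrix.transpose_mul, mul_assoc] at hle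
  simpa only [mul_assoc] using hle

lemma phase_apply_eq (b : Fin 4 → ℝ) (j k : Fin 4) :
    Complex.exp (-Complex.I * b j) = Complex.exp (-Complex.I * b k) *
      (((Real.cos (b j - b k) : ℝ) : ℂ) - ((Real.sin (b j - b k) : ℝ) : ℂ) * Complex.I) := by
  have : (-Complex.I * b j : ℂ) = -Complex.I * b k + ((-(b j - b k) : ℝ) : ℂ) * Complex.I := by
    push_cast; ring
  rw [this, Complex.exp_add, Complex.exp_mul_I, ← Complex.ofReal_cos, ← Complex.ofReal_sin,
    Real.sin_neg, Real.cos_neg]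
  push_cast; ring

/-- The linearized decomposition: a generator `-i A + Ω` acting on `exp(-i D_b)` from the left is,
to first order, the effect of infinitesimal rotations `X`, `Y` on the two sides together with a
change of `b` by the diagonal of `A`. -/
lemma exists_linearized_decomposition {A Ω : Matrix (Fin 4) (Fin 4) ℂ} {b d : Fin 4 → ℝ}
    (hAt : Aᵀ = A) (hAr : A.map star = A) (hΩt : Ωᵀ = -Ω) (hΩr : Ω.map star = Ω)
    (hd : ∀ i, A i i = (d i : ℂ))
    (hoff : ∀ i j, i ≠ j → Real.sin (b i - b j) = 0 → A i j = 0) :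
    ∃ X Y : Matrix (Fin 4) (Fin 4) ℂ, X.map star = X ∧ Xᵀ = -X ∧ Y.map star = Y ∧ Yᵀ = -Y ∧
      X * phase b + phase b * ((-Complex.I) • diag d) + phase b * Y =
        ((-Complex.I) • A + Ω) * phase b := by
  have hA' : ∀ i j, A j i = A i j := fun i j => congrFun (congrFun hAt i) j
  have hΩ' : ∀ i j, Ω j i = -Ω i j := fun i j => congrFun (congrFun hΩt i) j
  have hAs : ∀ i j, star (A i j) = A i j := fun i j => congrFun (congrFun hAr i) j
  have hΩs : ∀ i j, star (Ω i j) = Ω i j := fun i j => congrFun (congrFun hΩr i) j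
  have hrs : ∀ x : ℝ, star (x : ℂ) = x := fun x => by simp
  -- where the sine vanishes, so does the off-diagonal entry, and division by `0` gives `0`
  set Y : Matrix (Fin 4) (Fin 4) ℂ := Matrix.of fun i j =>
    A i j / ((Real.sin (b i - b j) : ℝ) : ℂ) with hY
  have hYe : ∀ i j, Y i j = A i j / ((Real.sin (b i - b j) : ℝ) : ℂ) := fun i j => rfl
  have hYt : ∀ i j, Y j i = - Y i j := by
    intro i j
    rw [hYe, hYe, hA', ← neg_sub (b i) (b j), Real.sin_neg, Complex.ofReal_neg, div_neg]
  have hYs : ∀ i j, star (Y i j) = Y i j := by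
    intro i j
    rw [hYe, star_div₀, hAs, hrs]
  have hYsin : ∀ i j, i ≠ j → Y i j * ((Real.sin (b i - b j) : ℝ) : ℂ) = A i j := by
    intro i j hij
    by_cases h : Real.sin (b i - b j) = 0
    · rw [hoff i j hij h, h]; simp
    · rw [hYe, div_mul_cancel₀]
      exact_mod_cast h
  refine ⟨Matrix.of fun i j => Ω i j - Y i j * ((Real.cos (b i - b j) : ℝ) : ℂ), Y, ?_, ?_, ?_,
    ?_, ?_⟩
  · ext i j
    simp only [Matrix.map_apply, Matrix.of_apply]
    rw [star_sub, star_mul', hΩs, hYs, hrs]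
  · ext i j
    simp only [Matrix.transpose_apply, Matrix.of_apply, Matrix.neg_apply]
    rw [hΩ', hYt, ← neg_sub (b i) (b j), Real.cos_neg]; ring
  · ext i j
    exact hYs i j
  · ext i j
    exact hYt i j
  · ext j k
    rw [phase_eq]
    simp only [Matrix.add_apply, Matrix.mul_diagonal, Matrix.diagonal_mul, Matrix.of_apply,
      Matrix.smul_apply, smul_eq_mul, diag]
    by_cases hjk : j = k
    · subst hjk
      have h1 : Y j j = 0 := by
        have := hYt j j
        linear_combination this / 2
      rw [h1, hd, Matrix.diagonal_apply_eq]
      ring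
    · rw [Matrix.diagonal_apply_ne _ hjk, phase_apply_eq b j k]
      linear_combination (-Complex.I * Complex.exp (-Complex.I * b k)) * hYsin j k hjk

/-- At every point of `kakSet a`, the generator `-i S + Ω` (`Ω` real antisymmetric) is tangent to
the family `kakSet (a + ∫ λ)`, where `λ` is the spectrum of `S`. -/
lemma exists_tangent_curve {S Ω : Matrix (Fin 4) (Fin 4) ℂ} {lam : Fin 4 → ℝ}
    (hSr : S.map star = S) (hSt : Sᵀ = S) (hlam : IsSpec S lam)
    (hΩr : Ω.map star = Ω) (hΩt : Ωᵀ = -Ω) {α : ℝ → Fin 4 → ℝ} {t : ℝ}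
    (hα : HasDerivAt α lam t) (hanti : ∀ s, t ≤ s → Antitone (α s - α t))
    {y : Matrix (Fin 4) (Fin 4) ℂ} (hy : y ∈ kakSet (α t)) :
    ∃ z : ℝ → Matrix (Fin 4) (Fin 4) ℂ, (∀ s, t ≤ s → z s ∈ kakSet (α s)) ∧ z t = y ∧
      HasDerivAt z (((-Complex.I) • S + Ω) * y) t := by
  obtain ⟨R₀, hR₀, P₀, hP₀, b, hb, rfl⟩ := hy
  obtain ⟨R, hR, P, hP, hRP, hoff⟩ := exists_adapted_decomposition hSr hSt (b := b) hR₀ hP₀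
  rw [← hRP]
  obtain ⟨D, hD, hDd⟩ := hlam.exists_doublyStochastic (transpose_mem_SO4 hR)
  rw [Matrix.transpose_transpose] at hDd
  obtain ⟨hAt, hAr⟩ := conj_symm_real hSr hSt hR
  have hΩh : Ωᴴ = -Ω := by
    have := congrArg Matrix.transpose hΩr
    rw [hΩt] at this
    exact this
  have hΩt' : (Rᵀ * Ω * R)ᵀ = -(Rᵀ * Ω * R) := by
    simp only [Matrix.transpose_mul, Matrix.transpose_transpose, hΩt, mul_assoc, neg_mul, mul_neg]
  have hΩr' : (Rᵀ * Ω * R).map star = Rᵀ * Ω * R := by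
    have : (Rᵀ * Ω * R)ᴴ = -(Rᵀ * Ω * R) := by
      rw [← SO4_conjTranspose hR]
      simp only [Matrix.conjTranspose_mul, Matrix.conjTranspose_conjTranspose, hΩh, mul_assoc,
        neg_mul, mul_neg]
    rw [map_star_eq, this, Matrix.transpose_neg, hΩt', neg_neg]
  obtain ⟨X, Y, hXr, hXt, hYr, hYt, hXY⟩ :=
    exists_linearized_decomposition hAt hAr hΩt' hΩr' hDd hoff
  refine ⟨fun s => R * (NormedSpace.exp ((s - t) • X) * phase b * phase (D *ᵥ (α s - α t)) *
    NormedSpace.exp ((s - t) • Y)) * P, fun s hs => ?_, by simp, ?_⟩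
  · refine ⟨R * NormedSpace.exp ((s - t) • X), mul_mem_SO4 hR (exp_smul_mem_SO4 hXr hXt _),
      NormedSpace.exp ((s - t) • Y) * P, mul_mem_SO4 (exp_smul_mem_SO4 hYr hYt _) hP,
      b + D *ᵥ (α s - α t), ?_, ?_⟩
    · have := hb.add (isMaj_mulVec hD (hanti s hs))
      simpa using this
    · rw [phase_add]; simp only [mul_assoc]
  · have dX := hasDerivAt_exp_sub_smul X t t
    have dY := hasDerivAt_exp_sub_smul Y t t
    have dP : HasDerivAt (fun s => phase (D *ᵥ (α s - α t))) ((-Complex.I) • diag (D *ᵥ lam)) t := by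
      let E : (Fin 4 → ℝ) →L[ℝ] Matrix (Fin 4) (Fin 4) ℂ := LinearMap.toContinuousLinearMap
        { toFun := fun x => (-Complex.I) • diag (D *ᵥ x)
          map_add' := fun x y => by rw [Matrix.mulVec_add, diag_add, smul_add]
          map_smul' := fun c x => by
            rw [Matrix.mulVec_smul, diag_smul, smul_comm, RingHom.id_apply, Complex.coe_smul] }
      have h1 : HasDerivAt (fun s => E (α s - α t)) (E lam) t :=
        E.hasFDerivAt.comp_hasDerivAt t (hα.sub_const (α t))
      have h0 : E (α t - α t) = 0 := by rw [sub_self, map_zero]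
      have h2 : HasFDerivAt (NormedSpace.exp : Matrix (Fin 4) (Fin 4) ℂ → _)
          (1 : Matrix (Fin 4) (Fin 4) ℂ →L[ℝ] Matrix (Fin 4) (Fin 4) ℂ) (E (α t - α t)) := by
        rw [h0]; exact hasFDerivAt_exp_zero
      exact h2.comp_hasDerivAt t h1
    have hprod := (((dX.mul_const (phase b)).mul dP).mul dY)
    simp only [sub_self, zero_smul, NormedSpace.exp_zero, Matrix.mulVec_zero, phase_zero, mul_one,
      one_mul, Pi.mul_apply] at hprod
    refine ((hprod.const_mul R).mul_const P).congr_deriv ?_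
    rw [hXY]
    calc _ = R * Rᵀ * (((-Complex.I) • S + Ω) * (R * phase b * P)) := by
          simp only [add_mul, mul_add, Matrix.smul_mul, Matrix.mul_smul, mul_assoc]
      _ = _ := by rw [SO4_mul_transpose hR, one_mul]

/-! ### Upper bound for the reachable set -/

/-- A control Hamiltonian becomes a real antisymmetric generator in the magic basis. -/
lemma control_generator {H : Matrix (Fin 4) (Fin 4) ℂ} (hH : H.IsHermitian)
    (hexp : ∀ s : ℝ, NormedSpace.exp ((-Complex.I * (s : ℂ)) • H) ∈ localUnitaries) :
    ((-Complex.I) • inMagicBasis H).map star = (-Complex.I) • inMagicBasis H ∧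
      ((-Complex.I) • inMagicBasis H)ᵀ = -((-Complex.I) • inMagicBasis H) := by
  set Ω := (-Complex.I) • inMagicBasis H with hΩ
  have hmem : ∀ s : ℝ, NormedSpace.exp (s • Ω) ∈ SO4 := by
    intro s
    have := inMagicBasis_mem_SO4 (hexp s)
    rw [inMagicBasis_exp, inMagicBasis_smul] at this
    have hs : s • Ω = (-Complex.I * (s : ℂ)) • inMagicBasis H := by
      rw [hΩ, mul_comm, mul_smul, Complex.coe_smul]
    rwa [hs]
  have hr : Ω.map star = Ω := by
    have h1 := hasDerivAt_exp_smul_const (𝕂 := ℝ) Ω (0 : ℝ)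
    have h2 := hasDerivAt_exp_smul_const (𝕂 := ℝ) (Ω.map star) (0 : ℝ)
    have heq : (fun s : ℝ => NormedSpace.exp (s • Ω.map star)) =
        fun s : ℝ => NormedSpace.exp (s • Ω) := by
      ext1 s
      have hs : (s • Ω).map star = s • Ω.map star := by ext; simp
      rw [← hs]
      conv_rhs => rw [← (mem_SO4_iff.1 (hmem s)).1]
      rw [map_star_eq, map_star_eq, ← Matrix.exp_conjTranspose, ← Matrix.exp_transpose]
    rw [heq] at h2
    simpa using h2.unique h1
  refine ⟨hr, ?_⟩
  have hh : Ωᴴ = -Ω := by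
    rw [hΩ, Matrix.conjTranspose_smul, ← inMagicBasis_conjTranspose, hH.eq]
    simp
  have := congrArg Matrix.transpose hr
  rw [map_star_eq, Matrix.transpose_transpose] at this
  rw [← this, hh]

/-- The generator `-i [H_d + ∑ v_j H_j]` of the control system. -/
noncomputable def generator {m : ℕ} (H : Fin m → Matrix (Fin 4) (Fin 4) ℂ)
    (M : Matrix (Fin 3) (Fin 3) ℝ) (v : Fin m → ℝ) : Matrix (Fin 4) (Fin 4) ℂ :=
  (-Complex.I) • (nonlocalHamiltonian M + ∑ j, (v j : ℂ) • H j)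

lemma star_generator {m : ℕ} {H : Fin m → Matrix (Fin 4) (Fin 4) ℂ}
    (hH : ∀ j, (H j).IsHermitian) (M : Matrix (Fin 3) (Fin 3) ℝ) (v : Fin m → ℝ) :
    star (generator H M v) = - generator H M v := by
  have h : (∑ j, (v j : ℂ) • H j)ᴴ = ∑ j, (v j : ℂ) • H j := by
    rw [Matrix.conjTranspose_sum]
    refine Finset.sum_congr rfl fun j _ => ?_
    rw [Matrix.conjTranspose_smul, (hH j).eq]; simp
  rw [generator, star_smul, Matrix.star_eq_conjTranspose, Matrix.conjTranspose_add, h,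
    nonlocalHamiltonian_conjTranspose]
  simp [add_comm]

lemma generator_sub {m : ℕ} (H : Fin m → Matrix (Fin 4) (Fin 4) ℂ)
    (M M' : Matrix (Fin 3) (Fin 3) ℝ) (v v' : Fin m → ℝ) :
    generator H M v - generator H M' v' =
      (-Complex.I) • (nonlocalHamiltonian (M - M')) +
        (-Complex.I) • ∑ j, ((v j - v' j : ℝ) : ℂ) • H j := by
  rw [generator, generator, nonlocalHamiltonian_sub, ← smul_sub, ← smul_add]
  congr 1
  simp only [Complex.ofReal_sub, sub_smul, Finset.sum_sub_distrib]
  abel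

lemma inMagicBasis_generator {m : ℕ} (H : Fin m → Matrix (Fin 4) (Fin 4) ℂ)
    (M : Matrix (Fin 3) (Fin 3) ℝ) (v : Fin m → ℝ) :
    inMagicBasis (generator H M v) = (-Complex.I) • inMagicBasis (nonlocalHamiltonian M) +
      ∑ j, v j • ((-Complex.I) • inMagicBasis (H j)) := by
  have hsum : inMagicBasis (∑ j, (v j : ℂ) • H j) = ∑ j, (v j : ℂ) • inMagicBasis (H j) := by
    simp [inMagicBasis, Finset.mul_sum, Finset.sum_mul]
  rw [generator, inMagicBasis_smul, inMagicBasis_add, hsum, smul_add, Finset.smul_sum]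
  congr 1
  refine Finset.sum_congr rfl fun j _ => ?_
  rw [smul_comm, Complex.coe_smul]

lemma intervalIntegrable_generator {m : ℕ} (H : Fin m → Matrix (Fin 4) (Fin 4) ℂ)
    {M : ℝ → Matrix (Fin 3) (Fin 3) ℝ} {v : Fin m → ℝ → ℝ} {a b : ℝ}
    (hM : ∀ i j, IntervalIntegrable (fun t => M t i j) volume a b)
    (hv : ∀ j, IntervalIntegrable (v j) volume a b) :
    IntervalIntegrable (fun t => generator H (M t) fun j => v j t) volume a b := by
  have h1 := intervalIntegrable_nonlocalHamiltonian hM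
  have h2 : IntervalIntegrable (fun t => ∑ j, (v j t : ℂ) • H j) volume a b :=
    ⟨integrable_finsetSum _ fun j _ => (hv j).1.ofReal.smul_const _,
      integrable_finsetSum _ fun j _ => (hv j).2.ofReal.smul_const _⟩
  exact ⟨(h1.1.add h2.1).smul (-Complex.I), (h1.2.add h2.2).smul (-Complex.I)⟩

lemma intervalIntegral_entry {F : ℝ → Matrix (Fin 4) (Fin 4) ℂ} {a b : ℝ}
    (hF : IntervalIntegrable F volume a b) (k l : Fin 4) :
    (∫ s in a..b, F s) k l = ∫ s in a..b, F s k l := by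
  let E : Matrix (Fin 4) (Fin 4) ℂ →L[ℝ] ℂ :=
    LinearMap.toContinuousLinearMap (Matrix.entryLinearMap ℝ ℂ k l)
  exact (E.intervalIntegral_comp_comm hF).symm

/-- Trajectories, defined entry by entry, are the solutions of the matrix-valued integral
equation. -/
lemma isTrajectory_iff_isSolution {m : ℕ} {H : Fin m → Matrix (Fin 4) (Fin 4) ℂ}
    {M : ℝ → Matrix (Fin 3) (Fin 3) ℝ} {v : Fin m → ℝ → ℝ} {τ : ℝ} (hτ : 0 ≤ τ)
    (hM : ∀ i j, IntervalIntegrable (fun t => M t i j) volume 0 τ)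
    (hv : ∀ j, IntervalIntegrable (v j) volume 0 τ) {U : ℝ → Matrix (Fin 4) (Fin 4) ℂ} :
    IsTrajectory (fun t => nonlocalHamiltonian (M t)) H v τ U ↔
      IsSolution (fun t => generator H (M t) fun j => v j t) 0 τ U := by
  refine and_congr_right fun hU => forall₂_congr fun t ht => ?_
  have hG : IntervalIntegrable (fun t => (generator H (M t) fun j => v j t) * U t) volume 0 t := by
    have hsub : uIcc 0 t ⊆ uIcc 0 τ := by
      rw [uIcc_of_le ht.1, uIcc_of_le hτ]; exact Icc_subset_Icc_right ht.2
    refine ((intervalIntegrable_generator H hM hv).mono_set hsub).mul_continuousOn (hU.mono ?_)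
    rw [← uIcc_of_le hτ]; exact hsub
  constructor
  · intro h
    ext k l
    rw [h k l, Matrix.add_apply, intervalIntegral_entry hG]
    rfl
  · intro h k l
    rw [h, Matrix.add_apply, intervalIntegral_entry hG]
    rfl

lemma IsSolution.inMagicBasis {G U : ℝ → Matrix (Fin 4) (Fin 4) ℂ} {a b : ℝ} (hab : a ≤ b)
    (h : IsSolution G a b U) (hG : IntervalIntegrable G volume a b) :
    IsSolution (fun t => inMagicBasis (G t)) a b fun t => inMagicBasis (U t) := by
  refine ⟨continuous_inMagicBasis.comp_continuousOn h.1, fun t ht => ?_⟩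
  let E : Matrix (Fin 4) (Fin 4) ℂ →L[ℝ] Matrix (Fin 4) (Fin 4) ℂ :=
    LinearMap.toContinuousLinearMap
      { toFun := TwoQubit.inMagicBasis
        map_add' := inMagicBasis_add
        map_smul' := fun c x => by simp [TwoQubit.inMagicBasis] }
  have hsub : uIcc a t ⊆ uIcc a b := by
    rw [uIcc_of_le ht.1, uIcc_of_le hab]; exact Icc_subset_Icc_right ht.2
  have hGU : IntervalIntegrable (fun s => G s * U s) volume a t := by
    refine (hG.mono_set hsub).mul_continuousOn (h.1.mono ?_)
    rw [← uIcc_of_le hab]; exact hsub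
  have h1 := E.intervalIntegral_comp_comm hGU
  have h2 : TwoQubit.inMagicBasis (∫ s in a..t, G s * U s) =
      ∫ s in a..t, TwoQubit.inMagicBasis (G s) * TwoQubit.inMagicBasis (U s) := by
    simp only [← inMagicBasis_mul]
    exact h1.symm
  change TwoQubit.inMagicBasis (U t) = _
  rw [h.2 t ht, inMagicBasis_add, inMagicBasis_one, h2]

/-- Integrals of the ordered spectrum, up to time `t`. -/
noncomputable def spectrumIntegral (M : ℝ → Matrix (Fin 3) (Fin 3) ℝ) (t : ℝ) : Fin 4 → ℝ :=
  fun k => ∫ s in (0 : ℝ)..t, spectrumVec (M s) k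

lemma antitone_spectrumIntegral_sub {M : ℝ → Matrix (Fin 3) (Fin 3) ℝ} {s t : ℝ} (hst : s ≤ t)
    (h0 : ∀ k, IntervalIntegrable (fun r => spectrumVec (M r) k) volume 0 s)
    (h1 : ∀ k, IntervalIntegrable (fun r => spectrumVec (M r) k) volume s t) :
    Antitone (spectrumIntegral M t - spectrumIntegral M s) := by
  have h : ∀ k, (spectrumIntegral M t - spectrumIntegral M s) k =
      ∫ r in s..t, spectrumVec (M r) k := by
    intro k
    rw [Pi.sub_apply, spectrumIntegral, spectrumIntegral, sub_eq_iff_eq_add',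
      intervalIntegral.integral_add_adjacent_intervals (h0 k) (h1 k)]
  intro k l hkl
  rw [h, h]
  exact intervalIntegral.integral_mono_on hst (h1 l) (h1 k)
    fun r _ => antitone_spectrumVec (M r) hkl

lemma hasDerivAt_spectrumIntegral {M : ℝ → Matrix (Fin 3) (Fin 3) ℝ} (hM : Continuous M) (t : ℝ) :
    HasDerivAt (spectrumIntegral M) (spectrumVec (M t)) t := by
  rw [hasDerivAt_pi]
  intro k
  have hc : Continuous fun r => spectrumVec (M r) k :=
    (continuous_apply k).comp (continuous_spectrumVec.comp hM)
  exact intervalIntegral.integral_hasDerivAt_right (hc.intervalIntegrable _ _)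
    (hc.stronglyMeasurableAtFilter _ _) hc.continuousAt

lemma norm_spectrumIntegral_sub_le {M M' : ℝ → Matrix (Fin 3) (Fin 3) ℝ} {τ : ℝ} (hτ : 0 ≤ τ)
    (hM : ∀ i j, IntervalIntegrable (fun t => M t i j) volume 0 τ)
    (hM' : ∀ i j, IntervalIntegrable (fun t => M' t i j) volume 0 τ) :
    ‖spectrumIntegral M τ - spectrumIntegral M' τ‖ ≤
      8 * ∫ s in (0 : ℝ)..τ, ‖nonlocalHamiltonian (M s) - nonlocalHamiltonian (M' s)‖ := by
  have hint := ((intervalIntegrable_nonlocalHamiltonian hM).sub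
    (intervalIntegrable_nonlocalHamiltonian hM')).norm.const_mul 8
  rw [← intervalIntegral.integral_const_mul, pi_norm_le_iff_of_nonneg
    (intervalIntegral.integral_nonneg hτ fun s _ => by positivity)]
  intro k
  rw [Pi.sub_apply, spectrumIntegral, spectrumIntegral, ← intervalIntegral.integral_sub
    (intervalIntegrable_spectrumVec hM k) (intervalIntegrable_spectrumVec hM' k)]
  exact intervalIntegral.norm_integral_le_of_norm_le hτ
    (Filter.Eventually.of_forall fun s _ => abs_spectrumVec_sub_le _ _ k) hint

/-- A continuous coupling matrix approximating a given integrable one. -/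
lemma exists_continuous_coupling {M : ℝ → Matrix (Fin 3) (Fin 3) ℝ} {τ : ℝ} (hτ : 0 ≤ τ)
    (hM : ∀ i j, IntervalIntegrable (fun t => M t i j) volume 0 τ) {ε : ℝ} (hε : 0 < ε) :
    ∃ M' : ℝ → Matrix (Fin 3) (Fin 3) ℝ, Continuous M' ∧
      ∫ s in (0 : ℝ)..τ, ‖nonlocalHamiltonian (M s) - nonlocalHamiltonian (M' s)‖ ≤ ε := by
  set C : ℝ := ∑ i, ∑ j, ‖tensor (pauli i) (pauli j)‖ with hC
  have hC0 : 0 ≤ C := by positivity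
  choose g hgc hg using fun i j => exists_continuous_integral_sub_le hτ (hM i j)
    (ε := ε / (C + 1)) (by positivity)
  have hgd : ∀ i j, IntervalIntegrable (fun s => ‖M s i j - g i j s‖) volume 0 τ := fun i j =>
    ((hM i j).sub ((hgc i j).intervalIntegrable _ _)).norm
  refine ⟨fun t => Matrix.of fun i j => g i j t, continuous_matrix fun i j => hgc i j, ?_⟩
  have hb : ∀ s, ‖nonlocalHamiltonian (M s) - nonlocalHamiltonian (Matrix.of fun i j => g i j s)‖ ≤
      ∑ i, ∑ j, ‖M s i j - g i j s‖ * ‖tensor (pauli i) (pauli j)‖ := by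
    intro s
    rw [← nonlocalHamiltonian_sub]
    refine (norm_sum_le _ _).trans (Finset.sum_le_sum fun i _ => (norm_sum_le _ _).trans
      (Finset.sum_le_sum fun j _ => ?_))
    rw [norm_smul, Complex.norm_real]
    rfl
  have hint : ∀ i, IntervalIntegrable
      (fun s => ∑ j, ‖M s i j - g i j s‖ * ‖tensor (pauli i) (pauli j)‖) volume 0 τ := fun i =>
    ⟨integrable_finsetSum _ fun j _ => (hgd i j).1.mul_const _,
      integrable_finsetSum _ fun j _ => (hgd i j).2.mul_const _⟩
  have hint2 : IntervalIntegrable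
      (fun s => ∑ i, ∑ j, ‖M s i j - g i j s‖ * ‖tensor (pauli i) (pauli j)‖) volume 0 τ :=
    ⟨integrable_finsetSum _ fun i _ => (hint i).1, integrable_finsetSum _ fun i _ => (hint i).2⟩
  have hl : IntervalIntegrable (fun s => ‖nonlocalHamiltonian (M s) -
      nonlocalHamiltonian (Matrix.of fun i j => g i j s)‖) volume 0 τ :=
    ((intervalIntegrable_nonlocalHamiltonian hM).sub (intervalIntegrable_nonlocalHamiltonian
      fun i j => (hgc i j).intervalIntegrable _ _)).norm
  refine (intervalIntegral.integral_mono_on hτ hl hint2 fun s _ => hb s).trans ?_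
  rw [intervalIntegral.integral_finsetSum fun i _ => hint i]
  calc ∑ i, ∫ s in (0 : ℝ)..τ, ∑ j, ‖M s i j - g i j s‖ * ‖tensor (pauli i) (pauli j)‖
      ≤ ∑ i, ∑ j, ε / (C + 1) * ‖tensor (pauli i) (pauli j)‖ := by
        refine Finset.sum_le_sum fun i _ => ?_
        rw [intervalIntegral.integral_finsetSum fun j _ => (hgd i j).mul_const _]
        refine Finset.sum_le_sum fun j _ => ?_
        rw [intervalIntegral.integral_mul_const]
        exact mul_le_mul_of_nonneg_right (hg i j) (norm_nonneg _)
    _ = ε / (C + 1) * C := by simp only [← Finset.mul_sum, hC]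
    _ ≤ ε := by
        rw [div_mul_eq_mul_div, div_le_iff₀ (by positivity)]
        nlinarith

lemma exists_continuous_controls {m : ℕ} (H : Fin m → Matrix (Fin 4) (Fin 4) ℂ)
    {v : Fin m → ℝ → ℝ} {τ : ℝ} (hτ : 0 ≤ τ) (hv : ∀ j, IntervalIntegrable (v j) volume 0 τ)
    {ε : ℝ} (hε : 0 < ε) : ∃ w : Fin m → ℝ → ℝ, (∀ j, Continuous (w j)) ∧
      ∫ s in (0 : ℝ)..τ, ‖∑ j, ((v j s - w j s : ℝ) : ℂ) • H j‖ ≤ ε := by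
  set C : ℝ := ∑ j, ‖H j‖ with hC
  have hC0 : 0 ≤ C := by positivity
  choose w hwc hw using fun j => exists_continuous_integral_sub_le hτ (hv j)
    (ε := ε / (C + 1)) (by positivity)
  have hwd : ∀ j, IntervalIntegrable (fun s => v j s - w j s) volume 0 τ := fun j =>
    (hv j).sub ((hwc j).intervalIntegrable _ _)
  refine ⟨w, hwc, ?_⟩
  have hl : IntervalIntegrable (fun s => ∑ j, ((v j s - w j s : ℝ) : ℂ) • H j) volume 0 τ :=
    ⟨integrable_finsetSum _ fun j _ => (hwd j).1.ofReal.smul_const _,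
      integrable_finsetSum _ fun j _ => (hwd j).2.ofReal.smul_const _⟩
  have hint : IntervalIntegrable (fun s => ∑ j, ‖v j s - w j s‖ * ‖H j‖) volume 0 τ :=
    ⟨integrable_finsetSum _ fun j _ => (hwd j).norm.1.mul_const _,
      integrable_finsetSum _ fun j _ => (hwd j).norm.2.mul_const _⟩
  refine (intervalIntegral.integral_mono_on hτ hl.norm hint fun s _ => ?_).trans ?_
  · refine (norm_sum_le _ _).trans (Finset.sum_le_sum fun j _ => ?_)
    rw [norm_smul, Complex.norm_real]
  · rw [intervalIntegral.integral_finsetSum fun j _ => (hwd j).norm.mul_const _]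
    calc _ ≤ ∑ j, ε / (C + 1) * ‖H j‖ := by
          refine Finset.sum_le_sum fun j _ => ?_
          rw [intervalIntegral.integral_mul_const]
          exact mul_le_mul_of_nonneg_right (hw j) (norm_nonneg _)
      _ = ε / (C + 1) * C := by simp only [← Finset.mul_sum, hC]
      _ ≤ ε := by
          rw [div_mul_eq_mul_div, div_le_iff₀ (by positivity)]
          nlinarith

/-- The upper bound: everything reached at time `τ` lies in `kakSet (∫ λ)`. The viability estimate
is applied, in the magic basis, with continuous couplings `M'` and controls `w` close to the given
ones in `L¹`, and with the moving set `kakSet (∫ λ')` that belongs to `M'`. -/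
lemma reachableAt_subset {m : ℕ} {H : Fin m → Matrix (Fin 4) (Fin 4) ℂ}
    (hH : GenerateLocalUnitaries H) {M : ℝ → Matrix (Fin 3) (Fin 3) ℝ} {τ : ℝ} (hτ : 0 ≤ τ)
    (hM : ∀ i j, IntervalIntegrable (fun t => M t i j) volume 0 τ)
    {W : Matrix (Fin 4) (Fin 4) ℂ}
    (hW : W ∈ reachableAt (fun t => nonlocalHamiltonian (M t)) H τ) :
    inMagicBasis W ∈ kakSet (spectrumIntegral M τ) := by
  obtain ⟨v, U, hv, hU, rfl⟩ := hW
  rw [isTrajectory_iff_isSolution hτ hM hv] at hU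
  have hexp : ∀ j, ∀ s : ℝ, NormedSpace.exp ((-Complex.I * (s : ℂ)) • H j) ∈ localUnitaries := by
    intro j s
    rw [← hH.2]
    exact Submonoid.subset_closure ⟨j, s, rfl⟩
  have hΩ := fun j => control_generator (hH.1 j) (hexp j)
  have hGint := intervalIntegrable_generator H hM hv
  have hUm := hU.inMagicBasis hτ hGint
  have hGm : IntervalIntegrable
      (fun t => inMagicBasis (generator H (M t) fun j => v j t)) volume 0 τ :=
    ⟨(hGint.1.const_mul' _).mul_const _, (hGint.2.const_mul' _).mul_const _⟩
  have hB : ∀ t ∈ Icc 0 τ, ‖inMagicBasis (U t)‖ ≤ 1 := by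
    intro t ht
    rw [norm_inMagicBasis]
    refine (norm_unitary ((hU.mono ht.2).mem_unitary ht.1 (hGint.mono_set ?_)
      fun _ => star_generator hH.1 _ _)).le
    rw [uIcc_of_le hτ, uIcc_of_le ht.1]
    exact Icc_subset_Icc_right ht.2
  have hSi := intervalIntegrable_spectrumVec hM
  have hanti : Antitone (spectrumIntegral M τ) := fun k l hkl =>
    intervalIntegral.integral_mono_on hτ (hSi l) (hSi k)
      fun r _ => antitone_spectrumVec (M r) hkl
  have key : ∀ ε : ℝ, 0 < ε →
      Metric.infDist (inMagicBasis (U τ)) (kakSet (spectrumIntegral M τ)) ≤ 0 + ε := by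
    intro ε hε
    obtain ⟨M', hM'c, hM'⟩ := exists_continuous_coupling hτ hM (ε := ε / 10) (by positivity)
    obtain ⟨w, hwc, hw⟩ := exists_continuous_controls H hτ hv (ε := ε / 10) (by positivity)
    have hM'i : ∀ (a b : ℝ) i j, IntervalIntegrable (fun t => M' t i j) volume a b :=
      fun a b i j => (hM'c.matrix_elem i j).intervalIntegrable _ _
    have hsp : ∀ a b k, IntervalIntegrable (fun t => spectrumVec (M' t) k) volume a b :=
      fun a b => intervalIntegrable_spectrumVec (hM'i a b)
    have hantis : ∀ s t, s ≤ t → Antitone (spectrumIntegral M' t - spectrumIntegral M' s) :=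
      fun s t hst => antitone_spectrumIntegral_sub hst (hsp _ _) (hsp _ _)
    have hanti' : ∀ t, 0 ≤ t → Antitone (spectrumIntegral M' t) := by
      intro t ht
      have h0 : spectrumIntegral M' 0 = 0 := by ext; simp [spectrumIntegral]
      simpa [h0] using hantis 0 t ht
    have hderiv := hasDerivAt_spectrumIntegral hM'c
    set Gc : ℝ → Matrix (Fin 4) (Fin 4) ℂ :=
      fun t => inMagicBasis (generator H (M' t) fun j => w j t) with hGc
    have hGcc : Continuous Gc := by
      refine continuous_inMagicBasis.comp ?_
      unfold generator
      exact ((continuous_nonlocalHamiltonian.comp hM'c).add (continuous_finsetSum _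
        fun j _ => (Complex.continuous_ofReal.comp (hwc j)).smul continuous_const)).const_smul
        (-Complex.I)
    have hskew : ∀ t, star (Gc t) = -Gc t := by
      intro t
      simp only [hGc]
      rw [Matrix.star_eq_conjTranspose, ← inMagicBasis_conjTranspose,
        ← Matrix.star_eq_conjTranspose, star_generator hH.1]
      simp [inMagicBasis]
    have hmain := infDist_solution_le hτ (C := fun t => kakSet (spectrumIntegral M' t)) hUm hGm hB
      hGcc hskew (fun t _ => isCompact_kakSet _) (fun t ht => kakSet_nonempty _ (hanti' t ht.1))
      (continuousOn_infDist_kakSet hUm.1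
        (continuous_iff_continuousAt.2 fun t => (hderiv t).continuousAt).continuousOn
        fun t ht => hanti' t ht.1) ?_ ?_
    · have hdiff : ∫ s in (0 : ℝ)..τ,
          ‖inMagicBasis (generator H (M s) fun j => v j s) - Gc s‖ ≤ ε / 10 + ε / 10 := by
        have i1 : IntervalIntegrable (fun s => ‖nonlocalHamiltonian (M s) -
            nonlocalHamiltonian (M' s)‖) volume 0 τ :=
          ((intervalIntegrable_nonlocalHamiltonian hM).sub
            (intervalIntegrable_nonlocalHamiltonian (hM'i _ _))).norm
        have i2 : IntervalIntegrable (fun s => ‖∑ j, ((v j s - w j s : ℝ) : ℂ) • H j‖)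
            volume 0 τ := by
          have hd : ∀ j, IntervalIntegrable (fun s => v j s - w j s) volume 0 τ := fun j =>
            (hv j).sub ((hwc j).intervalIntegrable _ _)
          exact IntervalIntegrable.norm
            ⟨integrable_finsetSum _ fun j _ => (hd j).1.ofReal.smul_const _,
              integrable_finsetSum _ fun j _ => (hd j).2.ofReal.smul_const _⟩
        refine le_trans (intervalIntegral.integral_mono_on hτ
          (hGm.sub (hGcc.intervalIntegrable _ _)).norm (i1.add i2) fun s _ => ?_) ?_
        · have : inMagicBasis (generator H (M s) fun j => v j s) - Gc s =
              inMagicBasis ((generator H (M s) fun j => v j s) -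
                generator H (M' s) fun j => w j s) := by
            simp [hGc, inMagicBasis, mul_sub, sub_mul]
          rw [this, norm_inMagicBasis, generator_sub, nonlocalHamiltonian_sub]
          refine (norm_add_le _ _).trans_eq ?_
          rw [norm_smul, norm_smul]
          simp
        · rw [intervalIntegral.integral_add i1 i2]
          exact add_le_add hM' hw
      have h2 := infDist_kakSet_le (hanti' τ hτ) hanti (inMagicBasis (U τ))
      have h3 := norm_spectrumIntegral_sub_le hτ hM (hM'i 0 τ)
      rw [norm_sub_rev] at h3
      linarith
    · intro t ht y hy
      have hS := inMagicBasis_nonlocal_real (M' t)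
      have hΩr : (∑ j, w j t • ((-Complex.I) • inMagicBasis (H j))).map star =
          ∑ j, w j t • ((-Complex.I) • inMagicBasis (H j)) := by
        rw [map_star_eq, Matrix.conjTranspose_sum, Matrix.transpose_sum]
        refine Finset.sum_congr rfl fun j _ => ?_
        rw [← map_star_eq, real_smul_map_star (hΩ j).1]
      have hΩt : (∑ j, w j t • ((-Complex.I) • inMagicBasis (H j)))ᵀ =
          -∑ j, w j t • ((-Complex.I) • inMagicBasis (H j)) := by
        rw [Matrix.transpose_sum, ← Finset.sum_neg_distrib]
        refine Finset.sum_congr rfl fun j _ => ?_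
        rw [Matrix.transpose_smul, (hΩ j).2, smul_neg]
      obtain ⟨z, hz, hzt, hzd⟩ := exists_tangent_curve hS (inMagicBasis_nonlocal_transpose _)
        (isSpec_spectrumVec (M' t)) hΩr hΩt (hderiv t) (fun s hs => hantis t s hs) hy
      refine ⟨z, fun s hs => hz s hs.1, hzt, ?_⟩
      simp only [hGc]
      rw [inMagicBasis_generator]
      exact hzd.hasDerivWithinAt
    · refine ⟨1, one_mem_SO4, 1, one_mem_SO4, 0, ?_, by simp⟩
      have h0 : spectrumIntegral M' 0 = 0 := by ext; simp [spectrumIntegral]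
      simp only [h0]
      exact ⟨fun s => by simp, by simp⟩
  have h0 := le_of_forall_pos_le_add key
  exact ((isCompact_kakSet _).isClosed.mem_iff_infDist_zero (kakSet_nonempty _ hanti)).2
    (le_antisymm h0 Metric.infDist_nonneg)

/-- The sets `kakSet (∫ λ)` increase with time, because `0` is majorized by the contribution of the
additional time. Stopping before time `T` therefore reaches nothing new. -/
lemma kakSet_mono {M : ℝ → Matrix (Fin 3) (Fin 3) ℝ} {τ T : ℝ} (hτ : 0 ≤ τ) (hτT : τ ≤ T)
    (hM : ∀ i j, IntervalIntegrable (fun t => M t i j) volume 0 T) :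
    kakSet (spectrumIntegral M τ) ⊆ kakSet (spectrumIntegral M T) := by
  rintro _ ⟨R, hR, P, hP, b, hb, rfl⟩
  have hi := intervalIntegrable_spectrumVec hM
  have h0 : ∀ k, IntervalIntegrable (fun r => spectrumVec (M r) k) volume 0 τ := fun k =>
    (hi k).mono_set (by
      rw [uIcc_of_le hτ, uIcc_of_le (hτ.trans hτT)]; exact Icc_subset_Icc_right hτT)
  have h1 : ∀ k, IntervalIntegrable (fun r => spectrumVec (M r) k) volume τ T := fun k =>
    (hi k).mono_set (by
      rw [uIcc_of_le hτT, uIcc_of_le (hτ.trans hτT)]; exact Icc_subset_Icc_left hτ)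
  set Δ := spectrumIntegral M T - spectrumIntegral M τ with hΔ
  have hanti : Antitone Δ := antitone_spectrumIntegral_sub hτT h0 h1
  have hΔe : ∀ k, Δ k = ∫ r in τ..T, spectrumVec (M r) k := by
    intro k
    rw [hΔ, Pi.sub_apply, spectrumIntegral, spectrumIntegral, sub_eq_iff_eq_add',
      intervalIntegral.integral_add_adjacent_intervals (h0 k) (h1 k)]
  have hsum : ∑ k, Δ k = 0 := by
    simp only [hΔe]
    rw [← intervalIntegral.integral_finsetSum fun k _ => h1 k]
    simp [spectrumVec, sum_eigenvalueVector]
  -- the average of a decreasing vector with vanishing sum is `0`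
  have hz : IsMaj 0 Δ := by
    have hD : (Matrix.of fun _ _ => (1 / 4 : ℝ) : Matrix (Fin 4) (Fin 4) ℝ) ∈
        doublyStochastic ℝ (Fin 4) := by
      rw [mem_doublyStochastic_iff_sum]
      refine ⟨fun _ _ => by simp, fun _ => by simp, fun _ => by simp⟩
    have := isMaj_mulVec hD hanti
    convert this using 1
    ext i
    simp only [Matrix.mulVec, dotProduct, Matrix.of_apply, ← Finset.mul_sum, hsum]
    simp
  refine ⟨R, hR, P, hP, b, ?_, rfl⟩
  have := hb.add hz
  rwa [add_zero, hΔ, add_sub_cancel] at this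

/-! ### Existence and concatenation of solutions -/

/-- A relation between the ends of an interval that is compatible with concatenation holds on
`[a, b]` as soon as it holds on all short subintervals. -/
lemma chain_of_short {P : ℝ → ℝ → Prop} {a b δ : ℝ} (hab : a < b) (hδ : 0 < δ)
    (htrans : ∀ x y z, a ≤ x → x < y → y < z → z ≤ b → P x y → P y z → P x z)
    (hshort : ∀ x y, a ≤ x → x < y → y ≤ b → y - x < δ → P x y) : P a b := by
  obtain ⟨N, hN⟩ := exists_nat_gt ((b - a) / δ)
  have hN0 : (0 : ℝ) < N := lt_of_le_of_lt (div_nonneg (sub_pos.2 hab).le hδ.le) hN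
  set h := (b - a) / N with hh
  have hhpos : 0 < h := div_pos (sub_pos.2 hab) hN0
  have hhδ : h < δ := by
    rw [hh, div_lt_iff₀ hN0]
    rw [div_lt_iff₀ hδ] at hN
    linarith
  have hNh : (N : ℝ) * h = b - a := by rw [hh]; field_simp
  have key : ∀ k : ℕ, k + 1 ≤ N → P a (a + (k + 1) * h) := by
    intro k
    induction k with
    | zero =>
      intro hk
      have h1 : (1 : ℝ) ≤ N := by exact_mod_cast hk
      refine hshort _ _ le_rfl (by simp [hhpos]) ?_ (by simpa using hhδ)
      simp; nlinarith
    | succ k ih =>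
      intro hk
      have h1 : ((k : ℝ) + 1 + 1) ≤ N := by exact_mod_cast hk
      have hkp : (0 : ℝ) ≤ k := Nat.cast_nonneg k
      have hle : a + ((k + 1 : ℕ) + 1 : ℝ) * h ≤ b := by push_cast; nlinarith
      refine htrans a (a + (k + 1) * h) _ le_rfl (by nlinarith) (by push_cast; nlinarith) hle
        (ih (by omega)) (hshort _ _ (by nlinarith) (by push_cast; nlinarith) hle ?_)
      push_cast; nlinarith
  have hN1 : 1 ≤ N := by exact_mod_cast hN0
  have := key (N - 1) (by omega)
  rw [Nat.cast_sub hN1] at this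
  have hb : a + (((N : ℝ) - (1 : ℕ)) + 1) * h = b := by push_cast; linarith
  rwa [hb] at this

lemma intervalIntegrable_mono {E : Type*} [NormedAddCommGroup E] {f : ℝ → E} {a b x y : ℝ}
    (hf : IntervalIntegrable f volume a b) (hx : a ≤ x) (hxy : x ≤ y) (hy : y ≤ b) :
    IntervalIntegrable f volume x y := by
  refine hf.mono_set ?_
  rw [uIcc_of_le hxy, uIcc_of_le (hx.trans (hxy.trans hy))]
  exact Icc_subset_Icc hx hy

/-- If the generator has small `L¹` norm, the Picard operator is a contraction. -/
lemma exists_isSolution_of_small {G : ℝ → Matrix (Fin 4) (Fin 4) ℂ} {a b : ℝ} (hab : a ≤ b)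
    (hG : IntervalIntegrable G volume a b) (hsmall : ∫ s in a..b, ‖G s‖ ≤ 1 / 2) :
    ∃ U, IsSolution G a b U := by
  have hint : ∀ f : C(Icc a b, Matrix (Fin 4) (Fin 4) ℂ),
      IntervalIntegrable (fun s => G s * f (projIcc a b hab s)) volume a b := fun f =>
    hG.mul_continuousOn (f.continuous.comp continuous_projIcc).continuousOn
  let Φ : C(Icc a b, Matrix (Fin 4) (Fin 4) ℂ) → C(Icc a b, Matrix (Fin 4) (Fin 4) ℂ) := fun f =>
    ⟨fun t => 1 + ∫ s in a..(t : ℝ), G s * f (projIcc a b hab s), by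
      have h := intervalIntegral.continuousOn_primitive_interval' (hint f) left_mem_uIcc
      rw [uIcc_of_le hab] at h
      exact continuous_const.add h.domRestrict⟩
  have hΦ : ∀ f (t : Icc a b), Φ f t = 1 + ∫ s in a..(t : ℝ), G s * f (projIcc a b hab s) :=
    fun _ _ => rfl
  have hcontr : ContractingWith (1 / 2 : NNReal) Φ := by
    refine ⟨by rw [← NNReal.coe_lt_coe]; norm_num, LipschitzWith.of_dist_le_mul fun f g => ?_⟩
    have hd : (((1 / 2 : NNReal) : ℝ)) = 1 / 2 := by norm_num
    rw [hd, ContinuousMap.dist_le (by positivity)]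
    intro t
    have hfi := intervalIntegrable_mono (hint f) le_rfl t.2.1 t.2.2
    have hgi := intervalIntegrable_mono (hint g) le_rfl t.2.1 t.2.2
    have hGi := intervalIntegrable_mono hG le_rfl t.2.1 t.2.2
    rw [hΦ, hΦ, dist_eq_norm, add_sub_add_left_eq_sub, ← intervalIntegral.integral_sub hfi hgi]
    have h1 : ‖∫ s in a..(t : ℝ), (G s * f (projIcc a b hab s) - G s * g (projIcc a b hab s))‖ ≤
        ∫ s in a..(t : ℝ), ‖G s‖ * dist f g := by
      refine intervalIntegral.norm_integral_le_of_norm_le t.2.1 (Filter.Eventually.of_forall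
        fun s _ => ?_) (hGi.norm.mul_const _)
      rw [← mul_sub]
      refine (norm_mul_le _ _).trans (mul_le_mul_of_nonneg_left ?_ (norm_nonneg _))
      rw [← dist_eq_norm]
      exact ContinuousMap.dist_apply_le_dist _
    refine h1.trans ?_
    rw [intervalIntegral.integral_mul_const]
    refine mul_le_mul_of_nonneg_right (le_trans ?_ hsmall) dist_nonneg
    exact intervalIntegral.integral_mono_interval le_rfl t.2.1 t.2.2
      (Filter.Eventually.of_forall fun _ => norm_nonneg _) hG.norm
  have hfix := hcontr.fixedPoint_isFixedPt
  set f := hcontr.fixedPoint with hf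
  refine ⟨fun t => f (projIcc a b hab t),
    (f.continuous.comp continuous_projIcc).continuousOn, fun t ht => ?_⟩
  have := congrArg (fun g : C(Icc a b, Matrix (Fin 4) (Fin 4) ℂ) => g ⟨t, ht⟩) hfix
  simp only [hΦ] at this
  simp only [projIcc_of_mem hab ht]
  exact this.symm

lemma IsSolution.concat {G U₁ U₂ : ℝ → Matrix (Fin 4) (Fin 4) ℂ} {a b c : ℝ} (hab : a ≤ b)
    (hbc : b ≤ c) (hG₁ : IntervalIntegrable G volume a b) (hG₂ : IntervalIntegrable G volume b c)
    (h₁ : IsSolution G a b U₁) (h₂ : IsSolution G b c U₂) :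
    ∃ U, IsSolution G a c U ∧ U c = U₂ c * U₁ b := by
  have hb2 : U₂ b = 1 := h₂.apply_left hbc
  set U : ℝ → Matrix (Fin 4) (Fin 4) ℂ := fun t => if t ≤ b then U₁ t else U₂ t * U₁ b with hU
  have hUl : ∀ t ≤ b, U t = U₁ t := fun t ht => by simp [hU, ht]
  have hUr : ∀ t, b ≤ t → U t = U₂ t * U₁ b := by
    intro t ht
    rcases ht.eq_or_lt with rfl | ht
    · simp [hU, hb2]
    · simp [hU, not_le.2 ht]
  have hU₁ : ∀ t ∈ Icc a b, ∫ s in a..t, G s * U s = ∫ s in a..t, G s * U₁ s := by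
    intro t ht
    refine intervalIntegral.integral_congr fun s hs => ?_
    rw [uIcc_of_le ht.1] at hs
    simp only [hUl s (hs.2.trans ht.2)]
  have hU₂ : ∀ t ∈ Icc b c, ∫ s in b..t, G s * U s = (∫ s in b..t, G s * U₂ s) * U₁ b := by
    intro t ht
    let E : Matrix (Fin 4) (Fin 4) ℂ →L[ℝ] Matrix (Fin 4) (Fin 4) ℂ :=
      (ContinuousLinearMap.mul ℝ (Matrix (Fin 4) (Fin 4) ℂ)).flip (U₁ b)
    have hi : IntervalIntegrable (fun s => G s * U₂ s) volume b t := by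
      refine (intervalIntegrable_mono hG₂ le_rfl ht.1 ht.2).mul_continuousOn (h₂.1.mono ?_)
      rw [uIcc_of_le ht.1]
      exact Icc_subset_Icc_right ht.2
    have hE := E.intervalIntegral_comp_comm hi
    have hE2 : (∫ s in b..t, G s * U₂ s) * U₁ b = ∫ s in b..t, G s * U₂ s * U₁ b := hE.symm
    rw [hE2]
    refine intervalIntegral.integral_congr fun s hs => ?_
    rw [uIcc_of_le ht.1] at hs
    simp only [hUr s hs.1, mul_assoc]
  have hcont : ContinuousOn U (Icc a c) := by
    rw [← Icc_union_Icc_eq_Icc hab hbc]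
    refine ContinuousOn.union_of_isClosed ?_ ?_ isClosed_Icc isClosed_Icc
    · exact h₁.1.congr fun t ht => hUl t ht.2
    · exact (h₂.1.mul continuousOn_const).congr fun t ht => hUr t ht.1
  refine ⟨U, ⟨hcont, fun t ht => ?_⟩, hUr c hbc⟩
  rcases le_total t b with htb | htb
  · rw [hU₁ t ⟨ht.1, htb⟩, hUl t htb, h₁.2 t ⟨ht.1, htb⟩]
  · have hGU : IntervalIntegrable (fun s => G s * U s) volume a c := by
      refine (hG₁.trans hG₂).mul_continuousOn ?_
      rwa [uIcc_of_le (hab.trans hbc)]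
    rw [← intervalIntegral.integral_add_adjacent_intervals
      (intervalIntegrable_mono hGU le_rfl hab hbc) (intervalIntegrable_mono hGU hab htb ht.2),
      hU₁ b ⟨hab, le_rfl⟩, hU₂ t ⟨htb, ht.2⟩, hUr t htb, ← add_assoc,
      ← h₁.2 b ⟨hab, le_rfl⟩]
    conv_lhs => rw [h₂.2 t ⟨htb, ht.2⟩]
    rw [add_mul, one_mul]

/-- Existence for an arbitrary integrable generator: solve on short intervals and concatenate. -/
lemma exists_isSolution {G : ℝ → Matrix (Fin 4) (Fin 4) ℂ} {a b : ℝ} (hab : a < b)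
    (hG : IntervalIntegrable G volume a b) : ∃ U, IsSolution G a b U := by
  have hI : UniformContinuousOn (fun t => ∫ s in a..t, ‖G s‖) (Icc a b) := by
    refine isCompact_Icc.uniformContinuousOn_of_continuous ?_
    have := intervalIntegral.continuousOn_primitive_interval' hG.norm left_mem_uIcc
    rwa [uIcc_of_le hab.le] at this
  obtain ⟨δ, hδ, hδI⟩ := Metric.uniformContinuousOn_iff.1 hI (1 / 2) (by norm_num)
  refine chain_of_short (P := fun x y => ∃ U, IsSolution G x y U) hab hδ ?_ ?_
  · rintro x y z hx hxy hyz hz ⟨U₁, h₁⟩ ⟨U₂, h₂⟩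
    obtain ⟨U, hU, -⟩ := h₁.concat hxy.le hyz.le
      (intervalIntegrable_mono hG hx hxy.le (hyz.le.trans hz))
      (intervalIntegrable_mono hG (hx.trans hxy.le) hyz.le hz) h₂
    exact ⟨U, hU⟩
  · intro x y hx hxy hy hδxy
    have hGx := intervalIntegrable_mono hG hx hxy.le hy
    refine exists_isSolution_of_small hxy.le hGx ?_
    have hx' : x ∈ Icc a b := ⟨hx, hxy.le.trans hy⟩
    have hy' : y ∈ Icc a b := ⟨hx.trans hxy.le, hy⟩
    have := hδI y hy' x hx' (by rw [Real.dist_eq, abs_of_pos (sub_pos.2 hxy)]; exact hδxy)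
    rw [Real.dist_eq, ← intervalIntegral.integral_add_adjacent_intervals
      (intervalIntegrable_mono hG.norm le_rfl hx hx'.2) hGx.norm, add_sub_cancel_left] at this
    exact (le_abs_self _).trans this.le

/-! ### Controllability -/

/-- The propagators over the time interval `[a, b]` that integrable controls can produce. -/
def propagators {m : ℕ} (H : Fin m → Matrix (Fin 4) (Fin 4) ℂ)
    (M : ℝ → Matrix (Fin 3) (Fin 3) ℝ) (a b : ℝ) : Set (Matrix (Fin 4) (Fin 4) ℂ) :=
  {W | ∃ (v : Fin m → ℝ → ℝ) (U : ℝ → Matrix (Fin 4) (Fin 4) ℂ),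
    (∀ j, IntervalIntegrable (v j) volume a b) ∧
      IsSolution (fun t => generator H (M t) fun j => v j t) a b U ∧ U b = W}

lemma IsSolution.congr {G G' U : ℝ → Matrix (Fin 4) (Fin 4) ℂ} {a b : ℝ}
    (h : IsSolution G a b U) (hG : ∀ t ∈ Ioc a b, G t = G' t) : IsSolution G' a b U := by
  refine ⟨h.1, fun t ht => ?_⟩
  rw [h.2 t ht]
  congr 1
  refine intervalIntegral.integral_congr_ae (Filter.Eventually.of_forall fun s hs => ?_)
  rw [uIoc_of_le ht.1] at hs
  simp only [hG s ⟨hs.1, hs.2.trans ht.2⟩]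

lemma mul_mem_propagators {m : ℕ} {H : Fin m → Matrix (Fin 4) (Fin 4) ℂ}
    {M : ℝ → Matrix (Fin 3) (Fin 3) ℝ} {a b c : ℝ} (hab : a ≤ b) (hbc : b ≤ c)
    (hM : ∀ i j, IntervalIntegrable (fun t => M t i j) volume a c)
    {W₁ W₂ : Matrix (Fin 4) (Fin 4) ℂ} (h₁ : W₁ ∈ propagators H M a b)
    (h₂ : W₂ ∈ propagators H M b c) : W₂ * W₁ ∈ propagators H M a c := by
  obtain ⟨v₁, U₁, hv₁, hU₁, rfl⟩ := h₁
  obtain ⟨v₂, U₂, hv₂, hU₂, rfl⟩ := h₂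
  set v : Fin m → ℝ → ℝ := fun j t => if t ≤ b then v₁ j t else v₂ j t with hv
  have e₁ : ∀ t ∈ Ioc a b, ∀ j, v₁ j t = v j t := fun t ht j => by simp [hv, ht.2]
  have e₂ : ∀ t ∈ Ioc b c, ∀ j, v₂ j t = v j t := fun t ht j => by simp [hv, not_le.2 ht.1]
  have i₁ : ∀ j, IntervalIntegrable (v j) volume a b := fun j =>
    (hv₁ j).congr fun t ht => e₁ t (by rwa [uIoc_of_le hab] at ht) j
  have i₂ : ∀ j, IntervalIntegrable (v j) volume b c := fun j =>
    (hv₂ j).congr fun t ht => e₂ t (by rwa [uIoc_of_le hbc] at ht) j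
  have s₁ : IsSolution (fun t => generator H (M t) fun j => v j t) a b U₁ :=
    hU₁.congr fun t ht => by simp only [e₁ t ht]
  have s₂ : IsSolution (fun t => generator H (M t) fun j => v j t) b c U₂ :=
    hU₂.congr fun t ht => by simp only [e₂ t ht]
  obtain ⟨U, hU, hUc⟩ := s₁.concat hab hbc
    (intervalIntegrable_generator H (fun i j => intervalIntegrable_mono (hM i j) le_rfl hab hbc) i₁)
    (intervalIntegrable_generator H (fun i j => intervalIntegrable_mono (hM i j) hab hbc le_rfl) i₂)
    s₂
  exact ⟨v, U, fun j => (i₁ j).trans (i₂ j), hU, hUc⟩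

lemma propagators_subset_unitary {m : ℕ} {H : Fin m → Matrix (Fin 4) (Fin 4) ℂ}
    (hH : ∀ j, (H j).IsHermitian) {M : ℝ → Matrix (Fin 3) (Fin 3) ℝ} {a b : ℝ} (hab : a ≤ b)
    (hM : ∀ i j, IntervalIntegrable (fun t => M t i j) volume a b)
    {W : Matrix (Fin 4) (Fin 4) ℂ} (hW : W ∈ propagators H M a b) :
    W ∈ unitary (Matrix (Fin 4) (Fin 4) ℂ) := by
  obtain ⟨v, U, hv, hU, rfl⟩ := hW
  exact hU.mem_unitary hab (intervalIntegrable_generator H hM hv) fun _ => star_generator hH _ _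

/-- `Z` is approximated, up to the error `e` and an arbitrarily small additional one, by
propagators over `[a, b]`. -/
def Near {m : ℕ} (H : Fin m → Matrix (Fin 4) (Fin 4) ℂ) (M : ℝ → Matrix (Fin 3) (Fin 3) ℝ)
    (Z : Matrix (Fin 4) (Fin 4) ℂ) (a b e : ℝ) : Prop :=
  ∀ ε : ℝ, 0 < ε → ∃ W ∈ propagators H M a b, ‖W - Z‖ ≤ e + ε

lemma Near.of_norm_sub_le {m : ℕ} {H : Fin m → Matrix (Fin 4) (Fin 4) ℂ}
    {M : ℝ → Matrix (Fin 3) (Fin 3) ℝ} {Z Z' : Matrix (Fin 4) (Fin 4) ℂ} {a b e e' : ℝ}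
    (h : Near H M Z a b e) (he : e + ‖Z - Z'‖ ≤ e') : Near H M Z' a b e' := by
  intro ε hε
  obtain ⟨W, hW, hWZ⟩ := h ε hε
  refine ⟨W, hW, ?_⟩
  have := norm_sub_le_norm_sub_add_norm_sub W Z Z'
  linarith

lemma Near.mul {m : ℕ} {H : Fin m → Matrix (Fin 4) (Fin 4) ℂ} (hH : ∀ j, (H j).IsHermitian)
    {M : ℝ → Matrix (Fin 3) (Fin 3) ℝ} {Z₁ Z₂ : Matrix (Fin 4) (Fin 4) ℂ} {a b c e₁ e₂ : ℝ}
    (hab : a ≤ b) (hbc : b ≤ c) (hM : ∀ i j, IntervalIntegrable (fun t => M t i j) volume a c)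
    (hZ₁ : Z₁ ∈ unitary (Matrix (Fin 4) (Fin 4) ℂ))
    (h₁ : Near H M Z₁ a b e₁) (h₂ : Near H M Z₂ b c e₂) :
    Near H M (Z₂ * Z₁) a c (e₁ + e₂) := by
  intro ε hε
  obtain ⟨W₁, hW₁, d₁⟩ := h₁ (ε / 2) (half_pos hε)
  obtain ⟨W₂, hW₂, d₂⟩ := h₂ (ε / 2) (half_pos hε)
  refine ⟨W₂ * W₁, mul_mem_propagators hab hbc hM hW₁ hW₂, ?_⟩
  have hu := propagators_subset_unitary hH hbc
    (fun i j => intervalIntegrable_mono (hM i j) hab hbc le_rfl) hW₂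
  have : W₂ * W₁ - Z₂ * Z₁ = W₂ * (W₁ - Z₁) + (W₂ - Z₂) * Z₁ := by
    rw [mul_sub, sub_mul]; abel
  rw [this]
  refine (norm_add_le _ _).trans ?_
  rw [norm_unitary_mul hu, norm_mul_unitary hZ₁]
  linarith

/-- Constant controls approximate the flow of a constant generator. -/
lemma near_exp_generator {m : ℕ} {H : Fin m → Matrix (Fin 4) (Fin 4) ℂ}
    (hH : ∀ j, (H j).IsHermitian) {M : ℝ → Matrix (Fin 3) (Fin 3) ℝ} {a b : ℝ} (hab : a < b)
    (hM : ∀ i j, IntervalIntegrable (fun t => M t i j) volume a b)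
    (M₀ : Matrix (Fin 3) (Fin 3) ℝ) (v : Fin m → ℝ) :
    Near H M (NormedSpace.exp ((b - a) • generator H M₀ v)) a b
      (∫ s in a..b, ‖nonlocalHamiltonian (M s) - nonlocalHamiltonian M₀‖) := by
  intro ε hε
  have hv : ∀ j, IntervalIntegrable (fun _ : ℝ => v j) volume a b := fun j =>
    intervalIntegrable_const
  have hG := intervalIntegrable_generator H hM hv
  obtain ⟨U, hU⟩ := exists_isSolution hab hG
  refine ⟨U b, ⟨fun j _ => v j, U, hv, hU, rfl⟩, ?_⟩
  have := hU.norm_sub_exp_le hab.le hG (fun _ => star_generator hH _ _) (star_generator hH M₀ v)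
  have he : ∀ s, ‖generator H (M s) v - generator H M₀ v‖ =
      ‖nonlocalHamiltonian (M s) - nonlocalHamiltonian M₀‖ := by
    intro s
    rw [generator_sub, nonlocalHamiltonian_sub]
    simp [norm_smul]
  simp only [he] at this
  linarith

/-- Local unitaries can be generated arbitrarily fast: over any interval, up to the `L¹` norm of the
drift on it. -/
lemma near_local {m : ℕ} {H : Fin m → Matrix (Fin 4) (Fin 4) ℂ} (hH : GenerateLocalUnitaries H)
    {M : ℝ → Matrix (Fin 3) (Fin 3) ℝ} {T : ℝ}
    (hM : ∀ i j, IntervalIntegrable (fun t => M t i j) volume 0 T)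
    {K : Matrix (Fin 4) (Fin 4) ℂ} (hK : K ∈ localUnitaries) :
    ∀ a b, 0 ≤ a → a < b → b ≤ T → Near H M K a b (∫ s in a..b, ‖nonlocalHamiltonian (M s)‖) := by
  have hM' : ∀ a b, 0 ≤ a → a < b → b ≤ T →
      ∀ i j, IntervalIntegrable (fun t => M t i j) volume a b :=
    fun a b ha hab hb i j => intervalIntegrable_mono (hM i j) ha hab.le hb
  have hzero : nonlocalHamiltonian 0 = 0 := by simp [nonlocalHamiltonian]
  have hcl := hH.2
  rw [← hcl] at hK
  induction hK using Submonoid.closure_induction with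
  | mem x hx =>
    obtain ⟨j, s, rfl⟩ := hx
    intro a b ha hab hb
    -- a single control of size `s / (b - a)`, compared with the system without drift
    have := near_exp_generator hH.1 hab (hM' a b ha hab hb) 0 (Pi.single j (s / (b - a)))
    have he : (b - a) • generator H 0 (Pi.single j (s / (b - a))) =
        (-Complex.I * (s : ℂ)) • H j := by
      have hba : ((b : ℂ) - a) ≠ 0 := by
        rw [sub_ne_zero]; exact_mod_cast hab.ne'
      rw [generator, hzero, zero_add, Finset.sum_eq_single j
        (fun k _ hk => by simp [Pi.single_eq_of_ne hk]) (by simp), ← Complex.coe_smul, smul_smul,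
        smul_smul, Pi.single_eq_same]
      congr 1
      push_cast
      field_simp
    rw [he] at this
    simpa [hzero] using this
  | one =>
    intro a b ha hab hb
    have := near_exp_generator hH.1 hab (hM' a b ha hab hb) 0 0
    simpa [hzero, generator] using this
  | mul x y hx hy ihx ihy =>
    intro a b ha hab hb
    have h1 : a < (a + b) / 2 := by linarith
    have h2 : (a + b) / 2 < b := by linarith
    have hyu : y ∈ unitary (Matrix (Fin 4) (Fin 4) ℂ) := by
      refine localUnitaries_subset_unitary ?_
      rw [← hcl]; exact hy
    have hn := (intervalIntegrable_nonlocalHamiltonian (hM' a b ha hab hb)).norm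
    have := Near.mul hH.1 h1.le h2.le (hM' a b ha hab hb) hyu
      (ihy a _ ha h1 (h2.le.trans hb)) (ihx _ b (ha.trans h1.le) h2 hb)
    rwa [intervalIntegral.integral_add_adjacent_intervals
      (intervalIntegrable_mono hn le_rfl h1.le h2.le)
      (intervalIntegrable_mono hn h1.le h2.le le_rfl)] at this

/-! ### Integrals over slightly shorter intervals -/

lemma tendsto_add_of_continuousOn {E : Type*} [TopologicalSpace E] {F : ℝ → E} {a b : ℝ}
    (hab : a < b) (hF : ContinuousOn F (Icc a b)) :
    Filter.Tendsto (fun δ => F (a + δ)) (nhdsWithin 0 (Ioi 0)) (nhds (F a)) := by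
  refine (hF a (left_mem_Icc.2 hab.le)).tendsto.comp (tendsto_nhdsWithin_iff.2 ⟨?_, ?_⟩)
  · have : Filter.Tendsto (fun δ : ℝ => a + δ) (nhds 0) (nhds (a + 0)) :=
      (continuous_const.add continuous_id).tendsto 0
    rw [add_zero] at this
    exact this.mono_left nhdsWithin_le_nhds
  · filter_upwards [Ioo_mem_nhdsGT (sub_pos.2 hab)] with δ hδ
    exact ⟨by linarith [hδ.1], by linarith [hδ.2]⟩

lemma tendsto_sub_of_continuousOn {E : Type*} [TopologicalSpace E] {F : ℝ → E} {a b : ℝ}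
    (hab : a < b) (hF : ContinuousOn F (Icc a b)) :
    Filter.Tendsto (fun δ => F (b - δ)) (nhdsWithin 0 (Ioi 0)) (nhds (F b)) := by
  refine (hF b (right_mem_Icc.2 hab.le)).tendsto.comp (tendsto_nhdsWithin_iff.2 ⟨?_, ?_⟩)
  · have : Filter.Tendsto (fun δ : ℝ => b - δ) (nhds 0) (nhds (b - 0)) :=
      (continuous_const.sub continuous_id).tendsto 0
    rw [sub_zero] at this
    exact this.mono_left nhdsWithin_le_nhds
  · filter_upwards [Ioo_mem_nhdsGT (sub_pos.2 hab)] with δ hδ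
    exact ⟨by linarith [hδ.2], by linarith [hδ.1]⟩

lemma continuousOn_primitive {f : ℝ → ℝ} {a b : ℝ} (hab : a < b)
    (hf : IntervalIntegrable f volume a b) : ContinuousOn (fun t => ∫ s in a..t, f s) (Icc a b) := by
  have := intervalIntegral.continuousOn_primitive_interval' hf left_mem_uIcc
  rwa [uIcc_of_le hab.le] at this

lemma tendsto_integral_left {f : ℝ → ℝ} {a b : ℝ} (hab : a < b)
    (hf : IntervalIntegrable f volume a b) :
    Filter.Tendsto (fun δ => ∫ s in a..a + δ, f s) (nhdsWithin 0 (Ioi 0)) (nhds 0) := by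
  simpa using tendsto_add_of_continuousOn hab (continuousOn_primitive hab hf)

lemma tendsto_integral_right {f : ℝ → ℝ} {a b : ℝ} (hab : a < b)
    (hf : IntervalIntegrable f volume a b) :
    Filter.Tendsto (fun δ => ∫ s in b - δ..b, f s) (nhdsWithin 0 (Ioi 0)) (nhds 0) := by
  have h := (tendsto_sub_of_continuousOn hab (continuousOn_primitive hab hf)).const_sub
    (∫ s in a..b, f s)
  rw [sub_self] at h
  refine h.congr' ?_
  filter_upwards [Ioo_mem_nhdsGT (sub_pos.2 hab)] with δ hδ
  have h1 : a ≤ b - δ := by linarith [hδ.2]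
  have h2 : b - δ ≤ b := by linarith [hδ.1]
  rw [sub_eq_iff_eq_add', intervalIntegral.integral_add_adjacent_intervals
    (intervalIntegrable_mono hf le_rfl h1 h2) (intervalIntegrable_mono hf h1 h2 le_rfl)]

lemma tendsto_integral_middle {f : ℝ → ℝ} {a b : ℝ} (hab : a < b)
    (hf : IntervalIntegrable f volume a b) :
    Filter.Tendsto (fun δ => ∫ s in a + δ..b - δ, f s) (nhdsWithin 0 (Ioi 0))
      (nhds (∫ s in a..b, f s)) := by
  have h := (tendsto_sub_of_continuousOn hab (continuousOn_primitive hab hf)).sub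
    (tendsto_integral_left hab hf)
  rw [sub_zero] at h
  refine h.congr' ?_
  have hpos : 0 < (b - a) / 2 := by linarith
  filter_upwards [Ioo_mem_nhdsGT hpos] with δ hδ
  have h0 : a ≤ a + δ := by linarith [hδ.1]
  have h1 : a + δ ≤ b - δ := by linarith [hδ.2]
  have h2 : b - δ ≤ b := by linarith [hδ.1]
  rw [sub_eq_iff_eq_add', intervalIntegral.integral_add_adjacent_intervals
    (intervalIntegrable_mono hf le_rfl h0 (h1.trans h2)) (intervalIntegrable_mono hf h0 h1 h2)]

/-! ### Lower bound for the reachable set -/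

/-- Short pulses at both ends of a time interval produce arbitrary local factors. -/
lemma near_pad {m : ℕ} {H : Fin m → Matrix (Fin 4) (Fin 4) ℂ} (hH : GenerateLocalUnitaries H)
    {M : ℝ → Matrix (Fin 3) (Fin 3) ℝ} {T : ℝ}
    (hM : ∀ i j, IntervalIntegrable (fun t => M t i j) volume 0 T)
    {K K' : Matrix (Fin 4) (Fin 4) ℂ} (hK : K ∈ localUnitaries) (hK' : K' ∈ localUnitaries)
    {a b : ℝ} (ha : 0 ≤ a) (hab : a < b) (hb : b ≤ T)
    {Z : ℝ → ℝ → Matrix (Fin 4) (Fin 4) ℂ} {e : ℝ → ℝ → ℝ} {Z₀ : Matrix (Fin 4) (Fin 4) ℂ} {e₀ : ℝ}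
    (hZ : ∀ x y, a < x → x < y → y < b → Near H M (Z x y) x y (e x y))
    (hu : ∀ x y, Z x y ∈ unitary (Matrix (Fin 4) (Fin 4) ℂ))
    (tZ : Filter.Tendsto (fun δ => Z (a + δ) (b - δ)) (nhdsWithin 0 (Ioi 0)) (nhds Z₀))
    (te : Filter.Tendsto (fun δ => e (a + δ) (b - δ)) (nhdsWithin 0 (Ioi 0)) (nhds e₀)) :
    Near H M (K * (Z₀ * K')) a b e₀ := by
  have hMi : ∀ x y, 0 ≤ x → x ≤ y → y ≤ T → ∀ i j,
      IntervalIntegrable (fun t => M t i j) volume x y :=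
    fun x y hx hxy hy i j => intervalIntegrable_mono (hM i j) hx hxy hy
  have hn := (intervalIntegrable_nonlocalHamiltonian (hMi a b ha hab.le hb)).norm
  have htot : Filter.Tendsto (fun δ => (∫ s in a..a + δ, ‖nonlocalHamiltonian (M s)‖) +
      e (a + δ) (b - δ) + (∫ s in b - δ..b, ‖nonlocalHamiltonian (M s)‖) +
      ‖Z (a + δ) (b - δ) - Z₀‖) (nhdsWithin 0 (Ioi 0)) (nhds (0 + e₀ + 0 + 0)) :=
    (((tendsto_integral_left hab hn).add te).add (tendsto_integral_right hab hn)).add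
      (tendsto_iff_norm_sub_tendsto_zero.1 tZ)
  rw [zero_add, add_zero, add_zero] at htot
  intro ε hε
  have hpos : 0 < (b - a) / 2 := by linarith
  obtain ⟨δ, hδ, hδ0, hδ1⟩ := ((htot.eventually_lt_const
    (show e₀ < e₀ + ε / 2 by linarith)).and (Ioo_mem_nhdsGT hpos)).exists
  have h0 : a < a + δ := by linarith
  have h1 : a + δ < b - δ := by linarith
  have h2 : b - δ < b := by linarith
  have n1 := near_local hH hM hK' a (a + δ) ha h0 (by linarith)
  have n2 := hZ (a + δ) (b - δ) h0 h1 h2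
  have n3 := near_local hH hM hK (b - δ) b (by linarith) h2 hb
  have n12 := Near.mul hH.1 h0.le h1.le (hMi _ _ ha (h0.trans h1).le (by linarith))
    (localUnitaries_subset_unitary hK') n1 n2
  have n123 := Near.mul hH.1 (h0.trans h1).le h2.le (hMi _ _ ha hab.le hb)
    (mul_mem (hu _ _) (localUnitaries_subset_unitary hK')) n12 n3
  obtain ⟨W, hW, hd⟩ := n123 (ε / 2) (half_pos hε)
  refine ⟨W, hW, ?_⟩
  have hdist : ‖K * (Z (a + δ) (b - δ) * K') - K * (Z₀ * K')‖ = ‖Z (a + δ) (b - δ) - Z₀‖ := by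
    rw [← mul_sub, ← sub_mul, norm_unitary_mul (localUnitaries_subset_unitary hK),
      norm_mul_unitary (localUnitaries_subset_unitary hK')]
  have := norm_sub_le_norm_sub_add_norm_sub W (K * (Z (a + δ) (b - δ) * K')) (K * (Z₀ * K'))
  linarith

lemma ofMagicBasis_phase_mem_unitary (x : Fin 4 → ℝ) :
    ofMagicBasis (phase x) ∈ unitary (Matrix (Fin 4) (Fin 4) ℂ) := by
  rw [ofMagicBasis]
  exact mul_mem (mul_mem magicBasis_mem_unitary (phase_mem_unitary x)) magicBasis_inv_mem_unitary

/-- A rotation conjugates the flow of the Hamiltonian with coupling matrix `M₀` to the flow of its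
spectrum in any prescribed order. -/
lemma exists_local_conj_generator {m : ℕ} (H : Fin m → Matrix (Fin 4) (Fin 4) ℂ)
    (M₀ : Matrix (Fin 3) (Fin 3) ℝ) (σ : Equiv.Perm (Fin 4)) :
    ∃ K ∈ localUnitaries, ∃ K' ∈ localUnitaries, ∀ c : ℝ,
      K * (NormedSpace.exp (c • generator H M₀ 0) * K') =
        ofMagicBasis (phase (c • (spectrumVec M₀ ∘ σ))) := by
  obtain ⟨-, L, hL, hS⟩ := isSpec_spectrumVec M₀
  obtain ⟨P, hP, hPe⟩ := exists_SO4_permuting σ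
  have hPL := mul_mem_SO4 hP hL
  refine ⟨ofMagicBasis (P * L), ofMagicBasis_mem_local hPL, ofMagicBasis (P * L)ᵀ,
    ofMagicBasis_mem_local (transpose_mem_SO4 hPL), fun c => ?_⟩
  have hinv : (P * L)⁻¹ = (P * L)ᵀ := Matrix.inv_eq_right_inv (SO4_mul_transpose hPL)
  have hunit : IsUnit (P * L) :=
    ⟨⟨_, _, SO4_mul_transpose hPL, SO4_transpose_mul hPL⟩, rfl⟩
  have hgen : inMagicBasis (generator H M₀ 0) =
      (-Complex.I) • inMagicBasis (nonlocalHamiltonian M₀) := by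
    simp [inMagicBasis_generator]
  have hdiag : (P * L) * inMagicBasis (c • generator H M₀ 0) * (P * L)⁻¹ =
      (-Complex.I) • diag (c • (spectrumVec M₀ ∘ σ)) := by
    rw [← Complex.coe_smul, inMagicBasis_smul, hgen, hinv, diag_smul, ← hPe, hS]
    simp only [Matrix.mul_smul, Matrix.smul_mul]
    rw [smul_comm]
    congr 2
    rw [Matrix.transpose_mul]
    calc _ = P * (L * Lᵀ) * diag (spectrumVec M₀) * (L * Lᵀ) * Pᵀ := by simp only [mul_assoc]
      _ = _ := by rw [SO4_mul_transpose hL, mul_one, mul_one]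
  have hexp := Matrix.exp_conj (P * L) (inMagicBasis (c • generator H M₀ 0)) hunit
  rw [hdiag, ← inMagicBasis_exp, hinv] at hexp
  rw [phase, hexp, ofMagicBasis_mul _ (P * L)ᵀ, ofMagicBasis_mul (P * L) (inMagicBasis _),
    ofMagicBasis_inMagicBasis, mul_assoc]

lemma Near.mul_phase {m : ℕ} {H : Fin m → Matrix (Fin 4) (Fin 4) ℂ} (hH : ∀ j, (H j).IsHermitian)
    {M : ℝ → Matrix (Fin 3) (Fin 3) ℝ} {x y : Fin 4 → ℝ} {a b c e₁ e₂ : ℝ}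
    (hab : a ≤ b) (hbc : b ≤ c) (hM : ∀ i j, IntervalIntegrable (fun t => M t i j) volume a c)
    (h₁ : Near H M (ofMagicBasis (phase x)) a b e₁)
    (h₂ : Near H M (ofMagicBasis (phase y)) b c e₂) :
    Near H M (ofMagicBasis (phase (x + y))) a c (e₁ + e₂) := by
  have := Near.mul hH hab hbc hM (ofMagicBasis_phase_mem_unitary x) h₁ h₂
  rwa [← ofMagicBasis_mul, ← phase_add, add_comm y x] at this

/-- For a constant Hamiltonian, local conjugations permute the spectrum, and time sharing produces
all convex combinations of the permuted spectra. -/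
lemma near_phase_constant {m : ℕ} {H : Fin m → Matrix (Fin 4) (Fin 4) ℂ}
    (hH : GenerateLocalUnitaries H) {M : ℝ → Matrix (Fin 3) (Fin 3) ℝ} {T : ℝ}
    (hM : ∀ i j, IntervalIntegrable (fun t => M t i j) volume 0 T)
    (M₀ : Matrix (Fin 3) (Fin 3) ℝ) {D : Matrix (Fin 4) (Fin 4) ℝ}
    (hD : D ∈ doublyStochastic ℝ (Fin 4)) :
    ∀ a b, 0 ≤ a → a < b → b ≤ T →
      Near H M (ofMagicBasis (phase ((b - a) • (D *ᵥ spectrumVec M₀)))) a b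
        (∫ s in a..b, ‖nonlocalHamiltonian (M s) - nonlocalHamiltonian M₀‖) := by
  have hMi : ∀ x y, 0 ≤ x → x ≤ y → y ≤ T → ∀ i j,
      IntervalIntegrable (fun t => M t i j) volume x y :=
    fun x y hx hxy hy i j => intervalIntegrable_mono (hM i j) hx hxy hy
  have hn : ∀ x y, 0 ≤ x → x ≤ y → y ≤ T → IntervalIntegrable
      (fun s => ‖nonlocalHamiltonian (M s) - nonlocalHamiltonian M₀‖) volume x y :=
    fun x y hx hxy hy => ((intervalIntegrable_nonlocalHamiltonian (hMi x y hx hxy hy)).sub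
      intervalIntegrable_const).norm
  set good : Set (Matrix (Fin 4) (Fin 4) ℝ) := {D | ∀ a b, 0 ≤ a → a < b → b ≤ T →
      Near H M (ofMagicBasis (phase ((b - a) • (D *ᵥ spectrumVec M₀)))) a b
        (∫ s in a..b, ‖nonlocalHamiltonian (M s) - nonlocalHamiltonian M₀‖)} with hgood
  change D ∈ good
  have hDh : D ∈ convexHull ℝ {σ.permMatrix ℝ | σ : Equiv.Perm (Fin 4)} := by
    rw [← doublyStochastic_eq_convexHull_permMatrix]; exact hD
  refine convexHull_min ?_ ?_ hDh
  · rintro _ ⟨σ, rfl⟩ a b ha hab hb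
    obtain ⟨K, hK, K', hK', hKe⟩ := exists_local_conj_generator H M₀ σ
    rw [Matrix.permMatrix_mulVec, ← hKe]
    refine near_pad hH hM hK hK' ha hab hb
      (Z := fun x y => NormedSpace.exp ((y - x) • generator H M₀ 0))
      (e := fun x y => ∫ s in x..y, ‖nonlocalHamiltonian (M s) - nonlocalHamiltonian M₀‖)
      (fun x y hx hxy hy => ?_) (fun x y => ?_) ?_ (tendsto_integral_middle hab (hn a b ha hab.le hb))
    · exact near_exp_generator hH.1 hxy (hMi x y (by linarith) hxy.le (by linarith)) M₀ 0
    · exact exp_smul_mem_unitary (star_generator hH.1 _ _) _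
    · have hc : Continuous fun δ : ℝ =>
          NormedSpace.exp ((b - δ - (a + δ)) • generator H M₀ 0) := by
        have h : Continuous fun t : ℝ => NormedSpace.exp (t • generator H M₀ 0) :=
          continuous_iff_continuousAt.2 fun t =>
            (hasDerivAt_exp_smul_const (𝕂 := ℝ) (generator H M₀ 0) t).continuousAt
        exact h.comp (by fun_prop : Continuous fun δ : ℝ => b - δ - (a + δ))
      have := hc.tendsto 0
      simp only [sub_zero, add_zero] at this
      exact this.mono_left nhdsWithin_le_nhds
  · -- a convex combination arises by spending the fraction `p` of the time on `D₁` and `q` on `D₂`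
    rw [convex_iff_pairwise_pos]
    intro D₁ h₁ D₂ h₂ _ p q hp hq hpq a b ha hab hb
    have hca : a + p * (b - a) - a = p * (b - a) := by ring
    have hbc : b - (a + p * (b - a)) = q * (b - a) := by
      rw [← sub_eq_of_eq_add' hpq.symm]; ring
    have hac : a < a + p * (b - a) := by nlinarith
    have hcb : a + p * (b - a) < b := by nlinarith
    have n₁ := h₁ a _ ha hac (hcb.le.trans hb)
    have n₂ := h₂ _ b (ha.trans hac.le) hcb hb
    have := Near.mul_phase hH.1 hac.le hcb.le (hMi a b ha hab.le hb) n₁ n₂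
    rw [intervalIntegral.integral_add_adjacent_intervals
      (hn _ _ ha hac.le (hcb.le.trans hb)) (hn _ _ (ha.trans hac.le) hcb.le hb), hca, hbc] at this
    convert this using 3
    rw [Matrix.add_mulVec, Matrix.smul_mulVec, Matrix.smul_mulVec, smul_add, smul_smul, smul_smul,
      mul_comm p, mul_comm q]

/-- For a continuous coupling matrix `M'`, concatenate short time intervals on which the Hamiltonian
is nearly constant. The actual coupling `M` enters only through its `L¹` distance from `M'`. -/
lemma near_phase_spectrumIntegral {m : ℕ} {H : Fin m → Matrix (Fin 4) (Fin 4) ℂ}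
    (hH : GenerateLocalUnitaries H) {M M' : ℝ → Matrix (Fin 3) (Fin 3) ℝ} {T : ℝ}
    (hM : ∀ i j, IntervalIntegrable (fun t => M t i j) volume 0 T) (hM' : Continuous M')
    {D : Matrix (Fin 4) (Fin 4) ℝ} (hD : D ∈ doublyStochastic ℝ (Fin 4)) {η : ℝ} (hη : 0 < η)
    {a b : ℝ} (ha : 0 ≤ a) (hab : a < b) (hb : b ≤ T) :
    Near H M (ofMagicBasis (phase (D *ᵥ (spectrumIntegral M' b - spectrumIntegral M' a)))) a b
      ((∫ s in a..b, ‖nonlocalHamiltonian (M s) - nonlocalHamiltonian (M' s)‖) + η * (b - a)) := by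
  have hMi : ∀ x y, 0 ≤ x → x ≤ y → y ≤ T → ∀ i j,
      IntervalIntegrable (fun t => M t i j) volume x y :=
    fun x y hx hxy hy i j => intervalIntegrable_mono (hM i j) hx hxy hy
  have hHc : Continuous fun s => nonlocalHamiltonian (M' s) :=
    continuous_nonlocalHamiltonian.comp hM'
  have hsc : Continuous fun s => spectrumVec (M' s) := continuous_spectrumVec.comp hM'
  have hn : ∀ x y, 0 ≤ x → x ≤ y → y ≤ T → IntervalIntegrable
      (fun s => ‖nonlocalHamiltonian (M s) - nonlocalHamiltonian (M' s)‖) volume x y :=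
    fun x y hx hxy hy => ((intervalIntegrable_nonlocalHamiltonian (hMi x y hx hxy hy)).sub
      (hHc.intervalIntegrable _ _)).norm
  obtain ⟨δ₁, hδ₁, hu₁⟩ := Metric.uniformContinuousOn_iff.1
    ((isCompact_Icc (a := a) (b := b)).uniformContinuousOn_of_continuous hHc.continuousOn) (η / 2)
    (half_pos hη)
  obtain ⟨δ₂, hδ₂, hu₂⟩ := Metric.uniformContinuousOn_iff.1
    ((isCompact_Icc (a := a) (b := b)).uniformContinuousOn_of_continuous hsc.continuousOn) (η / 2)
    (half_pos hη)
  refine chain_of_short (P := fun x y => Near H M (ofMagicBasis (phase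
    (D *ᵥ (spectrumIntegral M' y - spectrumIntegral M' x)))) x y
    ((∫ s in x..y, ‖nonlocalHamiltonian (M s) - nonlocalHamiltonian (M' s)‖) + η * (y - x)))
    hab (lt_min hδ₁ hδ₂) ?_ ?_
  · intro x y z hx hxy hyz hz h₁ h₂
    have := Near.mul_phase hH.1 hxy.le hyz.le
      (hMi x z (ha.trans hx) (hxy.trans hyz).le (hz.trans hb)) h₁ h₂
    convert this using 1
    · rw [← Matrix.mulVec_add]
      congr 3
      abel
    · rw [← intervalIntegral.integral_add_adjacent_intervals
        (hn x y (ha.trans hx) hxy.le ((hyz.le.trans hz).trans hb))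
        (hn y z ((ha.trans hx).trans hxy.le) hyz.le (hz.trans hb))]
      ring
  · intro x y hx hxy hy hδ
    have hx0 := ha.trans hx
    have hyT := hy.trans hb
    have hclose : ∀ s ∈ Icc x y, dist s x < δ₁ ∧ dist s x < δ₂ := by
      intro s hs
      have : dist s x < min δ₁ δ₂ := by
        rw [Real.dist_eq, abs_of_nonneg (sub_nonneg.2 hs.1)]
        linarith [hs.2]
      exact lt_min_iff.1 this
    have hmem : ∀ s ∈ Icc x y, s ∈ Icc a b := fun s hs => ⟨hx.trans hs.1, hs.2.trans hy⟩
    have hxm := hmem x (left_mem_Icc.2 hxy.le)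
    refine (near_phase_constant hH hM (M' x) hD x y hx0 hxy hyT).of_norm_sub_le ?_
    have e₁ : (∫ s in x..y, ‖nonlocalHamiltonian (M s) - nonlocalHamiltonian (M' x)‖) ≤
        (∫ s in x..y, ‖nonlocalHamiltonian (M s) - nonlocalHamiltonian (M' s)‖) +
          η / 2 * (y - x) := by
      have hconst : ∫ _ in x..y, η / 2 = η / 2 * (y - x) := by
        rw [intervalIntegral.integral_const, smul_eq_mul, mul_comm]
      rw [← hconst, ← intervalIntegral.integral_add (hn x y hx0 hxy.le hyT)
        intervalIntegrable_const]
      refine intervalIntegral.integral_mono_on hxy.le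
        ((intervalIntegrable_nonlocalHamiltonian (hMi x y hx0 hxy.le hyT)).sub
          intervalIntegrable_const).norm
        ((hn x y hx0 hxy.le hyT).add intervalIntegrable_const) fun s hs => ?_
      have h1 := hu₁ s (hmem s hs) x hxm (hclose s hs).1
      rw [dist_eq_norm] at h1
      have h2 := norm_sub_le_norm_sub_add_norm_sub (nonlocalHamiltonian (M s))
        (nonlocalHamiltonian (M' s)) (nonlocalHamiltonian (M' x))
      linarith
    have e₂ : ‖ofMagicBasis (phase ((y - x) • (D *ᵥ spectrumVec (M' x)))) -
        ofMagicBasis (phase (D *ᵥ (spectrumIntegral M' y - spectrumIntegral M' x)))‖ ≤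
          η / 2 * (y - x) := by
      rw [← ofMagicBasis_sub, norm_ofMagicBasis]
      refine (norm_phase_sub_le _ _).trans ?_
      rw [← Matrix.mulVec_smul, ← Matrix.mulVec_sub]
      refine (norm_mulVec_le hD _).trans ?_
      rw [pi_norm_le_iff_of_nonneg (mul_nonneg (half_pos hη).le (sub_pos.2 hxy).le)]
      intro k
      have hk : Continuous fun s => spectrumVec (M' s) k := (continuous_apply k).comp hsc
      have hki : ∀ u v, IntervalIntegrable (fun s => spectrumVec (M' s) k) volume u v :=
        fun u v => hk.intervalIntegrable u v
      have hval : ((y - x) • spectrumVec (M' x) -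
          (spectrumIntegral M' y - spectrumIntegral M' x)) k =
          ∫ s in x..y, (spectrumVec (M' x) k - spectrumVec (M' s) k) := by
        rw [intervalIntegral.integral_sub intervalIntegrable_const (hki _ _),
          intervalIntegral.integral_const, Pi.sub_apply, Pi.sub_apply, Pi.smul_apply,
          spectrumIntegral, spectrumIntegral,
          intervalIntegral.integral_interval_sub_left (hki _ _) (hki _ _)]
      rw [hval]
      refine (intervalIntegral.norm_integral_le_of_norm_le_const (C := η / 2) fun s hs => ?_).trans
        (by rw [abs_of_pos (sub_pos.2 hxy)])
      rw [uIoc_of_le hxy.le] at hs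
      have hs' : s ∈ Icc x y := Ioc_subset_Icc_self hs
      have h1 := hu₂ s (hmem s hs') x hxm (hclose s hs').2
      rw [dist_eq_norm, norm_sub_rev] at h1
      exact (norm_le_pi_norm (spectrumVec (M' x) - spectrumVec (M' s)) k).trans h1.le
    linarith

/-- The lower bound: every element of `kakSet (∫ λ)` is a limit of propagators over `[0, T]`. -/
lemma ofMagicBasis_mem_closure_propagators {m : ℕ} {H : Fin m → Matrix (Fin 4) (Fin 4) ℂ}
    (hH : GenerateLocalUnitaries H) {M : ℝ → Matrix (Fin 3) (Fin 3) ℝ} {T : ℝ} (hT : 0 < T)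
    (hM : ∀ i j, IntervalIntegrable (fun t => M t i j) volume 0 T)
    {X : Matrix (Fin 4) (Fin 4) ℂ} (hX : X ∈ kakSet (spectrumIntegral M T)) :
    ofMagicBasis X ∈ closure (propagators H M 0 T) := by
  obtain ⟨R, hR, P, hP, b, hb, rfl⟩ := hX
  obtain ⟨D, hD, rfl⟩ := hb.exists_doublyStochastic
  rw [Metric.mem_closure_iff]
  intro ε hε
  -- the errors add up to `(9 + T) * ε'`: one `ε'` from the drift, `T * ε'` from the discretization,
  -- `8 * ε'` from the change of the integrated spectrum
  set ε' := ε / (2 * (9 + T)) with hε'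
  have hε'0 : 0 < ε' := by positivity
  have hε'e : ε' * (9 + T) = ε / 2 := by rw [hε']; field_simp
  obtain ⟨M', hM'c, hM'⟩ := exists_continuous_coupling hT.le hM hε'0
  have hM'i : ∀ i j, IntervalIntegrable (fun t => M' t i j) volume 0 T := fun i j =>
    (hM'c.matrix_elem i j).intervalIntegrable _ _
  have hsI : Continuous (spectrumIntegral M') := continuous_iff_continuousAt.2 fun t =>
    (hasDerivAt_spectrumIntegral hM'c t).continuousAt
  have hn := ((intervalIntegrable_nonlocalHamiltonian hM).sub
    (intervalIntegrable_nonlocalHamiltonian hM'i)).norm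
  have hlin : ∀ {F : ℝ → Matrix (Fin 4) (Fin 4) ℂ}, Continuous F →
      Filter.Tendsto F (nhdsWithin 0 (Ioi 0)) (nhds (F 0)) := fun hF =>
    (hF.tendsto 0).mono_left nhdsWithin_le_nhds
  have key := near_pad hH hM (ofMagicBasis_mem_local hR) (ofMagicBasis_mem_local hP) le_rfl hT
    le_rfl
    (Z := fun x y => ofMagicBasis (phase (D *ᵥ (spectrumIntegral M' y - spectrumIntegral M' x))))
    (fun x y hx hxy hy => near_phase_spectrumIntegral hH hM hM'c hD hε'0 hx.le hxy hy.le)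
    (fun x y => ofMagicBasis_phase_mem_unitary _)
    (hlin (F := fun δ => ofMagicBasis (phase (D *ᵥ (spectrumIntegral M' (T - δ) -
      spectrumIntegral M' (0 + δ))))) (continuous_ofMagicBasis.comp (continuous_phase.comp
        (by fun_prop))))
    ((tendsto_integral_middle hT hn).add (((continuous_const.mul (by fun_prop :
      Continuous fun δ : ℝ => T - δ - (0 + δ))).tendsto 0).mono_left nhdsWithin_le_nhds))
  have h0 : spectrumIntegral M' 0 = 0 := by ext k; simp [spectrumIntegral]
  simp only [Pi.mul_apply, sub_zero, add_zero, h0] at key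
  obtain ⟨W, hW, hd⟩ := key (ε / 4) (by positivity)
  refine ⟨W, hW, ?_⟩
  rw [dist_comm, dist_eq_norm]
  have hdist : ‖ofMagicBasis R * (ofMagicBasis (phase (D *ᵥ spectrumIntegral M' T)) *
      ofMagicBasis P) - ofMagicBasis (R * phase (D *ᵥ spectrumIntegral M T) * P)‖ ≤ 8 * ε' := by
    rw [ofMagicBasis_mul, ofMagicBasis_mul, mul_assoc, ← mul_sub, ← sub_mul, ← ofMagicBasis_sub,
      norm_unitary_mul (localUnitaries_subset_unitary (ofMagicBasis_mem_local hR)),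
      norm_mul_unitary (localUnitaries_subset_unitary (ofMagicBasis_mem_local hP)),
      norm_ofMagicBasis]
    refine (norm_phase_sub_le _ _).trans ?_
    rw [← Matrix.mulVec_sub]
    refine (norm_mulVec_le hD _).trans ?_
    rw [norm_sub_rev]
    exact (norm_spectrumIntegral_sub_le hT.le hM hM'i).trans (by linarith)
  have := norm_sub_le_norm_sub_add_norm_sub W (ofMagicBasis R * (ofMagicBasis
    (phase (D *ᵥ spectrumIntegral M' T)) * ofMagicBasis P))
    (ofMagicBasis (R * phase (D *ᵥ spectrumIntegral M T) * P))
  linarith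

/-! ### The reachable set -/

lemma inMagicBasis_image_reachableWithin {m : ℕ} {H : Fin m → Matrix (Fin 4) (Fin 4) ℂ}
    (hH : GenerateLocalUnitaries H) {M : ℝ → Matrix (Fin 3) (Fin 3) ℝ} {T : ℝ} (hT : 0 < T)
    (hM : ∀ i j, IntervalIntegrable (fun t => M t i j) volume 0 T) :
    inMagicBasis '' reachableWithin (fun t => nonlocalHamiltonian (M t)) H T =
      kakSet (spectrumIntegral M T) := by
  refine Subset.antisymm ?_ fun X hX => ?_
  · rw [image_subset_iff]
    refine closure_minimal ?_ ((isCompact_kakSet _).isClosed.preimage continuous_inMagicBasis)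
    rw [iUnion₂_subset_iff]
    intro τ hτ W hW
    exact kakSet_mono hτ.1 hτ.2 hM (reachableAt_subset hH hτ.1
      (fun i j => intervalIntegrable_mono (hM i j) le_rfl hτ.1 hτ.2) hW)
  · refine ⟨ofMagicBasis X, ?_, inMagicBasis_ofMagicBasis X⟩
    refine closure_mono ?_ (ofMagicBasis_mem_closure_propagators hH hT hM hX)
    rintro W ⟨v, U, hv, hU, rfl⟩
    refine mem_iUnion₂.2 ⟨T, right_mem_Icc.2 hT.le, v, U, hv, ?_, rfl⟩
    exact (isTrajectory_iff_isSolution hT.le hM hv).2 hU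

lemma inMagicBasis_canonicalUnitary : ∃ L ∈ SO4, ∀ β : Fin 3 → ℝ,
    inMagicBasis (canonicalUnitary β) = L * phase (eigenvalueVector β) * Lᵀ := by
  obtain ⟨L, hL, h⟩ := exists_SO4_canonical
  refine ⟨L, hL, fun β => ?_⟩
  have hinv : L⁻¹ = Lᵀ := Matrix.inv_eq_right_inv (SO4_mul_transpose hL)
  have hunit : IsUnit L := ⟨⟨_, _, SO4_mul_transpose hL, SO4_transpose_mul hL⟩, rfl⟩
  rw [canonicalUnitary, inMagicBasis_exp, inMagicBasis_smul, h, phase, ← hinv,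
    ← Matrix.exp_conj _ _ hunit, Matrix.mul_smul, Matrix.smul_mul]

/-! ### The order `≺_s` as majorization of spectra -/

/-- A permutation of the parameters permutes the eigenvalues. -/
lemma exists_perm_eigenvalueVector_comp (τ : Equiv.Perm (Fin 3)) :
    ∃ σ : Equiv.Perm (Fin 4), ∀ x : Fin 3 → ℝ,
      eigenvalueVector (x ∘ τ) = eigenvalueVector x ∘ σ := by
  have hσ : ∀ τ : Equiv.Perm (Fin 3), ∃ σ : Equiv.Perm (Fin 4), σ 3 = 3 ∧
      ∀ k : Fin 3, σ k.rev.castSucc = (τ k).rev.castSucc := by decide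
  obtain ⟨σ, h3, hk⟩ := hσ τ
  -- `λ` consists of `x 0 + x 1 + x 2 - 2 * x k` for the three `k`, and of `-(x 0 + x 1 + x 2)`
  have hval : ∀ (x : Fin 3 → ℝ) (k : Fin 3),
      eigenvalueVector x k.rev.castSucc = ∑ i, x i - 2 * x k := by
    intro x k
    rw [Fin.sum_univ_three]
    fin_cases k
    · change -x 0 + x 1 + x 2 = x 0 + x 1 + x 2 - 2 * x 0; ring
    · change x 0 - x 1 + x 2 = x 0 + x 1 + x 2 - 2 * x 1; ring
    · change x 0 + x 1 - x 2 = x 0 + x 1 + x 2 - 2 * x 2; ring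
  have hlast : ∀ x : Fin 3 → ℝ, eigenvalueVector x 3 = -∑ i, x i := by
    intro x
    rw [Fin.sum_univ_three]
    change -x 0 - x 1 - x 2 = _; ring
  refine ⟨σ, fun x => funext fun j => ?_⟩
  have hsum : ∑ i, (x ∘ τ) i = ∑ i, x i := Equiv.sum_comp τ x
  induction j using Fin.lastCases with
  | last =>
    change eigenvalueVector (x ∘ τ) 3 = eigenvalueVector x (σ 3)
    rw [h3, hlast, hlast, hsum]
  | cast j =>
    obtain ⟨k, rfl⟩ := Fin.rev_surjective j
    rw [Function.comp_apply, hk, hval, hval, hsum, Function.comp_apply]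

/-- Changing an even number of signs of the parameters permutes the eigenvalues. -/
lemma exists_perm_eigenvalueVector_signs (z : Fin 3 → ℝ) {e₀ e₁ : ℝ} (h₀ : e₀ = 1 ∨ e₀ = -1)
    (h₁ : e₁ = 1 ∨ e₁ = -1) : ∃ σ : Equiv.Perm (Fin 4),
      eigenvalueVector ![e₀ * z 0, e₁ * z 1, e₀ * e₁ * z 2] = eigenvalueVector z ∘ σ := by
  have hperm : ∀ σ : Equiv.Perm (Fin 4), ∀ w : Fin 3 → ℝ,
      (eigenvalueVector w 0 = eigenvalueVector z (σ 0) ∧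
        eigenvalueVector w 1 = eigenvalueVector z (σ 1) ∧
        eigenvalueVector w 2 = eigenvalueVector z (σ 2) ∧
        eigenvalueVector w 3 = eigenvalueVector z (σ 3)) →
      eigenvalueVector w = eigenvalueVector z ∘ σ := by
    rintro σ w ⟨w0, w1, w2, w3⟩
    ext k
    fin_cases k
    exacts [w0, w1, w2, w3]
  have s0 : (Equiv.swap 0 1 * Equiv.swap 2 3 : Equiv.Perm (Fin 4)) 0 = 1 := by decide
  have s1 : (Equiv.swap 0 1 * Equiv.swap 2 3 : Equiv.Perm (Fin 4)) 1 = 0 := by decide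
  have s2 : (Equiv.swap 0 1 * Equiv.swap 2 3 : Equiv.Perm (Fin 4)) 2 = 3 := by decide
  have s3 : (Equiv.swap 0 1 * Equiv.swap 2 3 : Equiv.Perm (Fin 4)) 3 = 2 := by decide
  have t0 : (Equiv.swap 0 2 * Equiv.swap 1 3 : Equiv.Perm (Fin 4)) 0 = 2 := by decide
  have t1 : (Equiv.swap 0 2 * Equiv.swap 1 3 : Equiv.Perm (Fin 4)) 1 = 3 := by decide
  have t2 : (Equiv.swap 0 2 * Equiv.swap 1 3 : Equiv.Perm (Fin 4)) 2 = 0 := by decide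
  have t3 : (Equiv.swap 0 2 * Equiv.swap 1 3 : Equiv.Perm (Fin 4)) 3 = 1 := by decide
  have u0 : (Equiv.swap 0 3 * Equiv.swap 1 2 : Equiv.Perm (Fin 4)) 0 = 3 := by decide
  have u1 : (Equiv.swap 0 3 * Equiv.swap 1 2 : Equiv.Perm (Fin 4)) 1 = 2 := by decide
  have u2 : (Equiv.swap 0 3 * Equiv.swap 1 2 : Equiv.Perm (Fin 4)) 2 = 1 := by decide
  have u3 : (Equiv.swap 0 3 * Equiv.swap 1 2 : Equiv.Perm (Fin 4)) 3 = 0 := by decide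
  rcases h₀ with rfl | rfl <;> rcases h₁ with rfl | rfl
  · refine ⟨1, hperm _ _ ?_⟩
    simp [eigenvalueVector]
  · refine ⟨Equiv.swap 0 1 * Equiv.swap 2 3, hperm _ _ ?_⟩
    rw [s0, s1, s2, s3]
    refine ⟨?_, ?_, ?_, ?_⟩ <;> simp [eigenvalueVector] <;> ring
  · refine ⟨Equiv.swap 0 2 * Equiv.swap 1 3, hperm _ _ ?_⟩
    rw [t0, t1, t2, t3]
    refine ⟨?_, ?_, ?_, ?_⟩ <;> simp [eigenvalueVector] <;> ring
  · refine ⟨Equiv.swap 0 3 * Equiv.swap 1 2, hperm _ _ ?_⟩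
    rw [u0, u1, u2, u3]
    refine ⟨?_, ?_, ?_, ?_⟩ <;> simp [eigenvalueVector] <;> ring

lemma exists_abs_eq_mul (x : ℝ) : ∃ e : ℝ, (e = 1 ∨ e = -1) ∧ |x| = e * x := by
  rcases abs_choice x with h | h
  · exact ⟨1, Or.inl rfl, by rw [h, one_mul]⟩
  · exact ⟨-1, Or.inr rfl, by rw [h, neg_one_mul]⟩

lemma sign_mul_abs (x : ℝ) : Real.sign x * |x| = x := by
  rcases lt_trichotomy x 0 with h | rfl | h
  · rw [Real.sign_of_neg h, abs_of_neg h]; ring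
  · simp
  · rw [Real.sign_of_pos h, abs_of_pos h, one_mul]

lemma sOrder_isOrdered (x : Fin 3 → ℝ) :
    sOrder x 1 ≤ sOrder x 0 ∧ |sOrder x 2| ≤ sOrder x 1 := by
  have h := antitone_sortDesc fun i => |x i|
  have h2 : 0 ≤ sortDesc (fun i => |x i|) 2 := abs_nonneg _
  refine ⟨h (by decide), le_trans ?_ (h (show (1 : Fin 3) ≤ 2 by decide))⟩
  change |Real.sign (x 0 * x 1 * x 2) * sortDesc (fun i => |x i|) 2| ≤ _
  rcases Real.sign_apply_eq (x 0 * x 1 * x 2) with h | h | h <;> rw [h] <;>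
    simp [abs_of_nonneg h2, h2]

/-- The vector `x^s` arises from `x` by a permutation and an even number of sign changes, so that
the Hamiltonians with parameters `x` and `x^s` have the same eigenvalues. -/
lemma exists_perm_eigenvalueVector_sOrder (x : Fin 3 → ℝ) : ∃ σ : Equiv.Perm (Fin 4),
    eigenvalueVector (sOrder x) = eigenvalueVector x ∘ σ := by
  set τ := sortDescPerm fun i => |x i| with hτ
  set z := x ∘ τ with hz
  have ha : ∀ i, sortDesc (fun i => |x i|) i = |z i| := fun i => rfl
  have hanti := antitone_sortDesc fun i => |x i|
  have hprod : x 0 * x 1 * x 2 = z 0 * z 1 * z 2 := by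
    rw [← Fin.prod_univ_three, ← Fin.prod_univ_three, hz]
    exact (Equiv.prod_comp τ x).symm
  obtain ⟨e₀, he₀, hz₀⟩ := exists_abs_eq_mul (z 0)
  obtain ⟨e₁, he₁, hz₁⟩ := exists_abs_eq_mul (z 1)
  have hlast : Real.sign (z 0 * z 1 * z 2) * |z 2| = e₀ * e₁ * z 2 := by
    by_cases h2 : z 2 = 0
    · simp [h2]
    -- `|z 2|` is the smallest of the absolute values, so that none of them vanishes
    have p2 : 0 < |z 2| := abs_pos.2 h2
    have p1 : 0 < |z 1| := p2.trans_le (hanti (show (1 : Fin 3) ≤ 2 by decide))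
    have p0 : 0 < |z 0| := p1.trans_le (hanti (show (0 : Fin 3) ≤ 1 by decide))
    have h := sign_mul_abs (z 0 * z 1 * z 2)
    rw [abs_mul, abs_mul] at h
    have hsq₀ : e₀ * e₀ = 1 := by rcases he₀ with rfl | rfl <;> norm_num
    have hsq₁ : e₁ * e₁ = 1 := by rcases he₁ with rfl | rfl <;> norm_num
    refine mul_left_cancel₀ (mul_pos p0 p1).ne' ?_
    calc _ = Real.sign (z 0 * z 1 * z 2) * (|z 0| * |z 1| * |z 2|) := by ring
      _ = z 0 * z 1 * z 2 := h
      _ = (e₀ * e₀) * (e₁ * e₁) * (z 0 * z 1 * z 2) := by rw [hsq₀, hsq₁]; ring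
      _ = _ := by rw [hz₀, hz₁]; ring
  have hs : sOrder x = ![e₀ * z 0, e₁ * z 1, e₀ * e₁ * z 2] := by
    rw [sOrder, ha, ha, ha, hprod, hlast, hz₀, hz₁]
  obtain ⟨σ₁, h₁⟩ := exists_perm_eigenvalueVector_signs z he₀ he₁
  obtain ⟨σ₂, h₂⟩ := exists_perm_eigenvalueVector_comp τ
  refine ⟨σ₂ * σ₁, ?_⟩
  rw [hs, h₁, hz, h₂]
  rfl

lemma sOrder_of_isOrdered {y : Fin 3 → ℝ} (hy : y 1 ≤ y 0 ∧ |y 2| ≤ y 1) : sOrder y = y := by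
  have h1 : 0 ≤ y 1 := (abs_nonneg _).trans hy.2
  have h0 : 0 ≤ y 0 := h1.trans hy.1
  have hanti : Antitone fun i => |y i| := by
    rw [Fin.antitone_iff_succ_le]
    intro i
    fin_cases i
    · change |y 1| ≤ |y 0|
      rw [abs_of_nonneg h1, abs_of_nonneg h0]; exact hy.1
    · change |y 2| ≤ |y 1|
      rw [abs_of_nonneg h1]; exact hy.2
  have h2 : Real.sign (y 0 * y 1 * y 2) * |y 2| = y 2 := by
    by_cases h : y 2 = 0
    · simp [h]
    have p1 : 0 < y 1 := (abs_pos.2 h).trans_le hy.2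
    have p0 : 0 < y 0 := p1.trans_le hy.1
    have := sign_mul_abs (y 0 * y 1 * y 2)
    rw [abs_mul, abs_mul, abs_of_pos p0, abs_of_pos p1] at this
    refine mul_left_cancel₀ (mul_pos p0 p1).ne' ?_
    linarith
  ext i
  fin_cases i
  · change sortDesc (fun i => |y i|) 0 = y 0
    rw [sortDesc_of_antitone hanti]
    exact abs_of_nonneg h0
  · change sortDesc (fun i => |y i|) 1 = y 1
    rw [sortDesc_of_antitone hanti]
    exact abs_of_nonneg h1
  · change Real.sign (y 0 * y 1 * y 2) * sortDesc (fun i => |y i|) 2 = y 2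
    rw [sortDesc_of_antitone hanti, h2]

lemma sMajorized_iff_isMaj {x y : Fin 3 → ℝ} (hy : y 1 ≤ y 0 ∧ |y 2| ≤ y 1) :
    SMajorized x y ↔ IsMaj (eigenvalueVector x) (eigenvalueVector y) := by
  obtain ⟨σ, hσ⟩ := exists_perm_eigenvalueVector_sOrder x
  rw [← isMaj_comp_perm σ, ← hσ,
    isMaj_iff_of_antitone (antitone_eigenvalueVector (sOrder_isOrdered x)), sum_eigenvalueVector,
    sum_eigenvalueVector, SMajorized, sOrder_of_isOrdered hy]
  have i0 : Finset.Iic (0 : Fin 4) = {0} := by decide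
  have i1 : Finset.Iic (1 : Fin 4) = {0, 1} := by decide
  have i2 : Finset.Iic (2 : Fin 4) = {0, 1, 2} := by decide
  have i3 : Finset.Iic (3 : Fin 4) = {0, 1, 2, 3} := by decide
  simp only [and_true]
  constructor
  · rintro ⟨a, b, c⟩ k
    fin_cases k
    · simp [i0, eigenvalueVector]; linarith
    · simp [i1, eigenvalueVector]; linarith
    · simp [i2, eigenvalueVector]; linarith
    · simp [i3, eigenvalueVector]; linarith
  · intro h
    have h0 := h 0
    have h1 := h 1
    have h2 := h 2
    simp [i0, eigenvalueVector] at h0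
    simp [i1, eigenvalueVector] at h1
    simp [i2, eigenvalueVector] at h2
    exact ⟨by linarith, by linarith, by linarith⟩

/-- The integrated canonical parameters are themselves ordered. -/
lemma integral_canonicalParameters_isOrdered {M : ℝ → Matrix (Fin 3) (Fin 3) ℝ} {T : ℝ}
    (hT : 0 ≤ T) (hM : ∀ i j, IntervalIntegrable (fun t => M t i j) volume 0 T) :
    (∫ t in (0 : ℝ)..T, canonicalParameters (nonlocalHamiltonian (M t)) 1) ≤
        (∫ t in (0 : ℝ)..T, canonicalParameters (nonlocalHamiltonian (M t)) 0) ∧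
      |∫ t in (0 : ℝ)..T, canonicalParameters (nonlocalHamiltonian (M t)) 2| ≤
        ∫ t in (0 : ℝ)..T, canonicalParameters (nonlocalHamiltonian (M t)) 1 := by
  have hi := intervalIntegrable_canonicalParameters hM
  refine ⟨intervalIntegral.integral_mono_on hT (hi 1) (hi 0)
    fun t _ => (canonicalParameters_spec (M t)).1.1, ?_⟩
  exact (intervalIntegral.abs_integral_le_integral_abs hT).trans
    (intervalIntegral.integral_mono_on hT (hi 2).abs (hi 1)
      fun t _ => (canonicalParameters_spec (M t)).1.2)

lemma eigenvalueVector_integral {M : ℝ → Matrix (Fin 3) (Fin 3) ℝ} {T : ℝ}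
    (hM : ∀ i j, IntervalIntegrable (fun t => M t i j) volume 0 T) :
    eigenvalueVector (fun i => ∫ t in (0 : ℝ)..T, canonicalParameters (nonlocalHamiltonian (M t)) i)
      = spectrumIntegral M T := by
  have hi := intervalIntegrable_canonicalParameters hM
  let E : (Fin 3 → ℝ) →ₗ[ℝ] (Fin 4 → ℝ) :=
    { toFun := eigenvalueVector
      map_add' := fun x y => by
        ext k; fin_cases k <;> simp [eigenvalueVector] <;> ring
      map_smul' := fun c x => by
        ext k; fin_cases k <;> simp [eigenvalueVector] <;> ring }
  have hE : ∀ x k, eigenvalueVector x k = ∑ i, E (Pi.single i 1) k * x i := by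
    intro x k
    have h := congrFun (LinearMap.pi_apply_eq_sum_univ E x) k
    rw [Finset.sum_apply] at h
    refine Eq.trans h (Finset.sum_congr rfl fun i _ => ?_)
    have hsingle : (Pi.single i 1 : Fin 3 → ℝ) = fun j => if i = j then 1 else 0 := by
      ext j
      simp [Pi.single_apply, eq_comm]
    rw [Pi.smul_apply, smul_eq_mul, mul_comm, hsingle]
  ext k
  simp only [spectrumIntegral, spectrumVec, hE]
  rw [intervalIntegral.integral_finsetSum fun i _ => (hi i).const_mul _]
  simp only [intervalIntegral.integral_const_mul]

/-- Every vector of sum `0` is the eigenvalue vector of some parameters. -/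
lemma exists_eigenvalueVector_eq {b : Fin 4 → ℝ} (hb : ∑ i, b i = 0) :
    ∃ β, eigenvalueVector β = b := by
  rw [Fin.sum_univ_four] at hb
  refine ⟨![(b 0 + b 1) / 2, (b 0 + b 2) / 2, (b 1 + b 2) / 2], ?_⟩
  ext k
  fin_cases k <;> simp [eigenvalueVector] <;> linarith

end
end TwoQubit

theorem mainTheorem1 {m : ℕ}
    -- control Hamiltonians generating the local unitary operations
    (H : Fin m → Matrix (Fin 4) (Fin 4) ℂ) (hH : TwoQubit.GenerateLocalUnitaries H)
    -- time horizon and integrable time-varying coupling tensor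
    (T : ℝ) (hT : 0 < T) (M : ℝ → Matrix (Fin 3) (Fin 3) ℝ)
    (hM : ∀ i j, IntervalIntegrable (fun t => M t i j) MeasureTheory.volume 0 T) :
    let Hd : ℝ → Matrix (Fin 4) (Fin 4) ℂ := fun t => TwoQubit.nonlocalHamiltonian (M t)
    let θ : ℝ → Fin 3 → ℝ := fun t => TwoQubit.canonicalParameters (Hd t)
    let lam : ℝ → Fin 4 → ℝ := fun t => TwoQubit.eigenvalueVector (θ t)
    -- the canonical parameters exist and are integrable
    (∀ t, TwoQubit.IsCanonicalParameters (Hd t) (θ t)) ∧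
    (∀ i, IntervalIntegrable (fun t => θ t i) MeasureTheory.volume 0 T) ∧
    -- the reachable set
    TwoQubit.reachableWithin Hd H T =
      {U | ∃ K₁ ∈ TwoQubit.localUnitaries, ∃ K₂ ∈ TwoQubit.localUnitaries, ∃ β : Fin 3 → ℝ,
        TwoQubit.SMajorized β (fun i => ∫ t in (0 : ℝ)..T, θ t i) ∧
        U = K₁ * TwoQubit.canonicalUnitary β * K₂} ∧
    -- in the magic basis, the Hamiltonian is `Kᵀ D_λ K` with `K ∈ SO(4)`
    (∀ t, ∃ K ∈ TwoQubit.SO4,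
      TwoQubit.inMagicBasis (Hd t) = K.transpose * TwoQubit.diag (lam t) * K) ∧
    -- the reachable set in the magic basis
    TwoQubit.inMagicBasis '' TwoQubit.reachableWithin Hd H T =
      {V | ∃ R ∈ TwoQubit.SO4, ∃ S ∈ TwoQubit.SO4, ∃ β : Fin 4 → ℝ,
        TwoQubit.Majorized β (fun k => ∫ t in (0 : ℝ)..T, lam t k) ∧
        V = R * NormedSpace.exp ((-Complex.I) • TwoQubit.diag β) * S} := by
  intro Hd θ lam
  have hHd : TwoQubit.inMagicBasis '' TwoQubit.reachableWithin Hd H T =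
      TwoQubit.kakSet (TwoQubit.spectrumIntegral M T) :=
    TwoQubit.inMagicBasis_image_reachableWithin hH hT hM
  have hanti : Antitone (TwoQubit.spectrumIntegral M T) := by
    rw [← TwoQubit.eigenvalueVector_integral hM]
    exact TwoQubit.antitone_eigenvalueVector
      (TwoQubit.integral_canonicalParameters_isOrdered hT.le hM)
  have hmaj : ∀ β : Fin 3 → ℝ, TwoQubit.SMajorized β (fun i => ∫ t in (0 : ℝ)..T, θ t i) ↔
      TwoQubit.IsMaj (TwoQubit.eigenvalueVector β) (TwoQubit.spectrumIntegral M T) := by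
    intro β
    rw [← TwoQubit.eigenvalueVector_integral hM]
    exact TwoQubit.sMajorized_iff_isMaj
      (TwoQubit.integral_canonicalParameters_isOrdered hT.le hM)
  have hsum : ∑ k, TwoQubit.spectrumIntegral M T k = 0 := by
    rw [← TwoQubit.eigenvalueVector_integral hM, TwoQubit.sum_eigenvalueVector]
  refine ⟨fun t => TwoQubit.canonicalParameters_spec (M t),
    TwoQubit.intervalIntegrable_canonicalParameters hM, ?_,
    fun t => (TwoQubit.isSpec_spectrumVec (M t)).2, ?_⟩
  · obtain ⟨L, hL, hLβ⟩ := TwoQubit.inMagicBasis_canonicalUnitary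
    have hLt := TwoQubit.transpose_mem_SO4 hL
    refine Subset.antisymm (fun U hU => ?_) ?_
    · -- the rotation `L` between the two orders of the eigenvalues is absorbed by the local factors
      obtain ⟨R, hR, S, hS, b, hb, hX⟩ := hHd ▸ mem_image_of_mem TwoQubit.inMagicBasis hU
      obtain ⟨β, rfl⟩ := TwoQubit.exists_eigenvalueVector_eq (hb.2.trans hsum)
      refine ⟨TwoQubit.ofMagicBasis (R * L.transpose),
        TwoQubit.ofMagicBasis_mem_local (TwoQubit.mul_mem_SO4 hR hLt),
        TwoQubit.ofMagicBasis (L * S),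
        TwoQubit.ofMagicBasis_mem_local (TwoQubit.mul_mem_SO4 hL hS), β, (hmaj β).2 hb, ?_⟩
      rw [← TwoQubit.ofMagicBasis_inMagicBasis (TwoQubit.canonicalUnitary β), hLβ,
        ← TwoQubit.ofMagicBasis_mul, ← TwoQubit.ofMagicBasis_mul,
        ← TwoQubit.ofMagicBasis_inMagicBasis U, hX]
      congr 1
      calc _ = R * (L.transpose * L) * TwoQubit.phase (TwoQubit.eigenvalueVector β) *
            (L.transpose * L) * S := by rw [TwoQubit.SO4_transpose_mul hL, mul_one, mul_one]
        _ = _ := by simp only [mul_assoc]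
    · rintro _ ⟨K₁, hK₁, K₂, hK₂, β, hβ, rfl⟩
      have hmem : TwoQubit.inMagicBasis (K₁ * TwoQubit.canonicalUnitary β * K₂) ∈
          TwoQubit.kakSet (TwoQubit.spectrumIntegral M T) := by
        refine ⟨TwoQubit.inMagicBasis K₁ * L,
          TwoQubit.mul_mem_SO4 (TwoQubit.inMagicBasis_mem_SO4 hK₁) hL,
          L.transpose * TwoQubit.inMagicBasis K₂,
          TwoQubit.mul_mem_SO4 hLt (TwoQubit.inMagicBasis_mem_SO4 hK₂), _, (hmaj β).1 hβ, ?_⟩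
        rw [TwoQubit.inMagicBasis_mul, TwoQubit.inMagicBasis_mul, hLβ]
        simp only [mul_assoc]
      rw [← hHd] at hmem
      obtain ⟨U, hU, hUe⟩ := hmem
      have := congrArg TwoQubit.ofMagicBasis hUe
      rw [TwoQubit.ofMagicBasis_inMagicBasis, TwoQubit.ofMagicBasis_inMagicBasis] at this
      exact this ▸ hU
  · rw [hHd]
    ext V
    simp only [TwoQubit.kakSet, mem_ofPred_eq, ← TwoQubit.majorized_iff_isMaj hanti]
    rfl
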